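/- Let $L,H>0$, let $D:=\mathbb T_L\times(0,H)$ with $\mathbb T_L=\mathbb R/L\mathbb Z$ be a finite periodic channel with points $\mathbf x=(x_1,x_2)$, and let $1<p<\infty$. Let $\mathcal G$ be the inverse of $-\Delta$ in $D$ subject to zero Dirichlet boundary conditions on $\{x_2=0\}\cup\{x_2=H\}$: for $v\in L^p(D)$, $\mathcal Gv$ is the unique $u\in L^1(D)$ with $\int_D u\,(-\Delta\varphi)\,d\mathbf x=\int_D v\varphi\,d\mathbf x$ for all $\varphi\in C^\infty(\overline D)$ with $\varphi=0$ on $\partial D$. For $v\in L^p(D)$ define \[E(v):=\frac12\int_D v\,\mathcal Gv\,d\mathbf x,\qquad I(v):=\int_D x_2v\,d\mathbf x,\] \[\mathcal R_v:=\{u\in L^p(D)\mid |\{u>a\}|=|\{v>a\}|\ \ \forall a\in\mathbb R\},\qquad \mathcal I_v:=\{u\in L^p(D)\mid I(u)=I(v)\},\] where $|\cdot|$ is Lebesgue measure. Fix $w\in L^p(D)$ and let $\mathcal M$ be the set of maximizers of $E$ over $\mathcal R_w\cap\mathcal I_w$. A map $\zeta:\mathbb R\to L^p(D)$ is called admissible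 if $E(\zeta(t))=E(\zeta(0))$, $I(\zeta(t))=I(\zeta(0))$ and $\zeta(t)\in\mathcal R_{\zeta(0)}$ for all $t\in\mathbb R$. Then the following hold (in particular, all the minima of distances appearing below are attained). (i) For any $\varepsilon>0$ there exists $\delta>0$ such that for any admissible map $\zeta$, \[\min_{v\in\mathcal M}\|\zeta(0)-v\|_{L^p(D)}<\delta\quad\Longrightarrow\quad\min_{v\in\mathcal M}\|\zeta(t)-v\|_{L^p(D)}<\varepsilon\quad\forall\,t\in\mathbb R.\] (ii) Let $\mathcal S$ be a nonempty subset of $\mathcal M$ that is isolated in $\mathcal M$, i.e., there is $c>0$ with $\|v_1-v_2\|_{L^p(D)}\ge c$ for all $v_1\in\mathcal S$ and $v_2\in\mathcal M\setminus\mathcal S$. Then for any $\varepsilon>0$ there exists $\delta>0$ such that for any admissible map $\zeta$ that is continuous from $\mathbb R$ to $L^p(D)$, \[\min_{v\in\mathcal S}\|\zeta(0)-v\|_{L^p(D)}<\delta\quad\Longrightarrow\quad\min_{v\in\mathcal S}\|\zeta(t)-v\|_{L^p(D)}<\varepsilon\quad\forall\,t\in\mathbb R.\] -/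

import Mathlib

open MeasureTheory Set
open scoped ENNReal ContDiff

noncomputable section

namespace PeriodicChannel

/-- Lebesgue measure on the finite periodic channel `D = 𝕋_L × (0, H)`, as a measure on
`𝕋_L × ℝ` carried by `D`; the circle `𝕋_L = ℝ / Lℤ` has length `L`. -/
def channelMeasure (L H : ℝ) [Fact (0 < L)] : Measure (AddCircle L × ℝ) :=
  (volume : Measure (AddCircle L)).prod ((volume : Measure ℝ).restrict (Ioo 0 H))

/-- The space `L^p(D)`. -/
abbrev LpChannel (L H : ℝ) [Fact (0 < L)] (p : ℝ≥0∞) : Type :=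
  Lp ℝ p (channelMeasure L H)

/-- The Laplacian `∂₁² φ + ∂₂² φ` of a function on `𝕋_L × ℝ`. -/
def laplacian {L : ℝ} (φ : AddCircle L × ℝ → ℝ) (x : AddCircle L × ℝ) : ℝ :=
  iteratedDeriv 2 (fun s : ℝ => φ (x.1 + (s : AddCircle L), x.2)) 0 +
    iteratedDeriv 2 (fun s : ℝ => φ (x.1, s)) x.2

/-- Test functions for the Dirichlet problem: functions that are smooth up to the boundary of
`D`, periodic in `x₁`, and vanish on the two boundary components `x₂ = 0` and `x₂ = H`. -/
structure IsDirichletTest {L : ℝ} (H : ℝ) (φ : AddCircle L × ℝ → ℝ) : Prop where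
  smooth : ContDiff ℝ ∞ (fun y : ℝ × ℝ => φ ((y.1 : AddCircle L), y.2))
  bottom : ∀ x₁ : AddCircle L, φ (x₁, 0) = 0
  top : ∀ x₁ : AddCircle L, φ (x₁, H) = 0

/-- `u` is a weak solution of `-Δ u = v` in `D`, `u = 0` on `x₂ = 0` and on `x₂ = H`:
`u ∈ L¹(D)` and `∫_D u (-Δ φ) = ∫_D v φ` for all `φ` that are smooth up to the boundary and
vanish there. The boundary condition on `u` is encoded by the test functions not being required
to have vanishing normal derivative. -/
structure IsDirichletSolution {L : ℝ} [Fact (0 < L)] (H : ℝ)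
    (v u : AddCircle L × ℝ → ℝ) : Prop where
  integrable : Integrable u (channelMeasure L H)
  weak_eq : ∀ φ : AddCircle L × ℝ → ℝ, IsDirichletTest H φ →
    ∫ x, u x * (-laplacian φ x) ∂(channelMeasure L H) = ∫ x, v x * φ x ∂(channelMeasure L H)

open Classical in
/-- `𝒢`, the inverse of `-Δ` in `D` subject to zero Dirichlet boundary conditions (the solution
is unique up to modification on a null set). -/
def inverseLaplacian {L : ℝ} [Fact (0 < L)] (H : ℝ) (v : AddCircle L × ℝ → ℝ) :
    AddCircle L × ℝ → ℝ :=
  if h : ∃ u, IsDirichletSolution H v u then h.choose else 0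

/-- The energy `E(v) = ½ ∫_D v 𝒢v dx`. -/
def energy {L H : ℝ} [Fact (0 < L)] {p : ℝ≥0∞} (v : LpChannel L H p) : ℝ :=
  (1 / 2) * ∫ x, v x * inverseLaplacian H v x ∂(channelMeasure L H)

/-- The impulse `I(v) = ∫_D x₂ v dx`. -/
def impulse {L H : ℝ} [Fact (0 < L)] {p : ℝ≥0∞} (v : LpChannel L H p) : ℝ :=
  ∫ x, x.2 * v x ∂(channelMeasure L H)

/-- The rearrangement class `ℛ_w`. A rearrangement of an `L^p` function is again in `L^p`,
so nothing is lost by taking it inside `L^p(D)`. -/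
def rearrangementClass {L H : ℝ} [Fact (0 < L)] {p : ℝ≥0∞} (w : LpChannel L H p) :
    Set (LpChannel L H p) :=
  {v | ∀ a : ℝ, channelMeasure L H {x | a < v x} = channelMeasure L H {x | a < w x}}

/-- The elements of `L^p(D)` with the same impulse as `w`. -/
def impulseClass {L H : ℝ} [Fact (0 < L)] {p : ℝ≥0∞} (w : LpChannel L H p) :
    Set (LpChannel L H p) :=
  {v | impulse v = impulse w}

/-- The set `ℳ` of maximizers of `E` over `ℛ_w ∩ ℐ_w`. -/
def maximizers {L H : ℝ} [Fact (0 < L)] {p : ℝ≥0∞} (w : LpChannel L H p) :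
    Set (LpChannel L H p) :=
  {v | v ∈ rearrangementClass w ∩ impulseClass w ∧
    ∀ v' ∈ rearrangementClass w ∩ impulseClass w, energy v' ≤ energy v}

/-- Admissible maps `ζ : ℝ → L^p(D)`. -/
structure IsAdmissible {L H : ℝ} [Fact (0 < L)] {p : ℝ≥0∞} (ζ : ℝ → LpChannel L H p) :
    Prop where
  energy_eq : ∀ t, energy (ζ t) = energy (ζ 0)
  impulse_eq : ∀ t, impulse (ζ t) = impulse (ζ 0)
  rearrangement : ∀ t, ζ t ∈ rearrangementClass (ζ 0)

/-- `m = min_{v ∈ A} ‖u - v‖_{L^p(D)}`; in particular the minimum is attained. -/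
def IsMinDist {L H : ℝ} [Fact (0 < L)] {p : ℝ≥0∞} (A : Set (LpChannel L H p))
    (u : LpChannel L H p) (m : ℝ) : Prop :=
  IsLeast ((fun v => ‖u - v‖) '' A) m

end PeriodicChannel

end

/-! The constraint set is not weakly closed, so it is enlarged to the convex set `relaxedClass`:
functions majorized by `w` in the Hardy–Littlewood–Pólya order, with the impulse of `w`.
Majorization is expressed by the integrated excesses ∫(v−a)₊ together with equality of means. It
passes to weak limits, controls `L^p` norms, and becomes equality of distribution functions when all
excesses agree.

The energy is weakly continuous on bounded sets, so it attains its maximum over the relaxed set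
(`exists_isMax_relaxedClass`). It is also a positive definite quadratic form, hence strictly convex.
If a relaxed maximizer `v` were not a rearrangement, the majorization would be strict around some
level near which `v` takes values on a set of positive measure. On that set a small bounded function
`h` with zero mean and zero impulse can be added or subtracted, and E(v+h)+E(v−h)=2E(v)+2E(h)
contradicts maximality (`mem_rearrangementClass_of_isMax`). Thus every relaxed maximizer lies in ℳ
and relaxation does not raise the maximum.

Compactness follows (`exists_tendsto_maximizer`): take rearrangements of a family converging in
`L^p` to a maximizer `W`, with energy and impulse tending to those of `W`. A weak limit is a relaxed
maximizer, hence a rearrangement of `W`, and weak convergence to a function with the limiting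
distribution is strong. Part (i) is a contradiction argument from this; part (ii) adds connectedness
of the time axis.

The properties of 𝒢 are obtained by separation of variables. The Dirichlet modes are complete in
`L¹`, which gives uniqueness and definiteness. For existence, 𝒢 is a sum over transverse wave
numbers of operators bounded from `L^p` to `L^∞` with summable norms (`exists_abs_greenOp_le`),
which also yields weak continuity of the energy. -/

noncomputable section

namespace PeriodicChannel

open Filter Topology ProbabilityTheory

/-! ### Integrated excesses and the Hardy–Littlewood–Pólya order. -/

section Majorization

variable {X : Type*} [MeasurableSpace X] {μ : Measure X}

/-- The integrated excess `∫ (f - a)₊` of `f` over the level `a`. -/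
def stopLoss (μ : Measure X) (f : X → ℝ) (a : ℝ) : ℝ := ∫ x, max (f x - a) 0 ∂μ

/-- The Hardy–Littlewood–Pólya order: `v` is majorized by `w`. -/
structure Majorized (μ : Measure X) (v w : X → ℝ) : Prop where
  integrable_left : Integrable v μ
  integrable_right : Integrable w μ
  integral_eq : ∫ x, v x ∂μ = ∫ x, w x ∂μ
  stopLoss_le : ∀ a, stopLoss μ v a ≤ stopLoss μ w a

theorem majorized_of_identDistrib {v w : X → ℝ} (h : IdentDistrib v w μ μ)
    (hw : Integrable w μ) : Majorized μ v w where
  integrable_left := h.integrable_iff.2 hw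
  integrable_right := hw
  integral_eq := h.integral_eq
  stopLoss_le a := by
    have hm : Measurable fun s : ℝ => max (s - a) 0 := by fun_prop
    exact (h.comp hm).integral_eq.le

variable [IsFiniteMeasure μ]

theorem integrable_excess {f : X → ℝ} (hf : Integrable f μ) (a : ℝ) :
    Integrable (fun x => max (f x - a) 0) μ :=
  (hf.sub (integrable_const a)).pos_part

theorem abs_stopLoss_sub_le {f g : X → ℝ} (hf : Integrable f μ) (hg : Integrable g μ) (a : ℝ) :
    |stopLoss μ f a - stopLoss μ g a| ≤ ∫ x, |f x - g x| ∂μ := by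
  unfold stopLoss
  rw [← integral_sub (integrable_excess hf a) (integrable_excess hg a)]
  refine (abs_integral_le_integral_abs).trans (integral_mono
    ((integrable_excess hf a).sub (integrable_excess hg a)).abs (hf.sub hg).abs fun x => ?_)
  have := abs_max_sub_max_le_abs (f x - a) (g x - a) 0
  simpa using this

theorem continuous_stopLoss {f : X → ℝ} (hf : Integrable f μ) : Continuous (stopLoss μ f) := by
  refine LipschitzWith.continuous (K := (μ.real univ).toNNReal) (LipschitzWith.of_dist_le_mul ?_)
  intro a b
  rw [Real.dist_eq, Real.dist_eq, Real.coe_toNNReal _ measureReal_nonneg]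
  unfold stopLoss
  rw [← integral_sub (integrable_excess hf a) (integrable_excess hf b)]
  refine (abs_integral_le_integral_abs).trans ?_
  calc ∫ x, |max (f x - a) 0 - max (f x - b) 0| ∂μ ≤ ∫ _, |a - b| ∂μ := by
        refine integral_mono ((integrable_excess hf a).sub (integrable_excess hf b)).abs
          (integrable_const _) fun x => ?_
        have := abs_max_sub_max_le_abs (f x - a) (f x - b) 0
        simpa [abs_sub_comm] using this
    _ = _ := by simp

theorem tendsto_stopLoss_atTop {f : X → ℝ} (hf : Integrable f μ) :
    Tendsto (stopLoss μ f) atTop (𝓝 0) := by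
  have h0 : (0 : ℝ) = ∫ x, (0 : ℝ) ∂μ := by simp
  rw [h0]
  refine tendsto_integral_filter_of_dominated_convergence (fun x => |f x|)
    (Eventually.of_forall fun a => (integrable_excess hf a).aestronglyMeasurable) ?_ hf.abs ?_
  · filter_upwards [eventually_ge_atTop 0] with a ha
    refine Eventually.of_forall fun x => ?_
    rw [Real.norm_of_nonneg (le_max_right _ _)]
    exact max_le (by linarith [le_abs_self (f x)]) (abs_nonneg _)
  · refine Eventually.of_forall fun x => tendsto_const_nhds.congr' ?_
    filter_upwards [eventually_ge_atTop (f x)] with a ha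
    rw [max_eq_right (by linarith)]

/-- This is s₊ − (−s)₊ = s integrated. It transfers facts about high levels to low levels, and it is
where the equality of means in `Majorized` is needed. -/
theorem stopLoss_neg {f : X → ℝ} (hf : Integrable f μ) (a : ℝ) :
    stopLoss μ (fun x => -f x) a = stopLoss μ f (-a) - ∫ x, f x ∂μ - a * μ.real univ := by
  unfold stopLoss
  have h : ∀ x, max (-f x - a) 0 = max (f x - -a) 0 - (f x + a) := by
    intro x
    rcases le_total 0 (f x + a) with h | h
    · rw [max_eq_right (by linarith), max_eq_left (by linarith)]; ring
    · rw [max_eq_left (by linarith), max_eq_right (by linarith)]; ring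
  simp_rw [h]
  have ha : Integrable (fun x => f x + a) μ := hf.add (integrable_const a)
  rw [integral_sub (integrable_excess hf _) ha, integral_add hf (integrable_const a)]
  simp
  ring

theorem Majorized.neg {v w : X → ℝ} (h : Majorized μ v w) :
    Majorized μ (fun x => -v x) (fun x => -w x) where
  integrable_left := h.integrable_left.neg
  integrable_right := h.integrable_right.neg
  integral_eq := by rw [integral_neg, integral_neg, h.integral_eq]
  stopLoss_le a := by
    rw [stopLoss_neg h.integrable_left, stopLoss_neg h.integrable_right, h.integral_eq]
    linarith [h.stopLoss_le (-a)]

/-- The deficit between the integrated excesses vanishes at both ends. -/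
theorem Majorized.tendsto_deficit {v w : X → ℝ} (h : Majorized μ v w) :
    Tendsto (fun a => stopLoss μ w a - stopLoss μ v a) (cocompact ℝ) (𝓝 0) := by
  rw [cocompact_eq_atBot_atTop, tendsto_sup]
  constructor
  -- At −∞ each excess diverges when μ ≠ 0, but with equal means the deficit equals a difference of
  -- excesses of −w and −v at level −a, which tend to zero.
  · have h1 : Tendsto (fun a => stopLoss μ (fun x => -w x) (-a) - stopLoss μ (fun x => -v x) (-a))
        atBot (𝓝 (0 - 0)) :=
      (((tendsto_stopLoss_atTop h.integrable_right.neg).comp tendsto_neg_atBot_atTop).sub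
        ((tendsto_stopLoss_atTop h.integrable_left.neg).comp tendsto_neg_atBot_atTop))
    rw [sub_zero] at h1
    refine h1.congr fun a => ?_
    rw [stopLoss_neg h.integrable_left, stopLoss_neg h.integrable_right, h.integral_eq, neg_neg]
    ring
  · simpa using (tendsto_stopLoss_atTop h.integrable_right).sub
      (tendsto_stopLoss_atTop h.integrable_left)

/-- If `v` is majorized by `w` but has a different integrated excess, then there is a level
around which the majorization is strict and near which `v` takes its values on a set of
positive measure. -/
theorem Majorized.exists_slack {v w : X → ℝ} (h : Majorized μ v w)
    (hne : ∃ a, stopLoss μ v a ≠ stopLoss μ w a) :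
    ∃ a r η : ℝ, 0 < r ∧ 0 < η ∧
      (∀ b, |b - a| < 2 * r → stopLoss μ v b + η ≤ stopLoss μ w b) ∧
      μ {x | |v x - a| < r} ≠ 0 := by
  set g : ℝ → ℝ := fun a => stopLoss μ w a - stopLoss μ v a with hg
  have hgc : Continuous g :=
    (continuous_stopLoss h.integrable_right).sub (continuous_stopLoss h.integrable_left)
  have hg0 : Tendsto g (cocompact ℝ) (𝓝 0) := h.tendsto_deficit
  by_contra! hcon
  -- Denying the conclusion means that `v` avoids a neighbourhood of every level with positive
  -- deficit. The radius is halved because the slack is required on an interval of twice the radius.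
  have key : ∀ a, 0 < g a → ∃ r > 0, μ {x | |v x - a| < r} = 0 := by
    intro a ha
    have hnear : ∀ᶠ b in 𝓝 a, g a / 2 < g b := hgc.continuousAt.eventually_const_lt (by linarith)
    obtain ⟨ρ, hρ, hb⟩ := Metric.eventually_nhds_iff.1 hnear
    refine ⟨ρ / 2, by linarith, hcon a (ρ / 2) (g a / 2) (by linarith) (by linarith) ?_⟩
    intro b hba
    have := hb (y := b) (by rw [Real.dist_eq]; linarith)
    simp only [hg] at this ⊢
    linarith
  obtain ⟨a₁, ha₁⟩ := hne
  have hpos : 0 < g a₁ := by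
    have := h.stopLoss_le a₁
    simp only [hg]
    rcases this.lt_or_eq with h | h
    · linarith
    · exact absurd h ha₁
  obtain ⟨a₀, ha₀⟩ := hgc.exists_forall_ge' a₁
    ((hg0.eventually_lt_const hpos).mono fun x hx => hx.le)
  have hM : 0 < g a₀ := hpos.trans_le (ha₀ a₁)
  -- Near a maximum point `v` takes no values, so its excess is affine there, while that of `w` is
  -- convex. The deficit is then midpoint convex about a maximum, hence locally constant. By
  -- connectedness it is constant and positive, against its decay at infinity.
  have hopen : IsOpen {a | g a = g a₀} := by
    rw [Metric.isOpen_iff]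
    intro a ha
    have ha : g a = g a₀ := ha
    obtain ⟨r, hr, hnull⟩ := key a (ha ▸ hM)
    refine ⟨r, hr, fun b hb => ?_⟩
    rw [Metric.mem_ball, Real.dist_eq] at hb
    set s := b - a with hs
    have hbs : b = a + s := by rw [hs]; ring
    have hv : stopLoss μ v (a + s) + stopLoss μ v (a - s) = 2 * stopLoss μ v a := by
      unfold stopLoss
      rw [← integral_add (integrable_excess h.integrable_left _)
        (integrable_excess h.integrable_left _), ← integral_const_mul]
      refine integral_congr_ae ?_
      have : ∀ᵐ x ∂μ, ¬ |v x - a| < r := by rw [ae_iff]; simpa using hnull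
      filter_upwards [this] with x hx
      simp only [not_lt] at hx
      have h1 := neg_abs_le s
      have h2 := le_abs_self s
      rcases le_abs'.1 hx with h | h
      · rw [max_eq_right (by linarith), max_eq_right (by linarith), max_eq_right (by linarith)]
        ring
      · rw [max_eq_left (by linarith), max_eq_left (by linarith), max_eq_left (by linarith)]
        ring
    have hw : 2 * stopLoss μ w a ≤ stopLoss μ w (a + s) + stopLoss μ w (a - s) := by
      unfold stopLoss
      rw [← integral_add (integrable_excess h.integrable_right _)
        (integrable_excess h.integrable_right _), ← integral_const_mul]
      refine integral_mono ((integrable_excess h.integrable_right _).const_mul _)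
        ((integrable_excess h.integrable_right _).add (integrable_excess h.integrable_right _))
        fun x => ?_
      have h1 := le_max_left (w x - (a + s)) 0
      have h2 := le_max_left (w x - (a - s)) 0
      have h3 := le_max_right (w x - (a + s)) 0
      have h4 := le_max_right (w x - (a - s)) 0
      simp only
      rcases max_cases (w x - a) 0 with h5 | h5 <;> linarith
    have h1 := ha₀ (a + s)
    have h2 := ha₀ (a - s)
    show g b = g a₀
    rw [hbs]
    simp only [hg] at h1 h2 ha ⊢
    linarith
  have huniv := (isClopen_iff.1 ⟨isClosed_eq hgc continuous_const, hopen⟩).resolve_left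
    (Set.nonempty_iff_ne_empty.1 ⟨a₀, rfl⟩)
  have hconst : Tendsto g (cocompact ℝ) (𝓝 (g a₀)) :=
    tendsto_const_nhds.congr fun a => ((eq_univ_iff_forall.1 huniv a : g a = g a₀)).symm
  exact hM.ne' (tendsto_nhds_unique hconst hg0)

/-- Small mean-free perturbations supported where the majorization has slack preserve it. -/
theorem Majorized.add_of_slack {v w k : X → ℝ} (h : Majorized μ v w) {a r η : ℝ}
    (hslack : ∀ b, |b - a| < 2 * r → stopLoss μ v b + η ≤ stopLoss μ w b)
    (hk : Integrable k μ) (hkr : ∀ x, |k x| ≤ r) (hks : ∀ x, ¬ |v x - a| < r → k x = 0)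
    (hk0 : ∫ x, k x ∂μ = 0) (hkη : ∫ x, |k x| ∂μ ≤ η) :
    Majorized μ (fun x => v x + k x) w where
  integrable_left := h.integrable_left.add hk
  integrable_right := h.integrable_right
  integral_eq := by rw [integral_add h.integrable_left hk, hk0, add_zero, h.integral_eq]
  stopLoss_le b := by
    -- For levels within 2r of a, the slack η absorbs the `L¹` size of k. For other levels, wherever
    -- k can be nonzero both v and v + k stay on one side of b, so the excess changes by ∫k = 0 or
    -- not at all.
    by_cases hb : |b - a| < 2 * r
    · have h1 := abs_stopLoss_sub_le (h.integrable_left.add hk) h.integrable_left b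
      simp only [Pi.add_apply, add_sub_cancel_left] at h1
      have h2 := le_abs_self (stopLoss μ (v + k) b - stopLoss μ v b)
      have h3 := hslack b hb
      change stopLoss μ (v + k) b ≤ _
      linarith
    · have : stopLoss μ (fun x => v x + k x) b = stopLoss μ v b := by
        rw [not_lt, le_abs'] at hb
        unfold stopLoss
        rcases hb with hb | hb
        · have : ∀ x, max (v x + k x - b) 0 = max (v x - b) 0 + k x := by
            intro x
            by_cases hx : |v x - a| < r
            · have h1 := abs_lt.1 hx
              have h2 := abs_le.1 (hkr x)
              rw [max_eq_left (by linarith), max_eq_left (by linarith)]; ring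
            · rw [hks x hx]; simp
          simp_rw [this]
          rw [integral_add (integrable_excess h.integrable_left _) hk, hk0, add_zero]
        · refine integral_congr_ae (Eventually.of_forall fun x => ?_)
          by_cases hx : |v x - a| < r
          · have h1 := abs_lt.1 hx
            have h2 := abs_le.1 (hkr x)
            simp only
            rw [max_eq_right (by linarith), max_eq_right (by linarith)]
          · simp [hks x hx]
      rw [this]; exact h.stopLoss_le b

/-- The integrated excess determines the distribution function. -/
theorem measure_lt_eq_of_stopLoss_eq {v w : X → ℝ} (hv : Integrable v μ) (hw : Integrable w μ)
    (h : ∀ a, stopLoss μ v a = stopLoss μ w a) (a : ℝ) : μ {x | a < v x} = μ {x | a < w x} := by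
  -- The right derivative of the excess at a is −μ{f > a}; the difference quotients are bounded by
  -- 1, so dominated convergence applies.
  have key : ∀ f : X → ℝ, Integrable f μ →
      Tendsto (fun n : ℕ => ((n : ℝ) + 1) * (stopLoss μ f a - stopLoss μ f (a + 1 / ((n : ℝ) + 1))))
        atTop (𝓝 (μ.real {x | a < f x})) := by
    intro f hf
    have hms : NullMeasurableSet {x | a < f x} μ :=
      nullMeasurableSet_lt aemeasurable_const hf.aemeasurable
    have e1 : μ.real {x | a < f x} = ∫ x, {x | a < f x}.indicator (fun _ => (1 : ℝ)) x ∂μ := by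
      rw [integral_indicator₀ hms]; simp
    rw [e1]
    have e2 : ∀ n : ℕ, ((n : ℝ) + 1) * (stopLoss μ f a - stopLoss μ f (a + 1 / ((n : ℝ) + 1))) =
        ∫ x, ((n : ℝ) + 1) * (max (f x - a) 0 - max (f x - (a + 1 / ((n : ℝ) + 1))) 0) ∂μ := by
      intro n
      rw [integral_const_mul, integral_sub (integrable_excess hf _) (integrable_excess hf _)]
      rfl
    simp_rw [e2]
    refine tendsto_integral_of_dominated_convergence (fun _ => (1 : ℝ))
      (fun n => (((integrable_excess hf _).sub
        (integrable_excess hf _)).const_mul _).aestronglyMeasurable)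
      (integrable_const _) (fun n => Eventually.of_forall fun x => ?_)
      (Eventually.of_forall fun x => ?_)
    · have hn : (0 : ℝ) < (n : ℝ) + 1 := by positivity
      have := abs_max_sub_max_le_abs (f x - a) (f x - (a + 1 / ((n : ℝ) + 1))) 0
      rw [show f x - a - (f x - (a + 1 / ((n : ℝ) + 1))) = 1 / ((n : ℝ) + 1) by ring,
        abs_of_pos (a := 1 / ((n : ℝ) + 1)) (by positivity)] at this
      rw [norm_mul, Real.norm_of_nonneg hn.le, Real.norm_eq_abs]
      calc _ ≤ ((n : ℝ) + 1) * (1 / ((n : ℝ) + 1)) := by gcongr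
        _ = 1 := by field_simp
    · by_cases hx : a < f x
      · rw [indicator_of_mem (by exact hx)]
        refine tendsto_const_nhds.congr' ?_
        have : ∀ᶠ n : ℕ in atTop, 1 / ((n : ℝ) + 1) < f x - a :=
          tendsto_one_div_add_atTop_nhds_zero_nat.eventually_lt_const (by linarith)
        filter_upwards [this] with n hn
        have hn' : (0 : ℝ) < (n : ℝ) + 1 := by positivity
        rw [max_eq_left (by linarith), max_eq_left (by linarith)]
        field_simp
        ring
      · rw [indicator_of_notMem (by exact hx)]
        refine tendsto_const_nhds.congr fun n => ?_
        have hn' : (0 : ℝ) < 1 / ((n : ℝ) + 1) := by positivity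
        rw [not_lt] at hx
        rw [max_eq_right (by linarith), max_eq_right (by linarith)]
        simp
  have h1 := key v hv
  simp_rw [h] at h1
  have := tendsto_nhds_unique h1 (key w hw)
  rwa [measureReal_eq_measureReal_iff] at this

/-- Functions with the same distribution function are identically distributed. -/
theorem identDistrib_of_measure_lt_eq {v w : X → ℝ} (hv : AEMeasurable v μ) (hw : AEMeasurable w μ)
    (h : ∀ a, μ {x | a < v x} = μ {x | a < w x}) : IdentDistrib v w μ μ where
  aemeasurable_fst := hv
  aemeasurable_snd := hw
  map_eq := by
    refine Measure.ext_of_Iic _ _ fun a => ?_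
    have key : ∀ f : X → ℝ, AEMeasurable f μ →
        μ.map f (Iic a) = μ univ - μ {x | a < f x} := by
      intro f hf
      rw [Measure.map_apply_of_aemeasurable hf measurableSet_Iic, show f ⁻¹' Iic a =
        {x | a < f x}ᶜ by ext; simp, measure_compl₀ (nullMeasurableSet_lt aemeasurable_const hf)
        (measure_ne_top _ _)]
    rw [key v hv, key w hw, h]

end Majorization

/-! ### Majorization and `L^p` norms. -/

section MajorizedRpow

/-- Taylor's formula writes the convex function s₊^p as a mixture of the functions (s−a)₊, weighted
by its second derivative. For p < 2 the weight is singular at 0 but integrable. Comparing excesses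
then compares `L^p` norms. -/
theorem lintegral_rpow_mul_excess {p : ℝ} (hp : 1 < p) (s : ℝ) :
    ∫⁻ a in Ioi (0 : ℝ), ENNReal.ofReal (p * (p - 1) * a ^ (p - 2)) * ENNReal.ofReal (s - a) =
      ENNReal.ofReal (max s 0 ^ p) := by
  rcases le_or_gt s 0 with hs | hs
  · rw [max_eq_right hs, Real.zero_rpow (by linarith), ENNReal.ofReal_zero]
    refine (setLIntegral_congr_fun measurableSet_Ioi fun a ha => ?_).trans lintegral_zero
    have : s - a ≤ 0 := by linarith [mem_Ioi.1 ha]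
    simp [ENNReal.ofReal_of_nonpos this]
  · rw [max_eq_left hs.le, ← Ioc_union_Ioi_eq_Ioi hs.le,
      lintegral_union measurableSet_Ioi (Ioc_disjoint_Ioi le_rfl)]
    have h2 : ∫⁻ a in Ioi s, ENNReal.ofReal (p * (p - 1) * a ^ (p - 2)) * ENNReal.ofReal (s - a)
        = 0 := by
      refine (setLIntegral_congr_fun measurableSet_Ioi fun a ha => ?_).trans lintegral_zero
      have : s - a ≤ 0 := by linarith [mem_Ioi.1 ha]
      simp [ENNReal.ofReal_of_nonpos this]
    rw [h2, add_zero]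
    have h3 : ∫⁻ a in Ioc 0 s, ENNReal.ofReal (p * (p - 1) * a ^ (p - 2)) * ENNReal.ofReal (s - a)
        = ∫⁻ a in Ioc 0 s, ENNReal.ofReal (p * (p - 1) * (s * a ^ (p - 2) - a ^ (p - 1))) := by
      refine setLIntegral_congr_fun measurableSet_Ioc fun a ha => ?_
      have ha0 := ha.1
      rw [← ENNReal.ofReal_mul (by
        have := Real.rpow_nonneg ha0.le (p - 2)
        have : 0 ≤ p - 1 := by linarith
        positivity)]
      congr 1
      rw [show p - 1 = (p - 2) + 1 by ring, Real.rpow_add_one ha0.ne']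
      ring
    have hi1 : IntervalIntegrable (fun a : ℝ => a ^ (p - 2)) volume 0 s :=
      intervalIntegral.intervalIntegrable_rpow' (by linarith)
    have hi2 : IntervalIntegrable (fun a : ℝ => a ^ (p - 1)) volume 0 s :=
      intervalIntegral.intervalIntegrable_rpow' (by linarith)
    have hi : IntervalIntegrable (fun a : ℝ => p * (p - 1) * (s * a ^ (p - 2) - a ^ (p - 1)))
        volume 0 s := ((hi1.const_mul s).sub hi2).const_mul _
    rw [h3, ← ofReal_integral_eq_lintegral_ofReal, ← intervalIntegral.integral_of_le hs.le,
      intervalIntegral.integral_const_mul, intervalIntegral.integral_sub (hi1.const_mul s) hi2,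
      intervalIntegral.integral_const_mul, integral_rpow (Or.inl (by linarith)),
      integral_rpow (Or.inl (by linarith)), Real.zero_rpow (by linarith),
      Real.zero_rpow (by linarith)]
    · congr 1
      have e1 : s * s ^ (p - 2 + 1) = s ^ p := by
        rw [mul_comm, ← Real.rpow_add_one hs.ne']; congr 1; ring
      have h4 : p - 1 ≠ 0 := by linarith
      have h5 : p ≠ 0 := by linarith
      rw [show p - 1 + 1 = p by ring, sub_zero, sub_zero, mul_div_assoc', e1,
        show p - 2 + 1 = p - 1 by ring]
      field_simp
      ring
    · exact (intervalIntegrable_iff_integrableOn_Ioc_of_le hs.le).1 hi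
    · refine (ae_restrict_iff' measurableSet_Ioc).2 (Eventually.of_forall fun a ha => ?_)
      have ha0 := ha.1
      have h6 : s * a ^ (p - 2) - a ^ (p - 1) = (s - a) * a ^ (p - 2) := by
        rw [show p - 1 = (p - 2) + 1 by ring, Real.rpow_add_one ha0.ne']
        ring
      simp only [h6, Pi.zero_apply]
      have := Real.rpow_nonneg ha0.le (p - 2)
      have : 0 ≤ p - 1 := by linarith
      have : 0 ≤ s - a := by linarith [ha.2]
      positivity

variable {X : Type*} [MeasurableSpace X] {μ : Measure X} [IsFiniteMeasure μ]

theorem lintegral_max_rpow_eq {p : ℝ} (hp : 1 < p) {v : X → ℝ} (hv : Integrable v μ) :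
    ∫⁻ x, ENNReal.ofReal (max (v x) 0 ^ p) ∂μ =
      ∫⁻ a in Ioi (0 : ℝ), ENNReal.ofReal (p * (p - 1) * a ^ (p - 2)) *
        ENNReal.ofReal (stopLoss μ v a) := by
  have hv' := hv.aemeasurable
  simp_rw [← lintegral_rpow_mul_excess hp]
  rw [lintegral_lintegral_swap]
  · refine lintegral_congr fun a => ?_
    rw [lintegral_const_mul'' _ (hv'.sub_const a).ennreal_ofReal, stopLoss,
      ofReal_integral_eq_lintegral_ofReal (integrable_excess hv a)
        (Eventually.of_forall fun x => le_max_right _ _)]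
    congr 1
    refine lintegral_congr fun x => ?_
    rcases le_total 0 (v x - a) with h | h
    · rw [max_eq_left h]
    · rw [max_eq_right h, ENNReal.ofReal_of_nonpos h, ENNReal.ofReal_zero]
  · change AEMeasurable (fun z : X × ℝ => ENNReal.ofReal (p * (p - 1) * z.2 ^ (p - 2)) *
      ENNReal.ofReal (v z.1 - z.2)) _
    have h1 : Measurable fun a : ℝ => ENNReal.ofReal (p * (p - 1) * a ^ (p - 2)) := by fun_prop
    have h2 : AEMeasurable (fun z : X × ℝ => v z.1 - z.2) (μ.prod (volume.restrict (Ioi 0))) :=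
      hv'.comp_fst.sub measurable_snd.aemeasurable
    exact (h1.comp_aemeasurable measurable_snd.aemeasurable).mul h2.ennreal_ofReal

theorem Majorized.lintegral_max_rpow_le {p : ℝ} (hp : 1 < p) {v w : X → ℝ}
    (h : Majorized μ v w) : ∫⁻ x, ENNReal.ofReal (max (v x) 0 ^ p) ∂μ ≤
      ∫⁻ x, ENNReal.ofReal (max (w x) 0 ^ p) ∂μ := by
  rw [lintegral_max_rpow_eq hp h.integrable_left, lintegral_max_rpow_eq hp h.integrable_right]
  gcongr with a
  exact h.stopLoss_le a

/-- Majorization decreases `L^p` norms. -/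
theorem Majorized.eLpNorm_le {p : ℝ≥0∞} (hp : 1 < p) (hp' : p < ⊤) {v w : X → ℝ}
    (h : Majorized μ v w) : eLpNorm v p μ ≤ eLpNorm w p μ := by
  have hp1 : 1 < p.toReal := by
    rw [← ENNReal.toReal_one]; exact (ENNReal.toReal_lt_toReal (by simp) hp'.ne).2 hp
  -- Positive and negative parts are treated separately, since majorization is preserved by
  -- simultaneous negation.
  have key : ∀ f : X → ℝ, Integrable f μ → ∫⁻ x, ‖f x‖ₑ ^ p.toReal ∂μ =
      ∫⁻ x, ENNReal.ofReal (max (f x) 0 ^ p.toReal) ∂μ +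
        ∫⁻ x, ENNReal.ofReal (max (-f x) 0 ^ p.toReal) ∂μ := by
    intro f hf
    rw [← lintegral_add_left']
    · refine lintegral_congr fun x => ?_
      rw [← ofReal_norm, ENNReal.ofReal_rpow_of_nonneg (norm_nonneg _) (by linarith),
        Real.norm_eq_abs]
      rcases le_total 0 (f x) with hx | hx
      · rw [max_eq_left hx, max_eq_right (by linarith), abs_of_nonneg hx,
          Real.zero_rpow (by linarith)]; simp
      · rw [max_eq_right hx, max_eq_left (by linarith), abs_of_nonpos hx,
          Real.zero_rpow (by linarith)]; simp
    · exact ((hf.aemeasurable.max aemeasurable_const).pow_const _).ennreal_ofReal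
  rw [eLpNorm_eq_lintegral_rpow_enorm_toReal (by positivity) hp'.ne,
    eLpNorm_eq_lintegral_rpow_enorm_toReal (by positivity) hp'.ne, key v h.integrable_left,
    key w h.integrable_right]
  exact ENNReal.rpow_le_rpow (add_le_add (h.lintegral_max_rpow_le hp1)
    (h.neg.lintegral_max_rpow_le hp1)) (by positivity)

theorem Majorized.memLp {p : ℝ≥0∞} (hp : 1 < p) (hp' : p < ⊤) {v w : X → ℝ}
    (h : Majorized μ v w) (hw : MemLp w p μ) : MemLp v p μ :=
  ⟨h.integrable_left.aestronglyMeasurable, (h.eLpNorm_le hp hp').trans_lt hw.2⟩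

end MajorizedRpow

/-! ### Truncation and weak compactness under majorization. -/

section WeakLimits

/-- Truncation of a real number to `[-k, k]`. -/
def clip (k s : ℝ) : ℝ := max (-k) (min s k)

theorem measurable_clip (k : ℝ) : Measurable (clip k) := by unfold clip; fun_prop

theorem abs_clip_le {k : ℝ} (hk : 0 ≤ k) (s : ℝ) : |clip k s| ≤ k := by
  unfold clip
  rw [abs_le]
  exact ⟨le_max_left _ _, max_le (by linarith) (min_le_right _ _)⟩

/-- The truncation error is a sum of two excesses, so majorization by a convergent family gives
uniform integrability. -/
theorem abs_sub_clip {k : ℝ} (hk : 0 ≤ k) (s : ℝ) :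
    |s - clip k s| = max (s - k) 0 + max (-s - k) 0 := by
  unfold clip
  rcases le_total s k with h | h
  · rw [min_eq_left h, max_eq_right (a := s - k) (by linarith), zero_add]
    rcases le_total (-k) s with h' | h'
    · rw [max_eq_right h', max_eq_right (by linarith)]; simp
    · rw [max_eq_left h', max_eq_left (by linarith), abs_of_nonpos (by linarith)]; ring
  · rw [min_eq_right h, max_eq_right (by linarith), max_eq_left (a := s - k) (by linarith),
      max_eq_right (by linarith), abs_of_nonneg (by linarith)]; ring

theorem abs_clip_sub_clip_le (k s t : ℝ) : |clip k s - clip k t| ≤ |s - t| := by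
  unfold clip
  refine (abs_max_sub_max_le_max (-k) (min s k) (-k) (min t k)).trans ?_
  rw [sub_self, abs_zero]
  refine max_le (abs_nonneg _) ((abs_min_sub_min_le_max s k t k).trans ?_)
  simp

/-- Banach–Alaoglu combined with the Riesz representation. Working along an ultrafilter avoids
subsequences and separability. -/
theorem exists_weakLimit_of_bounded {F : Type*} [NormedAddCommGroup F] [InnerProductSpace ℝ F]
    [CompleteSpace F] {ι : Type*} (𝓤 : Ultrafilter ι) (x : ι → F) {C : ℝ} (hC : ∀ i, ‖x i‖ ≤ C) :
    ∃ y : F, ∀ g : F, Tendsto (fun i => inner ℝ (x i) g) 𝓤 (𝓝 (inner ℝ y g)) := by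
  let φ : ι → WeakDual ℝ F := fun i =>
    StrongDual.toWeakDual (InnerProductSpace.toDual ℝ F (x i))
  have hmem : ∀ i, φ i ∈ WeakDual.toStrongDual ⁻¹' Metric.closedBall (0 : StrongDual ℝ F) C := by
    intro i
    rw [mem_preimage, mem_closedBall_zero_iff]
    exact ((InnerProductSpace.toDual ℝ F).norm_map (x i)).le.trans (hC i)
  obtain ⟨ψ, -, hψ⟩ := (WeakDual.isCompact_closedBall (0 : StrongDual ℝ F) C).ultrafilter_le_nhds
    (𝓤.map φ) (by
      rw [Ultrafilter.coe_map, le_principal_iff, mem_map]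
      exact univ_mem' hmem)
  refine ⟨(InnerProductSpace.toDual ℝ F).symm (WeakDual.toStrongDual ψ), fun g => ?_⟩
  rw [InnerProductSpace.toDual_symm_apply]
  have h1 : Tendsto φ 𝓤 (𝓝 ψ) := hψ
  exact ((WeakDual.eval_continuous g).tendsto ψ).comp h1

variable {X : Type*} [MeasurableSpace X] {μ : Measure X}

/-- Convergence of `f i` to `v` along `l` when tested against essentially bounded functions. -/
def WeakTendsto {ι : Type*} (μ : Measure X) (f : ι → X → ℝ) (l : Filter ι) (v : X → ℝ) : Prop :=
  ∀ g : X → ℝ, AEStronglyMeasurable g μ → (∃ C, ∀ᵐ x ∂μ, |g x| ≤ C) →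
    Tendsto (fun i => ∫ x, f i x * g x ∂μ) l (𝓝 (∫ x, v x * g x ∂μ))

theorem integrable_mul_of_ae_bdd {f g : X → ℝ} (hf : Integrable f μ)
    (hg : AEStronglyMeasurable g μ) {C : ℝ} (hC : ∀ᵐ x ∂μ, |g x| ≤ C) :
    Integrable (fun x => f x * g x) μ :=
  hf.mul_bdd hg hC

theorem abs_integral_mul_le {f g : X → ℝ} (hf : Integrable f μ) {C : ℝ}
    (hC : ∀ᵐ x ∂μ, |g x| ≤ C) :
    |∫ x, f x * g x ∂μ| ≤ C * ∫ x, |f x| ∂μ := by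
  rw [← integral_const_mul, ← Real.norm_eq_abs]
  refine norm_integral_le_of_norm_le (hf.abs.const_mul C) ?_
  filter_upwards [hC] with x hx
  rw [norm_mul, Real.norm_eq_abs, Real.norm_eq_abs, mul_comm]
  gcongr

/-- Writes the `L¹` norm as a pairing with a bounded sign, so that `L¹` bounds survive weak limits.
-/
theorem integral_abs_eq_integral_mul_ite (f : X → ℝ) :
    ∫ x, |f x| ∂μ = ∫ x, f x * (if f x < 0 then -1 else 1) ∂μ := by
  refine integral_congr_ae (Eventually.of_forall fun x => ?_)
  by_cases h : f x < 0
  · simp [h, abs_of_neg h]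
  · simp [h, abs_of_nonneg (not_lt.1 h)]

theorem tendsto_integral_of_tendsto_L1 {ι : Type*} {l : Filter ι} {w : ι → X → ℝ} {W : X → ℝ}
    (hw : ∀ i, Integrable (w i) μ) (hW : Integrable W μ)
    (h : Tendsto (fun i => ∫ x, |w i x - W x| ∂μ) l (𝓝 0)) :
    Tendsto (fun i => ∫ x, w i x ∂μ) l (𝓝 (∫ x, W x ∂μ)) := by
  rw [tendsto_iff_norm_sub_tendsto_zero]
  refine squeeze_zero (fun i => norm_nonneg _) (fun i => ?_) h
  rw [← integral_sub (hw i) hW]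
  exact abs_integral_le_integral_abs

variable [IsFiniteMeasure μ]

theorem integrable_clip {f : X → ℝ} (hf : AEStronglyMeasurable f μ) {k : ℝ} (hk : 0 ≤ k) :
    Integrable (fun x => clip k (f x)) μ :=
  Integrable.of_bound ((measurable_clip k).comp_aemeasurable hf.aemeasurable).aestronglyMeasurable
    k (Eventually.of_forall fun x => abs_clip_le hk (f x))

theorem integral_abs_sub_clip {f : X → ℝ} (hf : Integrable f μ) {k : ℝ} (hk : 0 ≤ k) :
    ∫ x, |f x - clip k (f x)| ∂μ = stopLoss μ f k + stopLoss μ (fun x => -f x) k := by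
  simp_rw [abs_sub_clip hk]
  exact integral_add (integrable_excess hf k) (integrable_excess hf.neg k)

theorem Majorized.integral_abs_sub_clip_le {v w : X → ℝ} (h : Majorized μ v w) {k : ℝ}
    (hk : 0 ≤ k) : ∫ x, |v x - clip k (v x)| ∂μ ≤ ∫ x, |w x - clip k (w x)| ∂μ := by
  rw [integral_abs_sub_clip h.integrable_left hk, integral_abs_sub_clip h.integrable_right hk]
  exact add_le_add (h.stopLoss_le k) (h.neg.stopLoss_le k)

theorem tendsto_stopLoss_of_tendsto {ι : Type*} {l : Filter ι} {w : ι → X → ℝ} {W : X → ℝ}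
    (hw : ∀ i, Integrable (w i) μ) (hW : Integrable W μ)
    (h : Tendsto (fun i => ∫ x, |w i x - W x| ∂μ) l (𝓝 0)) (a : ℝ) :
    Tendsto (fun i => stopLoss μ (w i) a) l (𝓝 (stopLoss μ W a)) := by
  rw [tendsto_iff_norm_sub_tendsto_zero]
  exact squeeze_zero (fun i => norm_nonneg _) (fun i => abs_stopLoss_sub_le (hw i) hW a) h

/-- On a finite measure space bounded functions lie in `L²`, so Hilbert space weak compactness
suffices. -/
theorem exists_weakLimit_of_ae_bdd {ι : Type*} (𝓤 : Ultrafilter ι) {f : ι → X → ℝ} {k : ℝ}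
    (hf : ∀ i, AEStronglyMeasurable (f i) μ) (hk : ∀ i x, |f i x| ≤ k) :
    ∃ v, Integrable v μ ∧ WeakTendsto μ f 𝓤 v := by
  have hm : ∀ i, MemLp (f i) 2 μ := fun i =>
    MemLp.of_bound (hf i) k (Eventually.of_forall (hk i))
  have hb : ∀ i, ‖(hm i).toLp (f i)‖ ≤ μ.real univ ^ ((2 : ℝ≥0∞).toReal)⁻¹ * |k| := by
    intro i
    refine Lp.norm_le_of_ae_bound (abs_nonneg k) ?_
    filter_upwards [(hm i).coeFn_toLp] with x hx
    rw [hx]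
    exact (hk i x).trans (le_abs_self k)
  obtain ⟨y, hy⟩ := exists_weakLimit_of_bounded 𝓤 (fun i => (hm i).toLp (f i)) hb
  refine ⟨y, (Lp.memLp y).integrable (by norm_num), fun g hg ⟨C, hC⟩ => ?_⟩
  have hgm : MemLp g 2 μ := MemLp.of_bound hg C hC
  have h := hy (hgm.toLp g)
  have e : ∀ z : Lp ℝ 2 μ, inner ℝ z (hgm.toLp g) = ∫ x, z x * g x ∂μ := by
    intro z
    rw [L2.inner_def]
    refine integral_congr_ae ?_
    filter_upwards [hgm.coeFn_toLp] with x hx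
    simp [hx, mul_comm]
  rw [e y] at h
  refine h.congr fun i => ?_
  rw [e]
  refine integral_congr_ae ?_
  filter_upwards [(hm i).coeFn_toLp] with x hx
  rw [hx]

/-- Weak compactness of families majorized by an `L¹`-convergent family. -/
theorem exists_majorized_weakLimit {ι : Type*} (𝓤 : Ultrafilter ι) {v w : ι → X → ℝ} {W : X → ℝ}
    (hvw : ∀ i, Majorized μ (v i) (w i)) (hW : Integrable W μ)
    (hw : Tendsto (fun i => ∫ x, |w i x - W x| ∂μ) 𝓤 (𝓝 0)) :
    ∃ V, Majorized μ V W ∧ WeakTendsto μ v 𝓤 V := by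
  have hvi : ∀ i, Integrable (v i) μ := fun i => (hvw i).integrable_left
  have hwi : ∀ i, Integrable (w i) μ := fun i => (hvw i).integrable_right
  have hk0 : ∀ k : ℕ, (0 : ℝ) ≤ k := fun k => Nat.cast_nonneg k
  set τ : ℕ → ℝ := fun k => ∫ x, |W x - clip k (W x)| ∂μ with hτ
  have hτ0 : Tendsto τ atTop (𝓝 0) := by
    have h := ((tendsto_stopLoss_atTop hW).add (tendsto_stopLoss_atTop hW.neg)).comp
      tendsto_natCast_atTop_atTop
    rw [add_zero] at h
    exact h.congr fun k => (integral_abs_sub_clip hW (hk0 k)).symm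
  -- Uniform integrability: the tails of `v i` are dominated by those of `w i`, which converge to
  -- the tail τ of the limit.
  have htail : ∀ (k : ℕ) {ε : ℝ}, 0 < ε → ∀ᶠ i in (𝓤 : Filter ι),
      ∫ x, |v i x - clip k (v i x)| ∂μ ≤ τ k + ε := by
    intro k ε hε
    have h1 : Tendsto (fun i => ∫ x, |w i x - clip k (w i x)| ∂μ) 𝓤 (𝓝 (τ k)) := by
      have hneg : Tendsto (fun i => ∫ x, |(-w i x) - (-W x)| ∂μ) 𝓤 (𝓝 0) := by
        refine hw.congr fun i => integral_congr_ae (Eventually.of_forall fun x => ?_)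
        simp only
        rw [show -w i x - -W x = -(w i x - W x) by ring, abs_neg]
      have h := (tendsto_stopLoss_of_tendsto hwi hW hw k).add
        (tendsto_stopLoss_of_tendsto (fun i => (hwi i).neg) hW.neg hneg k)
      simp only [hτ, integral_abs_sub_clip hW (hk0 k)]
      exact h.congr fun i => (integral_abs_sub_clip (hwi i) (hk0 k)).symm
    filter_upwards [h1.eventually_le_const (show τ k < τ k + ε by linarith)] with i hi
    exact ((hvw i).integral_abs_sub_clip_le (hk0 k)).trans hi
  have hclip : ∀ i (k : ℕ), Integrable (fun x => clip k (v i x)) μ := fun i k =>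
    integrable_clip (hvi i).aestronglyMeasurable (hk0 k)
  choose u hui hu using fun k : ℕ => exists_weakLimit_of_ae_bdd 𝓤 (μ := μ)
    (f := fun i x => clip k (v i x)) (fun i => (hclip i k).aestronglyMeasurable)
    (fun i x => abs_clip_le (hk0 k) (v i x))
  -- The weak limits u k of the truncations are Cauchy in `L¹`, since the distance between two
  -- truncations is at most the sum of their tails; their strong limit V is the required weak limit.
  have hcauchy : ∀ j k : ℕ, ∫ x, |u j x - u k x| ∂μ ≤ τ j + τ k := by
    intro j k
    refine le_of_forall_pos_le_add fun ε hε => ?_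
    have hsm : AEStronglyMeasurable (fun x => (if u j x - u k x < 0 then -1 else 1 : ℝ)) μ := by
      have h1 : Measurable fun s : ℝ => (if s < 0 then -1 else 1 : ℝ) :=
        Measurable.ite measurableSet_Iio measurable_const measurable_const
      exact (h1.comp_aemeasurable ((hui j).sub (hui k)).aemeasurable).aestronglyMeasurable
    have hs1 : ∀ᵐ x ∂μ, |(if u j x - u k x < 0 then -1 else 1 : ℝ)| ≤ 1 :=
      Eventually.of_forall fun x => by
        split_ifs <;> simp
    rw [integral_abs_eq_integral_mul_ite]
    have hlim := (hu j _ hsm ⟨1, hs1⟩).sub (hu k _ hsm ⟨1, hs1⟩)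
    rw [← integral_sub (integrable_mul_of_ae_bdd (hui j) hsm hs1)
      (integrable_mul_of_ae_bdd (hui k) hsm hs1)] at hlim
    simp_rw [← sub_mul] at hlim
    refine le_of_tendsto hlim ?_
    filter_upwards [htail j (half_pos hε), htail k (half_pos hε)] with i h1 h2
    rw [← integral_sub (integrable_mul_of_ae_bdd (hclip i j) hsm hs1)
      (integrable_mul_of_ae_bdd (hclip i k) hsm hs1)]
    simp_rw [← sub_mul]
    refine (le_abs_self _).trans
      ((abs_integral_mul_le ((hclip i j).sub (hclip i k)) hs1).trans ?_)
    have h3 : ∫ x, |clip j (v i x) - clip k (v i x)| ∂μ ≤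
        ∫ x, |v i x - clip j (v i x)| ∂μ + ∫ x, |v i x - clip k (v i x)| ∂μ := by
      have hj : Integrable (fun x => |v i x - clip j (v i x)|) μ := ((hvi i).sub (hclip i j)).abs
      have hk : Integrable (fun x => |v i x - clip k (v i x)|) μ := ((hvi i).sub (hclip i k)).abs
      rw [← integral_add hj hk]
      refine integral_mono ((hclip i j).sub (hclip i k)).abs (hj.add hk) fun x => ?_
      have := abs_sub_le (clip j (v i x)) (v i x) (clip k (v i x))
      rwa [abs_sub_comm (clip j (v i x)) (v i x)] at this
    simp only [Pi.sub_apply, one_mul]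
    linarith
  have hnorm : ∀ f g : X → ℝ, ∀ (hf : Integrable f μ) (hg : Integrable g μ),
      ‖hf.toL1 f - hg.toL1 g‖ = ∫ x, |f x - g x| ∂μ := by
    intro f g hf hg
    rw [← Integrable.toL1_sub, L1.norm_of_fun_eq_integral_norm]
    rfl
  have hC : CauchySeq fun k => (hui k).toL1 (u k) := by
    rw [Metric.cauchySeq_iff]
    intro ε hε
    obtain ⟨N, hN⟩ := eventually_atTop.1 (hτ0.eventually_lt_const (half_pos hε))
    refine ⟨N, fun j hj k hk => ?_⟩
    rw [dist_eq_norm, hnorm]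
    linarith [hcauchy j k, hN j hj, hN k hk]
  obtain ⟨V, hV⟩ := cauchySeq_tendsto_of_complete hC
  have hVi : Integrable V μ := L1.integrable_coeFn V
  have hVlim : Tendsto (fun k => ∫ x, |u k x - V x| ∂μ) atTop (𝓝 0) := by
    have h := tendsto_iff_norm_sub_tendsto_zero.1 hV
    refine h.congr fun k => ?_
    rw [← hnorm (u k) V (hui k) hVi, Integrable.toL1_coeFn]
  have hweak : WeakTendsto μ v 𝓤 V := by
    rintro g hg ⟨C, hC⟩
    have hC' : ∀ᵐ x ∂μ, |g x| ≤ |C| + 1 := hC.mono fun x hx => by linarith [le_abs_self C]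
    set B := |C| + 1 with hB
    have hB0 : 0 < B := by positivity
    rw [Metric.tendsto_nhds]
    intro ε hε
    have hε' : 0 < ε / (4 * B) := by positivity
    obtain ⟨k, hk1, hk2⟩ := ((hτ0.eventually_lt_const hε').and
      (hVlim.eventually_lt_const hε')).exists
    have hu' := (Metric.tendsto_nhds.1 (hu k g hg ⟨C, hC⟩)) (ε / 4) (by positivity)
    filter_upwards [hu', htail k (show 0 < ε / (4 * B) - τ k by linarith)] with i h1 h2
    rw [Real.dist_eq] at h1 ⊢
    have e1 : ∫ x, v i x * g x ∂μ - ∫ x, clip k (v i x) * g x ∂μ =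
        ∫ x, (v i x - clip k (v i x)) * g x ∂μ := by
      rw [← integral_sub (integrable_mul_of_ae_bdd (hvi i) hg hC)
        (integrable_mul_of_ae_bdd (hclip i k) hg hC)]
      simp_rw [sub_mul]
    have e2 : ∫ x, u k x * g x ∂μ - ∫ x, V x * g x ∂μ = ∫ x, (u k x - V x) * g x ∂μ := by
      rw [← integral_sub (integrable_mul_of_ae_bdd (hui k) hg hC)
        (integrable_mul_of_ae_bdd hVi hg hC)]
      simp_rw [sub_mul]
    have b1 := abs_integral_mul_le ((hvi i).sub (hclip i k)) hC'
    have b2 := abs_integral_mul_le ((hui k).sub hVi) hC'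
    simp only [Pi.sub_apply] at b1 b2
    rw [← e1] at b1
    rw [← e2] at b2
    have b3 : B * ∫ x, |v i x - clip k (v i x)| ∂μ ≤ ε / 4 := by
      calc _ ≤ B * (ε / (4 * B)) := by gcongr; linarith
        _ = ε / 4 := by field_simp
    have b4 : B * ∫ x, |u k x - V x| ∂μ ≤ ε / 4 := by
      calc _ ≤ B * (ε / (4 * B)) := by gcongr
        _ = ε / 4 := by field_simp
    have b5 := abs_sub_le (∫ x, v i x * g x ∂μ) (∫ x, clip k (v i x) * g x ∂μ)
      (∫ x, V x * g x ∂μ)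
    have b6 := abs_sub_le (∫ x, clip k (v i x) * g x ∂μ) (∫ x, u k x * g x ∂μ)
      (∫ x, V x * g x ∂μ)
    linarith
  refine ⟨V, ⟨hVi, hW, ?_, fun a => ?_⟩, hweak⟩
  · have h1 := hweak (fun _ => 1) aestronglyMeasurable_const ⟨1, by simp⟩
    simp only [mul_one] at h1
    simp_rw [(hvw _).integral_eq] at h1
    exact tendsto_nhds_unique h1 (tendsto_integral_of_tendsto_L1 hwi hW hw)
  -- Testing with the indicator of {V > a} turns the left side into the excess of V, while for each
  -- i the same test gives at most the excess of `v i`.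
  · set A := {x | a < V x} with hA
    have hAm : MeasurableSet A := by
      have : StronglyMeasurable V := Lp.stronglyMeasurable V
      exact measurableSet_lt measurable_const this.measurable
    have hgm : AEStronglyMeasurable (A.indicator fun _ => (1 : ℝ)) μ :=
      (measurable_const.indicator hAm).aestronglyMeasurable
    have hgb : ∀ᵐ x ∂μ, |A.indicator (fun _ => (1 : ℝ)) x| ≤ 1 :=
      Eventually.of_forall fun x => by by_cases hx : x ∈ A <;> simp [hx]
    have h1 := (hweak _ hgm ⟨1, hgb⟩).sub_const (∫ x, a * A.indicator (fun _ => (1 : ℝ)) x ∂μ)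
    have hai := integrable_mul_of_ae_bdd (integrable_const (μ := μ) a) hgm hgb
    rw [← integral_sub (integrable_mul_of_ae_bdd hVi hgm hgb) hai] at h1
    have e1 : ∫ x, (V x * A.indicator (fun _ => (1 : ℝ)) x - a * A.indicator (fun _ => (1 : ℝ)) x)
        ∂μ = stopLoss μ V a := by
      refine integral_congr_ae (Eventually.of_forall fun x => ?_)
      by_cases hx : x ∈ A
      · have : a < V x := hx
        simp [hx, this.le]
      · have : V x ≤ a := not_lt.1 hx
        simp [hx, this]
    rw [e1] at h1
    refine le_of_tendsto_of_tendsto h1 (tendsto_stopLoss_of_tendsto hwi hW hw a)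
      (Eventually.of_forall fun i => ?_)
    refine le_trans ?_ ((hvw i).stopLoss_le a)
    simp only
    rw [← integral_sub (integrable_mul_of_ae_bdd (hvi i) hgm hgb) hai]
    refine integral_mono ((integrable_mul_of_ae_bdd (hvi i) hgm hgb).sub hai)
      (integrable_excess (hvi i) a) fun x => ?_
    by_cases hx : x ∈ A <;> simp [hx]

end WeakLimits

/-! ### From weak to strong convergence for rearrangements. -/

section StrongConvergence

/-- The Huber function, a convex primitive of `clip k`. -/
def huber (k s : ℝ) : ℝ := clip k s ^ 2 / 2 + clip k s * (s - clip k s)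

/-- The gap between the two sides is exactly (clip s − clip t)(s − clip s), nonnegative because clip
is the projection onto [−k, k]. This convexity estimate on truncations works for every exponent. -/
theorem huber_bregman {k : ℝ} (hk : 0 ≤ k) (s t : ℝ) :
    (clip k s - clip k t) ^ 2 / 2 ≤ huber k s - huber k t - clip k t * (s - t) := by
  have h : 0 ≤ (clip k s - clip k t) * (s - clip k s) := by
    have ht := abs_le.1 (abs_clip_le hk t)
    generalize clip k t = b at ht
    unfold clip
    rcases le_total s k with h | h
    · rw [min_eq_left h]
      rcases le_total (-k) s with h' | h'
      · rw [max_eq_right h']; simp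
      · rw [max_eq_left h']; exact mul_nonneg_of_nonpos_of_nonpos (by linarith) (by linarith)
    · rw [min_eq_right h, max_eq_right (by linarith)]
      exact mul_nonneg (by linarith) (by linarith)
  unfold huber
  nlinarith [h]

theorem abs_huber_sub_le {k : ℝ} (hk : 0 ≤ k) (s t : ℝ) :
    |huber k s - huber k t| ≤ k * |s - t| := by
  have key : ∀ s t, -(k * |s - t|) ≤ huber k s - huber k t := by
    intro s t
    have h1 := huber_bregman hk s t
    have h2 : |clip k t * (s - t)| ≤ k * |s - t| := by
      rw [abs_mul]; gcongr; exact abs_clip_le hk t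
    have h3 := neg_abs_le (clip k t * (s - t))
    have h4 := sq_nonneg (clip k s - clip k t)
    linarith
  rw [abs_le]
  have := key t s
  rw [abs_sub_comm] at this
  exact ⟨key s t, by linarith⟩

theorem measurable_huber (k : ℝ) : Measurable (huber k) := by
  have := measurable_clip k
  unfold huber; fun_prop

theorem lipschitzWith_clip (k : ℝ) : LipschitzWith 1 (clip k) :=
  LipschitzWith.of_dist_le_mul fun s t => by
    simpa [Real.dist_eq] using abs_clip_sub_clip_le k s t

theorem clip_zero {k : ℝ} (hk : 0 ≤ k) : clip k 0 = 0 := by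
  simp [clip, hk]

variable {X : Type*} [MeasurableSpace X] {μ : Measure X}
variable {p : ℝ≥0∞}

theorem integrable_huber {f : X → ℝ} (hf : Integrable f μ) {k : ℝ} (hk : 0 ≤ k) :
    Integrable (fun x => huber k (f x)) μ := by
  refine Integrable.mono' (hf.abs.const_mul k)
    ((measurable_huber k).comp_aemeasurable hf.aemeasurable).aestronglyMeasurable
    (Eventually.of_forall fun x => ?_)
  have := abs_huber_sub_le hk (f x) 0
  simpa [huber, clip_zero hk] using this

/-- Truncation as a map on `L^p`. -/
def clipLp {k : ℝ} (hk : 0 ≤ k) (f : Lp ℝ p μ) : Lp ℝ p μ :=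
  (lipschitzWith_clip k).compLp (clip_zero hk) f

theorem coeFn_clipLp {k : ℝ} (hk : 0 ≤ k) (f : Lp ℝ p μ) :
    clipLp hk f =ᵐ[μ] fun x => clip k (f x) :=
  (lipschitzWith_clip k).coeFn_compLp (clip_zero hk) f

theorem norm_clipLp_sub_le {k : ℝ} (hk : 0 ≤ k) (f g : Lp ℝ p μ) :
    ‖clipLp hk f - clipLp hk g‖ ≤ ‖f - g‖ := by
  have := (lipschitzWith_clip k).norm_compLp_sub_le (clip_zero hk) f g
  rwa [NNReal.coe_one, one_mul] at this

theorem norm_sub_clipLp {k : ℝ} (hk : 0 ≤ k) (f : Lp ℝ p μ) :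
    ‖f - clipLp hk f‖ = (eLpNorm (fun x => f x - clip k (f x)) p μ).toReal := by
  rw [Lp.norm_def]
  congr 1
  refine eLpNorm_congr_ae ?_
  filter_upwards [Lp.coeFn_sub f (clipLp hk f), coeFn_clipLp hk f] with x h1 h2
  rw [h1, Pi.sub_apply, h2]

theorem norm_sub_clipLp_eq {k : ℝ} (hk : 0 ≤ k) {f g : Lp ℝ p μ} (h : IdentDistrib f g μ μ) :
    ‖f - clipLp hk f‖ = ‖g - clipLp hk g‖ := by
  rw [norm_sub_clipLp, norm_sub_clipLp]
  have hm : Measurable fun s : ℝ => s - clip k s := measurable_id.sub (measurable_clip k)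
  congr 1
  exact (h.comp hm).eLpNorm_eq p

theorem exists_norm_sub_clipLp_lt (f : Lp ℝ p μ) {ε : ℝ} (hε : 0 < ε) :
    ∃ (k : ℝ) (hk : 0 < k), ‖f - clipLp hk.le f‖ < ε := by
  obtain ⟨M, hM0, hM⟩ := (Lp.memLp f).eLpNorm_indicator_norm_ge_pos_le
    (Lp.stronglyMeasurable f) (half_pos hε)
  refine ⟨M, hM0, ?_⟩
  rw [norm_sub_clipLp]
  refine lt_of_le_of_lt (ENNReal.toReal_mono ENNReal.ofReal_ne_top ((eLpNorm_mono fun x => ?_).trans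
    hM)) (by rw [ENNReal.toReal_ofReal (half_pos hε).le]; linarith)
  rw [Real.norm_eq_abs, abs_sub_clip hM0.le]
  by_cases hx : x ∈ {x | M ≤ (‖f x‖₊ : ℝ)}
  · rw [indicator_of_mem hx, Real.norm_eq_abs]
    rcases le_total 0 (f x) with h | h
    · rw [max_eq_right (a := -f x - M) (by linarith), abs_of_nonneg h, add_zero]
      exact max_le (by linarith) h
    · rw [max_eq_right (a := f x - M) (by linarith), abs_of_nonpos h, zero_add]
      exact max_le (by linarith) (by linarith)
  · rw [indicator_of_notMem hx]
    simp only [mem_ofPred_eq, coe_nnnorm, Real.norm_eq_abs, not_le] at hx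
    have := abs_lt.1 hx
    rw [max_eq_right (by linarith), max_eq_right (by linarith)]
    simp

variable [IsFiniteMeasure μ]

theorem exists_integral_abs_le [hp : Fact (1 ≤ p)] :
    ∃ C : ℝ, 0 ≤ C ∧ ∀ f : Lp ℝ p μ, ∫ x, |f x| ∂μ ≤ C * ‖f‖ := by
  refine ⟨(μ univ ^ (1 - 1 / p.toReal)).toReal, ENNReal.toReal_nonneg, fun f => ?_⟩
  have h := eLpNorm_le_eLpNorm_mul_rpow_measure_univ hp.out (Lp.memLp f).1
  rw [ENNReal.toReal_one, div_one, eLpNorm_one_eq_lintegral_enorm] at h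
  have hpos : 0 ≤ 1 - 1 / p.toReal := by
    rcases eq_or_ne p ⊤ with rfl | h'
    · simp
    · have : 1 ≤ p.toReal := by
        rw [← ENNReal.toReal_one]; exact ENNReal.toReal_mono h' hp.out
      rw [sub_nonneg, div_le_one (by linarith)]; exact this
  have hfin : eLpNorm f p μ * μ univ ^ (1 - 1 / p.toReal) ≠ ⊤ :=
    ENNReal.mul_ne_top (Lp.memLp f).2.ne (ENNReal.rpow_ne_top_of_nonneg hpos (measure_ne_top _ _))
  have h2 := ENNReal.toReal_mono hfin h
  rw [ENNReal.toReal_mul, ← Lp.norm_def, ← integral_norm_eq_lintegral_enorm (Lp.memLp f).1,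
    mul_comm] at h2
  exact h2

theorem tendsto_L1_of_tendsto_Lp [Fact (1 ≤ p)] {ι : Type*} {l : Filter ι} {w : ι → Lp ℝ p μ}
    {W : Lp ℝ p μ} (h : Tendsto w l (𝓝 W)) :
    Tendsto (fun i => ∫ x, |w i x - W x| ∂μ) l (𝓝 0) := by
  obtain ⟨C, hC, hb⟩ := exists_integral_abs_le (μ := μ) (p := p)
  have h1 := (tendsto_iff_norm_sub_tendsto_zero.1 h).const_mul C
  rw [mul_zero] at h1
  refine squeeze_zero (fun i => integral_nonneg fun x => abs_nonneg _) (fun i => ?_) h1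
  refine le_trans (le_of_eq (integral_congr_ae ?_)) (hb (w i - W))
  filter_upwards [Lp.coeFn_sub (w i) W] with x hx
  rw [hx, Pi.sub_apply]

/-- For uniformly bounded functions, convergence in mean square implies convergence in `L^p`. -/
theorem tendsto_norm_of_tendsto_sq [Fact (1 ≤ p)] (hp' : p ≠ ⊤) {ι : Type*} {l : Filter ι}
    {d : ι → Lp ℝ p μ} {k : ℝ} (hk : ∀ i, ∀ᵐ x ∂μ, |d i x| ≤ k)
    (hd : Tendsto (fun i => ∫ x, d i x ^ 2 ∂μ) l (𝓝 0)) : Tendsto (fun i => ‖d i‖) l (𝓝 0) := by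
  have hp : 1 ≤ p := Fact.out
  have hp0 : p ≠ 0 := (zero_lt_one.trans_le hp).ne'
  have hP : 1 ≤ p.toReal := by
    rw [← ENNReal.toReal_one]; exact ENNReal.toReal_mono hp' hp
  set P := p.toReal with hPdef
  have hnorm : ∀ i, ‖d i‖ = (∫ x, |d i x| ^ P ∂μ) ^ P⁻¹ := by
    intro i
    rw [Lp.norm_def, (Lp.memLp (d i)).eLpNorm_eq_integral_rpow_norm hp0 hp',
      ENNReal.toReal_ofReal (by positivity)]
    rfl
  have hI : Tendsto (fun i => ∫ x, |d i x| ^ P ∂μ) l (𝓝 0) := by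
    rw [Metric.tendsto_nhds]
    intro ε hε
    set m := μ.real univ
    have hm : 0 ≤ m := measureReal_nonneg
    -- Where |d| ≤ η the integrand is at most η^P; elsewhere it is at most |k|^P d²/η², which the
    -- mean square controls.
    obtain ⟨η, hη, hηε⟩ : ∃ η : ℝ, 0 < η ∧ η ^ P * m < ε / 2 := by
      have hc : Tendsto (fun η : ℝ => η ^ P * m) (𝓝[>] 0) (𝓝 (0 ^ P * m)) :=
        (((Real.continuous_rpow_const (by linarith)).tendsto 0).mul_const m).mono_left
          nhdsWithin_le_nhds
      rw [Real.zero_rpow (by linarith), zero_mul] at hc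
      obtain ⟨η, h1, h2⟩ := ((hc.eventually_lt_const (half_pos hε)).and
        self_mem_nhdsWithin).exists
      exact ⟨η, h2, h1⟩
    have hd' := hd.const_mul (|k| ^ P / η ^ 2)
    rw [mul_zero] at hd'
    filter_upwards [hd'.eventually_lt_const (half_pos hε)] with i hi
    have hnn : 0 ≤ ∫ x, |d i x| ^ P ∂μ := integral_nonneg fun x => by positivity
    rw [Real.dist_eq, sub_zero, abs_of_nonneg hnn]
    have hsq : Integrable (fun x => d i x ^ 2) μ := by
      refine Integrable.of_bound (C := k ^ 2) ((Lp.aestronglyMeasurable (d i)).pow 2) ?_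
      filter_upwards [hk i] with x hx
      rw [norm_pow, Real.norm_eq_abs]
      gcongr
    have hbound : ∫ x, |d i x| ^ P ∂μ ≤ ∫ x, (η ^ P + |k| ^ P / η ^ 2 * d i x ^ 2) ∂μ := by
      refine integral_mono_of_nonneg (Eventually.of_forall fun x => by positivity)
        ((integrable_const _).add (hsq.const_mul _)) ?_
      filter_upwards [hk i] with x hx
      have hkk : |d i x| ≤ |k| := hx.trans (le_abs_self k)
      rcases le_total |d i x| η with h | h
      · have h1 : |d i x| ^ P ≤ η ^ P := by gcongr
        have h2 : 0 ≤ |k| ^ P / η ^ 2 * d i x ^ 2 := by positivity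
        linarith
      · have h1 : |d i x| ^ P ≤ |k| ^ P := by gcongr
        have h2 : |k| ^ P ≤ |k| ^ P / η ^ 2 * d i x ^ 2 := by
          rw [div_mul_eq_mul_div, le_div_iff₀ (by positivity), ← sq_abs (d i x)]
          gcongr
        have h3 : 0 ≤ η ^ P := by positivity
        linarith
    rw [integral_add (integrable_const _) (hsq.const_mul _), integral_const_mul, integral_const,
      smul_eq_mul, mul_comm (μ.real univ)] at hbound
    linarith
  have h0 : Tendsto (fun i => (∫ x, |d i x| ^ P ∂μ) ^ P⁻¹) l (𝓝 (0 ^ P⁻¹)) :=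
    ((Real.continuous_rpow_const (by positivity)).tendsto 0).comp hI
  rw [Real.zero_rpow (by positivity)] at h0
  exact h0.congr fun i => (hnorm i).symm

/-- Weak convergence of rearrangements of a strongly convergent family to a rearrangement of its
limit is strong. -/
theorem tendsto_of_weakTendsto_of_identDistrib [Fact (1 ≤ p)] (hp' : p ≠ ⊤) {ι : Type*}
    {l : Filter ι} {v w : ι → Lp ℝ p μ} {V W : Lp ℝ p μ}
    (hvw : ∀ i, IdentDistrib (v i) (w i) μ μ) (hVW : IdentDistrib V W μ μ)
    (hw : Tendsto w l (𝓝 W)) (hweak : WeakTendsto μ (fun i => v i) l V) :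
    Tendsto v l (𝓝 V) := by
  have hint : ∀ f : Lp ℝ p μ, Integrable f μ := fun f => (Lp.memLp f).integrable Fact.out
  have hclip : ∀ {k : ℝ} (hk : 0 ≤ k), Tendsto (fun i => ‖clipLp hk (v i) - clipLp hk V‖) l
      (𝓝 0) := by
    intro k hk
    have hco : ∀ i, (clipLp hk (v i) - clipLp hk V : Lp ℝ p μ) =ᵐ[μ]
        fun x => clip k (v i x) - clip k (V x) := by
      intro i
      filter_upwards [Lp.coeFn_sub (clipLp hk (v i)) (clipLp hk V), coeFn_clipLp hk (v i),
        coeFn_clipLp hk V] with x h1 h2 h3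
      rw [h1, Pi.sub_apply, h2, h3]
    refine tendsto_norm_of_tendsto_sq hp' (k := k + k) (fun i => ?_) ?_
    · filter_upwards [hco i] with x hx
      rw [hx]
      exact (abs_sub _ _).trans (add_le_add (abs_clip_le hk _) (abs_clip_le hk _))
    -- The integral of the Huber function depends only on the distribution, so it may be computed on
    -- the strongly convergent `w i`. Together with the weak limit tested against clip k V, this
    -- makes the integrated Bregman distance vanish.
    have hH : Tendsto (fun i => ∫ x, huber k (v i x) ∂μ) l (𝓝 (∫ x, huber k (V x) ∂μ)) := by
      have e1 : ∀ i, ∫ x, huber k (v i x) ∂μ = ∫ x, huber k (w i x) ∂μ := fun i =>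
        ((hvw i).comp (measurable_huber k)).integral_eq
      have e2 : ∫ x, huber k (V x) ∂μ = ∫ x, huber k (W x) ∂μ :=
        (hVW.comp (measurable_huber k)).integral_eq
      simp_rw [e1, e2]
      refine tendsto_integral_of_tendsto_L1 (fun i => integrable_huber (hint _) hk)
        (integrable_huber (hint _) hk) ?_
      have h1 := (tendsto_L1_of_tendsto_Lp hw).const_mul k
      rw [mul_zero] at h1
      refine squeeze_zero (fun i => integral_nonneg fun x => abs_nonneg _) (fun i => ?_) h1
      rw [← integral_const_mul]
      exact integral_mono ((integrable_huber (hint _) hk).sub (integrable_huber (hint _) hk)).abs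
        (((hint (w i)).sub (hint W)).abs.const_mul k) fun x => abs_huber_sub_le hk _ _
    have hcm : AEStronglyMeasurable (fun x => clip k (V x)) μ :=
      (integrable_clip (hint V).aestronglyMeasurable hk).aestronglyMeasurable
    have hcb : ∀ᵐ x ∂μ, |clip k (V x)| ≤ k := Eventually.of_forall fun x => abs_clip_le hk _
    have hT := hweak _ hcm ⟨k, hcb⟩
    have hlim := ((hH.sub_const (∫ x, huber k (V x) ∂μ)).sub
      (hT.sub_const (∫ x, V x * clip k (V x) ∂μ))).const_mul 2
    simp only [sub_self, mul_zero] at hlim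
    refine squeeze_zero (fun i => integral_nonneg fun x => sq_nonneg _) (fun i => ?_) hlim
    have i1 := integrable_huber (μ := μ) (hint (v i)) hk
    have i2 := integrable_huber (μ := μ) (hint V) hk
    have i3 := integrable_mul_of_ae_bdd (hint (v i)) hcm hcb
    have i4 := integrable_mul_of_ae_bdd (hint V) hcm hcb
    have i5 : Integrable (fun x => huber k (v i x) - huber k (V x)) μ := i1.sub i2
    have i6 : Integrable (fun x => v i x * clip k (V x) - V x * clip k (V x)) μ := i3.sub i4
    rw [← integral_sub i1 i2, ← integral_sub i3 i4, ← integral_sub i5 i6,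
      ← integral_const_mul]
    refine integral_mono_of_nonneg (Eventually.of_forall fun x => sq_nonneg _)
      ((i5.sub i6).const_mul 2) ?_
    filter_upwards [hco i] with x hx
    have := huber_bregman hk (v i x) (V x)
    simp only [hx]
    linarith
  rw [tendsto_iff_norm_sub_tendsto_zero, Metric.tendsto_nhds]
  intro ε hε
  -- Five shares of ε: the truncation error of `v i` equals that of `w i`, costing two copies of ‖w
  -- i − W‖ and one of the error of W. One more share is the distance between truncations, and the
  -- last is the error of V, equal to that of W.
  obtain ⟨k, hk, hkW⟩ := exists_norm_sub_clipLp_lt W (show 0 < ε / 5 by linarith)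
  filter_upwards [(hclip hk.le).eventually_lt_const (show 0 < ε / 5 by linarith),
    (tendsto_iff_norm_sub_tendsto_zero.1 hw).eventually_lt_const (show 0 < ε / 5 by linarith)]
    with i h1 h2
  rw [Real.dist_eq, sub_zero, abs_norm]
  have e1 := norm_sub_clipLp_eq hk.le (hvw i)
  have e2 := norm_sub_clipLp_eq hk.le hVW
  have b1 : ‖w i - clipLp hk.le (w i)‖ ≤ ‖w i - W‖ + ‖W - clipLp hk.le W‖ +
      ‖clipLp hk.le (w i) - clipLp hk.le W‖ := by
    have : w i - clipLp hk.le (w i) = (w i - W) + (W - clipLp hk.le W) -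
      (clipLp hk.le (w i) - clipLp hk.le W) := by abel
    rw [this]
    exact (norm_sub_le _ _).trans (add_le_add_left (norm_add_le _ _) _)
  have b2 := norm_clipLp_sub_le hk.le (w i) W
  have b3 : ‖v i - V‖ ≤ ‖v i - clipLp hk.le (v i)‖ + ‖clipLp hk.le (v i) - clipLp hk.le V‖ +
      ‖V - clipLp hk.le V‖ := by
    have : v i - V = (v i - clipLp hk.le (v i)) + (clipLp hk.le (v i) - clipLp hk.le V) -
      (V - clipLp hk.le V) := by abel
    rw [this]
    exact (norm_sub_le _ _).trans (add_le_add_left (norm_add_le _ _) _)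
  linarith

end StrongConvergence

/-! ### Trigonometric functions on the circle and the Dirichlet eigenfunctions. -/

section Modes

variable {L : ℝ}

/-- The real trigonometric functions on the circle: the real (`b = true`) or imaginary
(`b = false`) part of the Fourier monomial of index `m`. -/
def circ (b : Bool) (m : ℤ) (z : AddCircle L) : ℝ :=
  if b then (fourier m z).re else (fourier m z).im

/-- The wave numbers across the channel. -/
def freq (H : ℝ) (k : ℕ) : ℝ := (k + 1) * Real.pi / H

/-- The Dirichlet eigenfunctions of the channel. -/
def mode (H : ℝ) (b : Bool) (m : ℤ) (k : ℕ) (x : AddCircle L × ℝ) : ℝ :=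
  circ b m x.1 * Real.sin (freq H k * x.2)

theorem continuous_circ (b : Bool) (m : ℤ) : Continuous (circ b m : AddCircle L → ℝ) := by
  cases b
  · exact Complex.continuous_im.comp (fourier m).continuous
  · exact Complex.continuous_re.comp (fourier m).continuous

theorem continuous_mode (H : ℝ) (b : Bool) (m : ℤ) (k : ℕ) :
    Continuous (mode H b m k : AddCircle L × ℝ → ℝ) :=
  ((continuous_circ b m).comp continuous_fst).mul (by fun_prop)

theorem norm_fourier_apply (m : ℤ) (z : AddCircle L) : ‖fourier m z‖ = 1 := by
  rw [fourier_apply]; exact Circle.norm_coe _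

theorem abs_circ_le (b : Bool) (m : ℤ) (z : AddCircle L) : |circ b m z| ≤ 1 := by
  rw [← norm_fourier_apply m z]
  cases b
  · exact Complex.abs_im_le_norm _
  · exact Complex.abs_re_le_norm _

theorem abs_mode_le (H : ℝ) (b : Bool) (m : ℤ) (k : ℕ) (x : AddCircle L × ℝ) :
    |mode H b m k x| ≤ 1 := by
  rw [mode, abs_mul]
  exact mul_le_one₀ (abs_circ_le _ _ _) (abs_nonneg _) (Real.abs_sin_le_one _)

theorem circ_true_coe (m : ℤ) (s : ℝ) :
    circ true m (s : AddCircle L) = Real.cos (2 * Real.pi * m / L * s) := by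
  have : (2 * Real.pi * Complex.I * m * s / L : ℂ) =
      ((2 * Real.pi * m / L * s : ℝ) : ℂ) * Complex.I := by push_cast; ring
  simp only [circ, if_true]
  rw [fourier_coe_apply, this, Complex.exp_ofReal_mul_I_re]

theorem circ_false_coe (m : ℤ) (s : ℝ) :
    circ false m (s : AddCircle L) = Real.sin (2 * Real.pi * m / L * s) := by
  have : (2 * Real.pi * Complex.I * m * s / L : ℂ) =
      ((2 * Real.pi * m / L * s : ℝ) : ℂ) * Complex.I := by push_cast; ring
  simp only [circ, Bool.false_eq_true, if_false]
  rw [fourier_coe_apply, this, Complex.exp_ofReal_mul_I_im]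

/-- Product-to-sum formulas, stated so that multiplying by a first harmonic visibly preserves the
span of the modes. -/
theorem circ_one_mul_circ (b c : Bool) (m : ℤ) : ∃ (d : Bool) (α β : ℝ), ∀ z : AddCircle L,
    circ b 1 z * circ c m z = α * circ d (m + 1) z + β * circ d (m - 1) z := by
  have h : ∀ z : AddCircle L, fourier (m - 1) z = fourier m z * (starRingEnd ℂ) (fourier 1 z) := by
    intro z; rw [sub_eq_add_neg, fourier_add, fourier_neg]
  cases b <;> cases c
  · refine ⟨true, -1 / 2, 1 / 2, fun z => ?_⟩
    simp [circ, h]; ring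
  · refine ⟨false, 1 / 2, -1 / 2, fun z => ?_⟩
    simp [circ, h]; ring
  · refine ⟨false, 1 / 2, 1 / 2, fun z => ?_⟩
    simp [circ, h]; ring
  · refine ⟨true, 1 / 2, 1 / 2, fun z => ?_⟩
    simp [circ, h]; ring

end Modes

/-! ### Completeness of the Dirichlet eigenfunctions in `L¹`. -/

section Completeness

variable {L H : ℝ}

instance [Fact (0 < L)] : IsFiniteMeasure (channelMeasure L H) := by
  unfold channelMeasure; infer_instance

/-- The closed channel. -/
abbrev ClosedChannel (L H : ℝ) : Type := AddCircle L × Icc (0 : ℝ) H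

/-- The eigenfunctions on the closed channel. -/
def modeClosed (b : Bool) (m : ℤ) (k : ℕ) : C(ClosedChannel L H, ℝ) where
  toFun x := mode H b m k (x.1, (x.2 : ℝ))
  continuous_toFun := (continuous_mode H b m k).comp (by fun_prop)

/-- The span of the eigenfunctions on the closed channel. -/
def modeSpan (L H : ℝ) : Submodule ℝ C(ClosedChannel L H, ℝ) :=
  Submodule.span ℝ (range fun i : Bool × ℤ × ℕ => modeClosed i.1 i.2.1 i.2.2)

/-- The first trigonometric functions along the channel. -/
def alongGen (b : Bool) : C(ClosedChannel L H, ℝ) where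
  toFun x := circ b 1 x.1
  continuous_toFun := (continuous_circ b 1).comp continuous_fst

/-- The first cosine across the channel. -/
def acrossGen : C(ClosedChannel L H, ℝ) where
  toFun x := Real.cos (freq H 0 * (x.2 : ℝ))
  continuous_toFun := by fun_prop

/-- The algebra generated by the first trigonometric functions. -/
def trigAlgebra (L H : ℝ) : Subalgebra ℝ C(ClosedChannel L H, ℝ) :=
  Algebra.adjoin ℝ (range alongGen ∪ {acrossGen})

theorem modeClosed_mem (b : Bool) (m : ℤ) (k : ℕ) :
    (modeClosed b m k : C(ClosedChannel L H, ℝ)) ∈ modeSpan L H :=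
  Submodule.subset_span ⟨(b, m, k), rfl⟩

theorem mul_mem_modeSpan_of_modes {a : C(ClosedChannel L H, ℝ)}
    (h : ∀ b m k, a * modeClosed b m k ∈ modeSpan L H) {f : C(ClosedChannel L H, ℝ)}
    (hf : f ∈ modeSpan L H) : a * f ∈ modeSpan L H := by
  induction hf using Submodule.span_induction with
  | mem f hf => obtain ⟨i, rfl⟩ := hf; exact h _ _ _
  | zero => rw [mul_zero]; exact Submodule.zero_mem _
  | add f g _ _ hf hg => rw [mul_add]; exact Submodule.add_mem _ hf hg
  | smul r f _ hf => rw [mul_smul_comm]; exact Submodule.smul_mem _ _ hf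

/-- The span of the modes is not dense among continuous functions on the closed channel, as modes
vanish on the boundary. It is a module over the trigonometric algebra, however, and that algebra is
dense. -/
theorem trigAlgebra_mul_mem {a f : C(ClosedChannel L H, ℝ)} (ha : a ∈ trigAlgebra L H)
    (hf : f ∈ modeSpan L H) : a * f ∈ modeSpan L H := by
  induction ha using Algebra.adjoin_induction generalizing f with
  | mem a ha =>
    refine mul_mem_modeSpan_of_modes (fun b m k => ?_) hf
    rcases ha with ⟨c, rfl⟩ | ha
    · obtain ⟨d, α, β, hd⟩ := circ_one_mul_circ (L := L) c b m
      have : alongGen c * modeClosed b m k =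
          α • modeClosed d (m + 1) k + β • (modeClosed d (m - 1) k : C(ClosedChannel L H, ℝ)) := by
        ext x
        simp only [alongGen, modeClosed, mode, ContinuousMap.mul_apply, ContinuousMap.coe_mk,
          ContinuousMap.add_apply, ContinuousMap.smul_apply, smul_eq_mul]
        rw [← mul_assoc, hd]; ring
      rw [this]
      exact Submodule.add_mem _ (Submodule.smul_mem _ _ (modeClosed_mem _ _ _))
        (Submodule.smul_mem _ _ (modeClosed_mem _ _ _))
    · rw [mem_singleton_iff.1 ha]
      have hsin : ∀ θ t : ℝ, Real.cos θ * Real.sin t =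
          (Real.sin (t + θ) + Real.sin (t - θ)) / 2 := by
        intro θ t; rw [Real.sin_add, Real.sin_sub]; ring
      rcases k with _ | k
      -- For the lowest transverse mode the difference frequency is zero, and only the sum term
      -- survives.
      · have : acrossGen * modeClosed b m 0 =
            (1 / 2 : ℝ) • (modeClosed b m 1 : C(ClosedChannel L H, ℝ)) := by
          ext x
          simp only [acrossGen, modeClosed, mode, ContinuousMap.mul_apply, ContinuousMap.coe_mk,
            ContinuousMap.smul_apply, smul_eq_mul]
          rw [mul_left_comm, hsin, sub_self, Real.sin_zero]
          have : freq H 0 * (x.2 : ℝ) + freq H 0 * (x.2 : ℝ) = freq H 1 * (x.2 : ℝ) := by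
            unfold freq; push_cast; ring
          rw [this]; ring
        rw [this]
        exact Submodule.smul_mem _ _ (modeClosed_mem _ _ _)
      · have : acrossGen * modeClosed b m (k + 1) =
            (1 / 2 : ℝ) • modeClosed b m (k + 2) +
              (1 / 2 : ℝ) • (modeClosed b m k : C(ClosedChannel L H, ℝ)) := by
          ext x
          simp only [acrossGen, modeClosed, mode, ContinuousMap.mul_apply, ContinuousMap.coe_mk,
            ContinuousMap.add_apply, ContinuousMap.smul_apply, smul_eq_mul]
          rw [mul_left_comm, hsin]
          have h1 : freq H (k + 1) * (x.2 : ℝ) + freq H 0 * (x.2 : ℝ) =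
              freq H (k + 2) * (x.2 : ℝ) := by
            unfold freq; push_cast; ring
          have h2 : freq H (k + 1) * (x.2 : ℝ) - freq H 0 * (x.2 : ℝ) =
              freq H k * (x.2 : ℝ) := by
            unfold freq; push_cast; ring
          rw [h1, h2]; ring
        rw [this]
        exact Submodule.add_mem _ (Submodule.smul_mem _ _ (modeClosed_mem _ _ _))
          (Submodule.smul_mem _ _ (modeClosed_mem _ _ _))
  | algebraMap r =>
    rw [Algebra.algebraMap_eq_smul_one, smul_mul_assoc, one_mul]
    exact Submodule.smul_mem _ _ hf
  | add a b _ _ ha hb => rw [add_mul]; exact Submodule.add_mem _ (ha hf) (hb hf)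
  | mul a b _ _ ha hb => rw [mul_assoc]; exact ha (hb hf)

variable [hL : Fact (0 < L)]

theorem trigAlgebra_separatesPoints (hH : 0 < H) : (trigAlgebra L H).SeparatesPoints := by
  intro x y hxy
  have hmem : ∀ a ∈ range alongGen ∪ {acrossGen}, a ∈ trigAlgebra L H := fun a ha =>
    Algebra.subset_adjoin ha
  by_cases h1 : x.1 = y.1
  · refine ⟨_, ⟨acrossGen, hmem _ (Or.inr rfl), rfl⟩, fun h => hxy (Prod.ext h1 ?_)⟩
    have hIcc : ∀ t : Icc (0 : ℝ) H, freq H 0 * (t : ℝ) ∈ Icc 0 Real.pi := by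
      intro t
      have ht := t.2
      have hf : freq H 0 = Real.pi / H := by unfold freq; simp
      have hpi := Real.pi_pos
      rw [hf]
      refine ⟨mul_nonneg (by positivity) ht.1, ?_⟩
      rw [div_mul_eq_mul_div, div_le_iff₀ hH]
      exact mul_le_mul_of_nonneg_left ht.2 hpi.le
    have := Real.injOn_cos (hIcc x.2) (hIcc y.2) h
    have hf : freq H 0 ≠ 0 := by
      unfold freq
      have hpi := Real.pi_pos
      positivity
    exact Subtype.ext (mul_left_cancel₀ hf this)
  · have hne : fourier 1 x.1 ≠ fourier 1 y.1 := by
      intro h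
      rw [fourier_one, fourier_one] at h
      exact h1 (AddCircle.injective_toCircle hL.out.ne' (Subtype.ext h))
    by_cases hre : (fourier 1 x.1).re = (fourier 1 y.1).re
    · refine ⟨_, ⟨alongGen false, hmem _ (Or.inl ⟨_, rfl⟩), rfl⟩, fun h => hne ?_⟩
      exact Complex.ext hre h
    · exact ⟨_, ⟨alongGen true, hmem _ (Or.inl ⟨_, rfl⟩), rfl⟩, hre⟩

theorem ae_channel_mem : ∀ᵐ x ∂(channelMeasure L H), x.2 ∈ Ioo 0 H := by
  unfold channelMeasure
  exact Measure.quasiMeasurePreserving_snd.ae (ae_restrict_mem measurableSet_Ioo)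

/-- The Dirichlet eigenfunctions are complete in `L¹`. -/
theorem ae_eq_zero_of_modes (hH : 0 < H) {u : AddCircle L × ℝ → ℝ}
    (hu : Integrable u (channelMeasure L H))
    (h : ∀ b m k, ∫ x, u x * mode H b m k x ∂(channelMeasure L H) = 0) :
    u =ᵐ[channelMeasure L H] 0 := by
  set μ := channelMeasure L H
  -- Clamping the second coordinate provides the compact space needed for Stone–Weierstrass and
  -- changes nothing almost everywhere.
  let P : AddCircle L × ℝ → ClosedChannel L H := fun x => (x.1, projIcc 0 H hH.le x.2)
  have hP : Continuous P := continuous_fst.prodMk (continuous_projIcc.comp continuous_snd)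
  have hPx : ∀ x : AddCircle L × ℝ, x.2 ∈ Ioo 0 H → ((P x).2 : ℝ) = x.2 := fun x hx => by
    simp only [P]; rw [projIcc_of_mem hH.le ⟨hx.1.le, hx.2.le⟩]
  have hint : ∀ a : C(ClosedChannel L H, ℝ), Integrable (fun x => u x * a (P x)) μ := fun a =>
    hu.mul_bdd (a.continuous.comp hP).aestronglyMeasurable
      (Eventually.of_forall fun x => a.norm_coe_le_norm (P x))
  have hspan : ∀ a ∈ modeSpan L H, ∫ x, u x * a (P x) ∂μ = 0 := by
    intro a ha
    induction ha using Submodule.span_induction with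
    | mem f hf =>
      obtain ⟨i, rfl⟩ := hf
      refine Eq.trans (integral_congr_ae ?_) (h i.1 i.2.1 i.2.2)
      filter_upwards [ae_channel_mem] with x hx
      simp only [modeClosed, ContinuousMap.coe_mk, hPx x hx]
      rfl
    | zero => simp
    | add f g _ _ hf hg =>
      simp only [ContinuousMap.add_apply, mul_add]
      rw [integral_add (hint f) (hint g), hf, hg, add_zero]
    | smul r f _ hf =>
      simp only [ContinuousMap.smul_apply, smul_eq_mul, mul_left_comm _ r]
      rw [integral_const_mul, hf, mul_zero]
  -- S is sin(πx₂/H), positive in the open channel. The algebra times S lies in the mode span, so uS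
  -- annihilates all continuous functions; S is divided out at the end.
  let S : C(ClosedChannel L H, ℝ) := modeClosed true 0 0
  have hS : ∀ y, |S y| ≤ 1 := fun y => abs_mode_le H true 0 0 (y.1, (y.2 : ℝ))
  have hall : ∀ g : C(ClosedChannel L H, ℝ), ∫ x, u x * (g * S) (P x) ∂μ = 0 := by
    intro g
    have hcont : Continuous fun a : C(ClosedChannel L H, ℝ) => ∫ x, u x * (a * S) (P x) ∂μ := by
      refine LipschitzWith.continuous (K := (∫ x, |u x| ∂μ).toNNReal)
        (LipschitzWith.of_dist_le_mul fun a b => ?_)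
      rw [Real.coe_toNNReal _ (integral_nonneg fun x => abs_nonneg _), Real.dist_eq,
        ← integral_sub (hint _) (hint _),
        mul_comm (∫ x, |u x| ∂μ), dist_eq_norm]
      have e : ∀ x, u x * (a * S) (P x) - u x * (b * S) (P x) = u x * ((a - b) * S) (P x) := by
        intro x; simp only [ContinuousMap.mul_apply, ContinuousMap.sub_apply]; ring
      rw [integral_congr_ae (Eventually.of_forall e)]
      refine abs_integral_mul_le hu (Eventually.of_forall fun x => ?_)
      rw [ContinuousMap.mul_apply, abs_mul]
      calc |(a - b) (P x)| * |S (P x)| ≤ ‖a - b‖ * 1 := by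
            gcongr
            · exact (a - b).norm_coe_le_norm (P x)
            · exact hS _
        _ = ‖a - b‖ := mul_one _
    have hg : g ∈ closure (trigAlgebra L H : Set C(ClosedChannel L H, ℝ)) := by
      have := ContinuousMap.subalgebra_topologicalClosure_eq_top_of_separatesPoints _
        (trigAlgebra_separatesPoints (L := L) hH)
      rw [← Subalgebra.topologicalClosure_coe, this]
      trivial
    exact closure_minimal (fun a ha => hspan _ (trigAlgebra_mul_mem ha (modeClosed_mem _ _ _)))
      (isClosed_eq hcont continuous_const) hg
  -- Indicators of closed sets are limits of thickened indicators, which are continuous; vanishing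
  -- integrals over closed sets determine the function.
  have hzero : (fun x => u x * S (P x)) =ᵐ[μ] 0 := by
    refine ae_eq_zero_of_forall_setIntegral_isClosed_eq_zero (hint S) fun F hF => ?_
    have hδ : ∀ n : ℕ, (0 : ℝ) < 1 / ((n : ℝ) + 1) := fun n => by positivity
    have hlim : Tendsto (fun n => ∫ x, u x * S (P x) * (thickenedIndicator (hδ n) F x : ℝ) ∂μ)
        atTop (𝓝 (∫ x, u x * S (P x) * F.indicator (fun _ => (1 : ℝ)) x ∂μ)) := by
      refine tendsto_integral_of_dominated_convergence (fun x => |u x * S (P x)|)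
        (fun n => (hint S).aestronglyMeasurable.mul
          (NNReal.continuous_coe.comp (thickenedIndicator (hδ n) F).continuous).aestronglyMeasurable)
        (hint S).abs (fun n => Eventually.of_forall fun x => ?_)
        (Eventually.of_forall fun x => ?_)
      · rw [norm_mul, Real.norm_eq_abs, Real.norm_of_nonneg (NNReal.coe_nonneg _)]
        exact mul_le_of_le_one_right (abs_nonneg _)
          (by exact_mod_cast thickenedIndicator_le_one (hδ n) F x)
      · have h1 := tendsto_pi_nhds.1 (thickenedIndicator_tendsto_indicator_closure hδ
          tendsto_one_div_add_atTop_nhds_zero_nat F) x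
        rw [hF.closure_eq] at h1
        have h2 := (NNReal.continuous_coe.tendsto _).comp h1
        have h3 : ((F.indicator (fun _ => (1 : NNReal)) x : NNReal) : ℝ) =
            F.indicator (fun _ => (1 : ℝ)) x := by
          by_cases hx : x ∈ F <;> simp [hx]
        rw [h3] at h2
        exact h2.const_mul _
    have hn : ∀ n : ℕ, ∫ x, u x * S (P x) * (thickenedIndicator (hδ n) F x : ℝ) ∂μ = 0 := by
      intro n
      let g : C(ClosedChannel L H, ℝ) :=
        ⟨fun y => (thickenedIndicator (hδ n) F (y.1, (y.2 : ℝ)) : ℝ), by fun_prop⟩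
      refine Eq.trans (integral_congr_ae ?_) (hall g)
      filter_upwards [ae_channel_mem] with x hx
      simp only [ContinuousMap.mul_apply, g, ContinuousMap.coe_mk, hPx x hx]
      simp only [P]
      ring
    simp_rw [hn] at hlim
    have := tendsto_nhds_unique hlim tendsto_const_nhds
    rw [← integral_indicator hF.measurableSet]
    refine Eq.trans ?_ this
    refine integral_congr_ae (Eventually.of_forall fun x => ?_)
    by_cases hx : x ∈ F <;> simp [hx]
  filter_upwards [hzero, ae_channel_mem] with x hx hx2
  refine (mul_eq_zero.1 hx).resolve_right ?_
  have e : S (P x) = Real.sin (Real.pi * (x.2 / H)) := by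
    simp only [S, modeClosed, ContinuousMap.coe_mk, mode, hPx x hx2, circ, if_true, fourier_zero,
      Complex.one_re, one_mul, freq]
    congr 1
    push_cast
    ring
  rw [e]
  have h0 : 0 < x.2 / H := div_pos hx2.1 hH
  have h1 : x.2 / H < 1 := (div_lt_one hH).2 hx2.2
  exact (Real.sin_pos_of_pos_of_lt_pi (by positivity) (by nlinarith [Real.pi_pos])).ne'

end Completeness

/-! ### Second derivatives of modes and test functions, and Green's identity. -/

section TestFunctions

theorem iteratedDeriv_two_eq {f f' f'' : ℝ → ℝ} (h1 : ∀ s, HasDerivAt f (f' s) s)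
    (h2 : ∀ s, HasDerivAt f' (f'' s) s) : iteratedDeriv 2 f = f'' := by
  rw [iteratedDeriv_succ, iteratedDeriv_one, show deriv f = f' from funext fun s => (h1 s).deriv]
  exact funext fun s => (h2 s).deriv

/-- Green's second identity in one variable, with vanishing boundary terms. -/
theorem integral_mul_second_deriv {f f' f'' g g' g'' : ℝ → ℝ} {a b : ℝ}
    (hf : ∀ s, HasDerivAt f (f' s) s) (hf' : ∀ s, HasDerivAt f' (f'' s) s)
    (hg : ∀ s, HasDerivAt g (g' s) s) (hg' : ∀ s, HasDerivAt g' (g'' s) s)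
    (cf : Continuous f'') (cg : Continuous g'')
    (hbd : g b * f' b - g a * f' a = g' b * f b - g' a * f a) :
    ∫ s in a..b, g s * f'' s = ∫ s in a..b, g'' s * f s := by
  have c1 : Continuous f' := continuous_iff_continuousAt.2 fun s => (hf' s).continuousAt
  have c2 : Continuous g' := continuous_iff_continuousAt.2 fun s => (hg' s).continuousAt
  have e1 := intervalIntegral.integral_mul_deriv_eq_deriv_mul (a := a) (b := b)
    (fun s _ => hg s) (fun s _ => hf' s) (c2.intervalIntegrable _ _) (cf.intervalIntegrable _ _)
  have e2 := intervalIntegral.integral_mul_deriv_eq_deriv_mul (a := a) (b := b)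
    (fun s _ => hg' s) (fun s _ => hf s) (cg.intervalIntegrable _ _) (c1.intervalIntegrable _ _)
  rw [e1, e2]
  linarith

variable {L : ℝ}

/-- The wave numbers along the channel. -/
def wave (L : ℝ) (m : ℤ) : ℝ := 2 * Real.pi * m / L

/-- The Dirichlet eigenvalues of the channel. -/
def eig (L H : ℝ) (m : ℤ) (k : ℕ) : ℝ := wave L m ^ 2 + freq H k ^ 2

/-- The derivative of `circ b m` lifted to the line. -/
def circDeriv (L : ℝ) (b : Bool) (m : ℤ) (s : ℝ) : ℝ :=
  if b then -(wave L m * circ false m (s : AddCircle L))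
  else wave L m * circ true m (s : AddCircle L)

theorem hasDerivAt_circ (b : Bool) (m : ℤ) (s : ℝ) :
    HasDerivAt (fun s : ℝ => circ b m (s : AddCircle L)) (circDeriv L b m s) s := by
  have hw : HasDerivAt (fun s : ℝ => wave L m * s) (wave L m) s := by
    simpa using (hasDerivAt_id s).const_mul (wave L m)
  cases b
  · simp only [circDeriv, circ_false_coe, circ_true_coe, Bool.false_eq_true, if_false]
    exact hw.sin.congr_deriv (mul_comm _ _)
  · simp only [circDeriv, circ_false_coe, circ_true_coe, if_true]
    refine hw.cos.congr_deriv ?_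
    rw [mul_comm, mul_neg]; rfl

theorem hasDerivAt_circDeriv (b : Bool) (m : ℤ) (s : ℝ) :
    HasDerivAt (circDeriv L b m) (-wave L m ^ 2 * circ b m (s : AddCircle L)) s := by
  cases b
  · have h := (hasDerivAt_circ (L := L) true m s).const_mul (wave L m)
    refine h.congr_deriv ?_
    simp only [circDeriv, if_true]; ring
  · have h := ((hasDerivAt_circ (L := L) false m s).const_mul (wave L m)).neg
    refine h.congr_deriv ?_
    simp only [circDeriv, Bool.false_eq_true, if_false]; ring

theorem hasDerivAt_sin_mul (κ s : ℝ) :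
    HasDerivAt (fun s : ℝ => Real.sin (κ * s)) (κ * Real.cos (κ * s)) s := by
  have hw : HasDerivAt (fun s : ℝ => κ * s) κ s := by
    simpa using (hasDerivAt_id s).const_mul κ
  exact hw.sin.congr_deriv (mul_comm _ _)

theorem hasDerivAt_cos_mul (κ s : ℝ) :
    HasDerivAt (fun s : ℝ => κ * Real.cos (κ * s)) (-κ ^ 2 * Real.sin (κ * s)) s := by
  have hw : HasDerivAt (fun s : ℝ => κ * s) κ s := by
    simpa using (hasDerivAt_id s).const_mul κ
  exact (hw.cos.const_mul κ).congr_deriv (by ring)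

theorem sin_freq_mul {H : ℝ} (hH : 0 < H) (k : ℕ) : Real.sin (freq H k * H) = 0 := by
  rw [freq, div_mul_cancel₀ _ hH.ne']
  exact_mod_cast Real.sin_nat_mul_pi (k + 1)

theorem laplacian_mode (H : ℝ) (b : Bool) (m : ℤ) (k : ℕ) (x : AddCircle L × ℝ) :
    laplacian (mode H b m k) x = -(eig L H m k * mode H b m k x) := by
  obtain ⟨x₁, x₂⟩ := x
  obtain ⟨t, rfl⟩ := QuotientAddGroup.mk_surjective x₁
  have h1 : iteratedDeriv 2 (fun s : ℝ => mode H b m k ((t : AddCircle L) + (s : AddCircle L), x₂))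
      0 = -wave L m ^ 2 * circ b m (t : AddCircle L) * Real.sin (freq H k * x₂) := by
    have hs : ∀ s : ℝ, HasDerivAt (fun s : ℝ => t + s) 1 s := fun s => by
      simpa using (hasDerivAt_id s).const_add t
    have e := iteratedDeriv_two_eq
      (f := fun s : ℝ => mode H b m k ((t : AddCircle L) + (s : AddCircle L), x₂))
      (f' := fun s => circDeriv L b m (t + s) * Real.sin (freq H k * x₂))
      (f'' := fun s => -wave L m ^ 2 * circ b m ((t + s : ℝ) : AddCircle L) *
        Real.sin (freq H k * x₂))
      (fun s => by
        have := ((hasDerivAt_circ (L := L) b m (t + s)).comp s (hs s)).mul_const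
          (Real.sin (freq H k * x₂))
        simpa [Function.comp_def, mode] using this)
      (fun s => by
        have := ((hasDerivAt_circDeriv (L := L) b m (t + s)).comp s (hs s)).mul_const
          (Real.sin (freq H k * x₂))
        simpa [Function.comp_def] using this)
    rw [e]; simp
  have h2 : iteratedDeriv 2 (fun s : ℝ => mode H b m k ((t : AddCircle L), s)) x₂ =
      circ b m (t : AddCircle L) * (-freq H k ^ 2 * Real.sin (freq H k * x₂)) := by
    rw [iteratedDeriv_two_eq (f := fun s : ℝ => mode H b m k ((t : AddCircle L), s))
      (f' := fun s => circ b m (t : AddCircle L) * (freq H k * Real.cos (freq H k * s)))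
      (f'' := fun s => circ b m (t : AddCircle L) * (-freq H k ^ 2 * Real.sin (freq H k * s)))
      (fun s => (hasDerivAt_sin_mul (freq H k) s).const_mul (circ b m (t : AddCircle L)))
      (fun s => (hasDerivAt_cos_mul (freq H k) s).const_mul _)]
  unfold laplacian
  simp only
  erw [h1, h2]
  simp only [mode, eig]
  change _ = -((wave L m ^ 2 + freq H k ^ 2) * (circ b m (t : AddCircle L) * _))
  ring

theorem isDirichletTest_mode {H : ℝ} (hH : 0 < H) (b : Bool) (m : ℤ) (k : ℕ) :
    IsDirichletTest H (mode H b m k : AddCircle L × ℝ → ℝ) where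
  smooth := by
    cases b
    · simp only [mode, circ_false_coe]; fun_prop
    · simp only [mode, circ_true_coe]; fun_prop
  bottom x := by simp [mode]
  top x := by simp only [mode]; rw [sin_freq_mul hH, mul_zero]

/-- Directional derivative on the plane. -/
def planeDeriv (e : ℝ × ℝ) (Φ : ℝ × ℝ → ℝ) (y : ℝ × ℝ) : ℝ := fderiv ℝ Φ y e

theorem contDiff_planeDeriv (e : ℝ × ℝ) {Φ : ℝ × ℝ → ℝ} (h : ContDiff ℝ ∞ Φ) :
    ContDiff ℝ ∞ (planeDeriv e Φ) := by
  unfold planeDeriv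
  exact (h.fderiv_right (m := ∞) (by simp)).clm_apply contDiff_const

theorem hasDerivAt_fst {Φ : ℝ × ℝ → ℝ} (h : ContDiff ℝ ∞ Φ) (t s : ℝ) :
    HasDerivAt (fun s => Φ (s, t)) (planeDeriv (1, 0) Φ (s, t)) s := by
  have h1 : HasFDerivAt Φ (fderiv ℝ Φ (s, t)) (s, t) :=
    (h.differentiable (by simp)).differentiableAt.hasFDerivAt
  exact h1.comp_hasDerivAt s ((hasDerivAt_id s).prodMk (hasDerivAt_const s t))

theorem hasDerivAt_snd {Φ : ℝ × ℝ → ℝ} (h : ContDiff ℝ ∞ Φ) (t s : ℝ) :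
    HasDerivAt (fun s => Φ (t, s)) (planeDeriv (0, 1) Φ (t, s)) s := by
  have h1 : HasFDerivAt Φ (fderiv ℝ Φ (t, s)) (t, s) :=
    (h.differentiable (by simp)).differentiableAt.hasFDerivAt
  exact h1.comp_hasDerivAt s ((hasDerivAt_const s t).prodMk (hasDerivAt_id s))

theorem continuous_of_continuous_lift {g : AddCircle L × ℝ → ℝ}
    (h : Continuous fun y : ℝ × ℝ => g ((y.1 : AddCircle L), y.2)) : Continuous g := by
  have hq : IsOpenQuotientMap (Prod.map (QuotientAddGroup.mk : ℝ → AddCircle L) (id : ℝ → ℝ)) :=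
    QuotientAddGroup.isOpenQuotientMap_mk.prodMap IsOpenQuotientMap.id
  exact hq.isQuotientMap.continuous_iff.2 h

variable {H : ℝ}

/-- The second derivative along the channel. -/
def alongSecond (φ : AddCircle L × ℝ → ℝ) (x : AddCircle L × ℝ) : ℝ :=
  iteratedDeriv 2 (fun s : ℝ => φ (x.1 + (s : AddCircle L), x.2)) 0

/-- The second derivative across the channel. -/
def acrossSecond (φ : AddCircle L × ℝ → ℝ) (x : AddCircle L × ℝ) : ℝ :=
  iteratedDeriv 2 (fun s : ℝ => φ (x.1, s)) x.2

theorem alongSecond_coe {φ : AddCircle L × ℝ → ℝ}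
    (h : ContDiff ℝ ∞ fun y : ℝ × ℝ => φ ((y.1 : AddCircle L), y.2)) (t s : ℝ) :
    alongSecond φ ((t : AddCircle L), s) = planeDeriv (1, 0) (planeDeriv (1, 0)
      fun y : ℝ × ℝ => φ ((y.1 : AddCircle L), y.2)) (t, s) := by
  set Φ := fun y : ℝ × ℝ => φ ((y.1 : AddCircle L), y.2) with hΦ
  have hs : ∀ r : ℝ, HasDerivAt (fun r : ℝ => t + r) 1 r := fun r => by
    simpa using (hasDerivAt_id r).const_add t
  have e := iteratedDeriv_two_eq (f := fun r : ℝ => Φ (t + r, s))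
    (f' := fun r => planeDeriv (1, 0) Φ (t + r, s))
    (f'' := fun r => planeDeriv (1, 0) (planeDeriv (1, 0) Φ) (t + r, s))
    (fun r => by simpa [Function.comp_def] using (hasDerivAt_fst h s (t + r)).comp r (hs r))
    (fun r => by simpa [Function.comp_def] using
      (hasDerivAt_fst (contDiff_planeDeriv _ h) s (t + r)).comp r (hs r))
  have e' := congrFun e 0
  rw [add_zero] at e'
  rw [← e']
  simp only [alongSecond, hΦ, AddCircle.coe_add]

theorem acrossSecond_coe {φ : AddCircle L × ℝ → ℝ}
    (h : ContDiff ℝ ∞ fun y : ℝ × ℝ => φ ((y.1 : AddCircle L), y.2)) (t s : ℝ) :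
    acrossSecond φ ((t : AddCircle L), s) = planeDeriv (0, 1) (planeDeriv (0, 1)
      fun y : ℝ × ℝ => φ ((y.1 : AddCircle L), y.2)) (t, s) := by
  set Φ := fun y : ℝ × ℝ => φ ((y.1 : AddCircle L), y.2) with hΦ
  have e := iteratedDeriv_two_eq (f := fun r : ℝ => Φ (t, r))
    (f' := fun r => planeDeriv (0, 1) Φ (t, r))
    (f'' := fun r => planeDeriv (0, 1) (planeDeriv (0, 1) Φ) (t, r))
    (fun r => hasDerivAt_snd h t r)
    (fun r => hasDerivAt_snd (contDiff_planeDeriv _ h) t r)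
  exact congrFun e s

theorem IsDirichletTest.continuous {φ : AddCircle L × ℝ → ℝ} (h : IsDirichletTest H φ) :
    Continuous φ := continuous_of_continuous_lift h.smooth.continuous

theorem IsDirichletTest.continuous_alongSecond {φ : AddCircle L × ℝ → ℝ}
    (h : IsDirichletTest H φ) : Continuous (alongSecond φ) := by
  refine continuous_of_continuous_lift ?_
  have : (fun y : ℝ × ℝ => alongSecond φ ((y.1 : AddCircle L), y.2)) = planeDeriv (1, 0)
      (planeDeriv (1, 0) fun y : ℝ × ℝ => φ ((y.1 : AddCircle L), y.2)) :=
    funext fun y => alongSecond_coe h.smooth y.1 y.2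
  rw [this]
  exact (contDiff_planeDeriv _ (contDiff_planeDeriv _ h.smooth)).continuous

theorem IsDirichletTest.continuous_acrossSecond {φ : AddCircle L × ℝ → ℝ}
    (h : IsDirichletTest H φ) : Continuous (acrossSecond φ) := by
  refine continuous_of_continuous_lift ?_
  have : (fun y : ℝ × ℝ => acrossSecond φ ((y.1 : AddCircle L), y.2)) = planeDeriv (0, 1)
      (planeDeriv (0, 1) fun y : ℝ × ℝ => φ ((y.1 : AddCircle L), y.2)) :=
    funext fun y => acrossSecond_coe h.smooth y.1 y.2
  rw [this]
  exact (contDiff_planeDeriv _ (contDiff_planeDeriv _ h.smooth)).continuous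

theorem IsDirichletTest.continuous_laplacian {φ : AddCircle L × ℝ → ℝ}
    (h : IsDirichletTest H φ) : Continuous (laplacian φ) :=
  h.continuous_alongSecond.add h.continuous_acrossSecond

variable [hL : Fact (0 < L)]

theorem exists_bound_of_continuous {g : AddCircle L × ℝ → ℝ} (hg : Continuous g) :
    ∃ C, ∀ᵐ x ∂(channelMeasure L H), |g x| ≤ C := by
  obtain ⟨C, hC⟩ := (isCompact_univ.prod (isCompact_Icc (a := (0 : ℝ))
    (b := H))).exists_bound_of_continuousOn (s := (univ : Set (AddCircle L)) ×ˢ Icc 0 H)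
    hg.continuousOn
  refine ⟨C, ?_⟩
  filter_upwards [ae_channel_mem] with x hx
  exact hC x ⟨mem_univ _, hx.1.le, hx.2.le⟩

theorem integrable_of_continuous {g : AddCircle L × ℝ → ℝ} (hg : Continuous g) :
    Integrable g (channelMeasure L H) := by
  obtain ⟨C, hC⟩ := exists_bound_of_continuous (H := H) hg
  exact Integrable.of_bound hg.aestronglyMeasurable C hC

/-- Two integrations by parts along each horizontal circle; boundary terms cancel because values and
first derivatives are periodic. -/
theorem integral_mode_mul_along {φ : AddCircle L × ℝ → ℝ} (h : IsDirichletTest H φ)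
    (b : Bool) (m : ℤ) (k : ℕ) :
    ∫ x, mode H b m k x * alongSecond φ x ∂(channelMeasure L H) =
      -wave L m ^ 2 * ∫ x, mode H b m k x * φ x ∂(channelMeasure L H) := by
  have i1 : Integrable (fun x => mode H b m k x * alongSecond φ x) (channelMeasure L H) :=
    integrable_of_continuous ((continuous_mode H b m k).mul h.continuous_alongSecond)
  have i2 : Integrable (fun x => mode H b m k x * φ x) (channelMeasure L H) :=
    integrable_of_continuous ((continuous_mode H b m k).mul h.continuous)
  unfold channelMeasure at i1 i2 ⊢
  rw [integral_prod_symm _ i1, integral_prod_symm _ i2, ← integral_const_mul]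
  congr 1
  funext s
  rw [← AddCircle.intervalIntegral_preimage L 0, ← AddCircle.intervalIntegral_preimage L 0,
    ← intervalIntegral.integral_const_mul]
  set Φ := fun y : ℝ × ℝ => φ ((y.1 : AddCircle L), y.2) with hΦ
  have hper : ∀ t : ℝ, ((t + L : ℝ) : AddCircle L) = (t : AddCircle L) := fun t =>
    AddCircle.coe_add_period L t
  have hper0 : ((0 + L : ℝ) : AddCircle L) = ((0 : ℝ) : AddCircle L) := hper 0
  have hΦper : Φ (0 + L, s) = Φ (0, s) := by simp only [hΦ, hper0]
  have hΦ'per : planeDeriv (1, 0) Φ (0 + L, s) = planeDeriv (1, 0) Φ (0, s) := by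
    have a1 := hasDerivAt_fst h.smooth s 0
    have a2 : HasDerivAt (fun r => Φ (r + L, s)) (planeDeriv (1, 0) Φ (0 + L, s)) 0 := by
      have := (hasDerivAt_fst h.smooth s (0 + L)).comp_add_const 0 L
      exact this
    have e : (fun r => Φ (r + L, s)) = fun r => Φ (r, s) := by
      funext r; simp only [hΦ, hper]
    rw [e] at a2
    exact a2.unique a1
  have hDper : circDeriv L b m (0 + L) = circDeriv L b m 0 := by
    simp only [circDeriv, hper0]
  have key := integral_mul_second_deriv (a := 0) (b := 0 + L)
    (f := fun t => Φ (t, s)) (f' := fun t => planeDeriv (1, 0) Φ (t, s))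
    (f'' := fun t => planeDeriv (1, 0) (planeDeriv (1, 0) Φ) (t, s))
    (g := fun t => circ b m (t : AddCircle L)) (g' := circDeriv L b m)
    (g'' := fun t => -wave L m ^ 2 * circ b m (t : AddCircle L))
    (fun t => hasDerivAt_fst h.smooth s t)
    (fun t => hasDerivAt_fst (contDiff_planeDeriv _ h.smooth) s t)
    (fun t => hasDerivAt_circ b m t) (fun t => hasDerivAt_circDeriv b m t)
    ((contDiff_planeDeriv _ (contDiff_planeDeriv _ h.smooth)).continuous.comp (by fun_prop))
    (continuous_const.mul ((continuous_circ b m).comp (AddCircle.continuous_mk' L)))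
    (by simp only [hΦper, hΦ'per, hDper, hper0, sub_self])
  calc ∫ t in (0 : ℝ)..0 + L, mode H b m k ((t : AddCircle L), s) *
        alongSecond φ ((t : AddCircle L), s)
      = Real.sin (freq H k * s) * ∫ t in (0 : ℝ)..0 + L, circ b m (t : AddCircle L) *
        planeDeriv (1, 0) (planeDeriv (1, 0) Φ) (t, s) := by
        rw [← intervalIntegral.integral_const_mul]
        refine intervalIntegral.integral_congr fun t _ => ?_
        simp only [alongSecond_coe h.smooth, mode]
        ring
    _ = _ := by
        rw [key, ← intervalIntegral.integral_const_mul]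
        refine intervalIntegral.integral_congr fun t _ => ?_
        simp only [mode, hΦ]
        ring

/-- Two integrations by parts on each vertical segment; boundary terms vanish because both the sine
factor and the test function are zero at its ends, so normal derivatives do not matter. -/
theorem integral_mode_mul_across (hH : 0 < H) {φ : AddCircle L × ℝ → ℝ} (h : IsDirichletTest H φ)
    (b : Bool) (m : ℤ) (k : ℕ) :
    ∫ x, mode H b m k x * acrossSecond φ x ∂(channelMeasure L H) =
      -freq H k ^ 2 * ∫ x, mode H b m k x * φ x ∂(channelMeasure L H) := by
  have i1 : Integrable (fun x => mode H b m k x * acrossSecond φ x) (channelMeasure L H) :=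
    integrable_of_continuous ((continuous_mode H b m k).mul h.continuous_acrossSecond)
  have i2 : Integrable (fun x => mode H b m k x * φ x) (channelMeasure L H) :=
    integrable_of_continuous ((continuous_mode H b m k).mul h.continuous)
  unfold channelMeasure at i1 i2 ⊢
  rw [integral_prod _ i1, integral_prod _ i2, ← integral_const_mul]
  congr 1
  funext z
  obtain ⟨t, rfl⟩ := QuotientAddGroup.mk_surjective z
  change ∫ s in Ioo 0 H, mode H b m k ((t : AddCircle L), s) * acrossSecond φ ((t : AddCircle L), s)
    = -freq H k ^ 2 * ∫ s in Ioo 0 H, mode H b m k ((t : AddCircle L), s) * φ ((t : AddCircle L), s)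
  rw [← integral_Ioc_eq_integral_Ioo, ← integral_Ioc_eq_integral_Ioo,
    ← intervalIntegral.integral_of_le hH.le, ← intervalIntegral.integral_of_le hH.le,
    ← intervalIntegral.integral_const_mul]
  set Φ := fun y : ℝ × ℝ => φ ((y.1 : AddCircle L), y.2) with hΦ
  have hbot : Φ (t, 0) = 0 := h.bottom _
  have htop : Φ (t, H) = 0 := h.top _
  have key := integral_mul_second_deriv (a := 0) (b := H)
    (f := fun s => Φ (t, s)) (f' := fun s => planeDeriv (0, 1) Φ (t, s))
    (f'' := fun s => planeDeriv (0, 1) (planeDeriv (0, 1) Φ) (t, s))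
    (g := fun s => Real.sin (freq H k * s)) (g' := fun s => freq H k * Real.cos (freq H k * s))
    (g'' := fun s => -freq H k ^ 2 * Real.sin (freq H k * s))
    (fun s => hasDerivAt_snd h.smooth t s)
    (fun s => hasDerivAt_snd (contDiff_planeDeriv _ h.smooth) t s)
    (fun s => hasDerivAt_sin_mul _ s) (fun s => hasDerivAt_cos_mul _ s)
    ((contDiff_planeDeriv _ (contDiff_planeDeriv _ h.smooth)).continuous.comp (by fun_prop))
    (by fun_prop)
    (by simp only [hbot, htop, sin_freq_mul hH]; simp)
  calc ∫ s in (0 : ℝ)..H, mode H b m k ((t : AddCircle L), s) *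
        acrossSecond φ ((t : AddCircle L), s)
      = circ b m (t : AddCircle L) * ∫ s in (0 : ℝ)..H, Real.sin (freq H k * s) *
        planeDeriv (0, 1) (planeDeriv (0, 1) Φ) (t, s) := by
        rw [← intervalIntegral.integral_const_mul]
        refine intervalIntegral.integral_congr fun s _ => ?_
        simp only [acrossSecond_coe h.smooth, mode]
        ring
    _ = _ := by
        rw [key, ← intervalIntegral.integral_const_mul]
        refine intervalIntegral.integral_congr fun s _ => ?_
        simp only [mode, hΦ]
        ring

/-- Green's identity between a Dirichlet eigenfunction and a test function. -/
theorem integral_mode_mul_laplacian (hH : 0 < H) {φ : AddCircle L × ℝ → ℝ}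
    (h : IsDirichletTest H φ) (b : Bool) (m : ℤ) (k : ℕ) :
    ∫ x, mode H b m k x * (-laplacian φ x) ∂(channelMeasure L H) =
      eig L H m k * ∫ x, mode H b m k x * φ x ∂(channelMeasure L H) := by
  have i1 : Integrable (fun x => mode H b m k x * alongSecond φ x) (channelMeasure L H) :=
    integrable_of_continuous ((continuous_mode H b m k).mul h.continuous_alongSecond)
  have i2 : Integrable (fun x => mode H b m k x * acrossSecond φ x) (channelMeasure L H) :=
    integrable_of_continuous ((continuous_mode H b m k).mul h.continuous_acrossSecond)
  have e : ∀ x, mode H b m k x * (-laplacian φ x) =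
      -(mode H b m k x * alongSecond φ x + mode H b m k x * acrossSecond φ x) := by
    intro x; unfold laplacian alongSecond acrossSecond; ring
  simp_rw [e]
  rw [integral_neg, integral_add i1 i2, integral_mode_mul_along h,
    integral_mode_mul_across hH h, eig]
  ring

end TestFunctions

/-! ### Orthogonality relations along and across the channel. -/

section Orthogonality

variable {L : ℝ}

theorem circ_true_neg (m : ℤ) (z : AddCircle L) : circ true (-m) z = circ true m z := by
  simp [circ]

theorem circ_false_neg (m : ℤ) (z : AddCircle L) : circ false (-m) z = -circ false m z := by
  simp [circ]

theorem circ_true_sub (n : ℤ) (z y : AddCircle L) :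
    circ true n (z - y) = circ true n z * circ true n y + circ false n z * circ false n y := by
  obtain ⟨s, rfl⟩ := QuotientAddGroup.mk_surjective z
  obtain ⟨t, rfl⟩ := QuotientAddGroup.mk_surjective y
  change circ true n ((s - t : ℝ) : AddCircle L) = circ true n (s : AddCircle L) *
    circ true n (t : AddCircle L) + circ false n (s : AddCircle L) * circ false n (t : AddCircle L)
  simp only [circ_true_coe, circ_false_coe]
  rw [mul_sub, Real.cos_sub]

theorem fourier_sub_index (n m : ℤ) (z : AddCircle L) :
    fourier (n - m) z = fourier n z * (starRingEnd ℂ) (fourier m z) := by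
  rw [sub_eq_add_neg, fourier_add, fourier_neg]

theorem circ_true_mul_true (n m : ℤ) (z : AddCircle L) :
    circ true n z * circ true m z = (1 / 2) * circ true (n + m) z + (1 / 2) * circ true (n - m) z := by
  have h := fourier_sub_index n m z
  simp only [circ, h, fourier_add]
  simp; ring

theorem circ_false_mul_false (n m : ℤ) (z : AddCircle L) :
    circ false n z * circ false m z =
      (1 / 2) * circ true (n - m) z - (1 / 2) * circ true (n + m) z := by
  have h := fourier_sub_index n m z
  simp only [circ, h, fourier_add]
  simp; ring

theorem circ_false_mul_true (n m : ℤ) (z : AddCircle L) :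
    circ false n z * circ true m z =
      (1 / 2) * circ false (n + m) z + (1 / 2) * circ false (n - m) z := by
  have h := fourier_sub_index n m z
  simp only [circ, h, fourier_add]
  simp; ring

variable [hL : Fact (0 < L)]

theorem integrable_circle {f : AddCircle L → ℝ} (hf : Continuous f) : Integrable f :=
  hf.integrable_of_hasCompactSupport (HasCompactSupport.of_compactSpace f)

/-- Translation by half a wavelength reverses the sign of the integrand. -/
theorem integral_circ_of_ne (b : Bool) {j : ℤ} (hj : j ≠ 0) :
    ∫ z : AddCircle L, circ b j z = 0 := by
  refine integral_eq_zero_of_add_right_eq_neg (g := ((L / 2 / j : ℝ) : AddCircle L)) fun z => ?_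
  have := fourier_add_half_inv_index hj hL.out z
  cases b <;> simp only [circ, this] <;> simp

theorem integral_circ_true (j : ℤ) : ∫ z : AddCircle L, circ true j z = if j = 0 then L else 0 := by
  split_ifs with h
  · subst h
    simp only [circ, if_true, fourier_zero, Complex.one_re, integral_const, smul_eq_mul, mul_one,
      measureReal_def, AddCircle.measure_univ]
    exact ENNReal.toReal_ofReal hL.out.le
  · exact integral_circ_of_ne true h

theorem integral_circ_false (j : ℤ) : ∫ z : AddCircle L, circ false j z = 0 := by
  by_cases h : j = 0
  · subst h; simp [circ]
  · exact integral_circ_of_ne false h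

theorem integral_circ_true_mul_true (n m : ℤ) : ∫ z : AddCircle L, circ true n z * circ true m z =
    L / 2 * ((if n = -m then 1 else 0) + if n = m then 1 else 0) := by
  simp_rw [circ_true_mul_true]
  rw [integral_add ((integrable_circle (continuous_circ _ _)).const_mul _)
    ((integrable_circle (continuous_circ _ _)).const_mul _), integral_const_mul,
    integral_const_mul, integral_circ_true, integral_circ_true]
  simp only [sub_eq_zero, add_eq_zero_iff_eq_neg]
  split_ifs <;> ring

theorem integral_circ_false_mul_false (n m : ℤ) :
    ∫ z : AddCircle L, circ false n z * circ false m z =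
      L / 2 * ((if n = m then 1 else 0) - if n = -m then 1 else 0) := by
  simp_rw [circ_false_mul_false]
  rw [integral_sub ((integrable_circle (continuous_circ _ _)).const_mul _)
    ((integrable_circle (continuous_circ _ _)).const_mul _), integral_const_mul,
    integral_const_mul, integral_circ_true, integral_circ_true]
  simp only [sub_eq_zero, add_eq_zero_iff_eq_neg]
  split_ifs <;> ring

theorem integral_circ_false_mul_true (n m : ℤ) :
    ∫ z : AddCircle L, circ false n z * circ true m z = 0 := by
  simp_rw [circ_false_mul_true]
  rw [integral_add ((integrable_circle (continuous_circ _ _)).const_mul _)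
    ((integrable_circle (continuous_circ _ _)).const_mul _), integral_const_mul,
    integral_const_mul, integral_circ_false, integral_circ_false]
  simp

/-- The reproducing property of `cos (n (z - y))` on trigonometric functions. -/
theorem circ_reproducing (n m : ℤ) (b : Bool) (z : AddCircle L) :
    circ true n z * (∫ y : AddCircle L, circ b m y * circ true n y) +
      circ false n z * (∫ y : AddCircle L, circ b m y * circ false n y) =
    L / 2 * ((if n = m then 1 else 0) + if n = -m then 1 else 0) * circ b m z := by
  cases b
  · have e : ∫ y : AddCircle L, circ false m y * circ false n y =
        L / 2 * ((if n = m then 1 else 0) - if n = -m then 1 else 0) := by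
      simp_rw [mul_comm (circ false m _)]; exact integral_circ_false_mul_false n m
    rw [integral_circ_false_mul_true, e]
    by_cases h1 : n = m
    · subst h1
      -- The indices n and −n coincide only at zero, where the sine vanishes identically.
      by_cases h2 : n = -n
      · have : n = 0 := by omega
        subst this
        simp [circ]
      · simp [h2]; ring
    · by_cases h2 : n = -m
      · subst h2
        rw [circ_false_neg]
        simp only [h1, if_true, if_false]; ring
      · simp [h1, h2]
  · have e : ∫ y : AddCircle L, circ true m y * circ true n y =
        L / 2 * ((if n = -m then 1 else 0) + if n = m then 1 else 0) := by
      simp_rw [mul_comm (circ true m _)]; exact integral_circ_true_mul_true n m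
    have e2 : ∫ y : AddCircle L, circ true m y * circ false n y = 0 := by
      simp_rw [mul_comm (circ true m _)]; exact integral_circ_false_mul_true n m
    rw [e, e2]
    by_cases h1 : n = m
    · subst h1; ring
    · by_cases h2 : n = -m
      · subst h2
        rw [circ_true_neg]
        ring
      · simp [h1, h2]

theorem integral_cos_pi_div {H : ℝ} (hH : 0 < H) (j : ℤ) :
    ∫ s in (0 : ℝ)..H, Real.cos (j * Real.pi / H * s) = if j = 0 then H else 0 := by
  split_ifs with h
  · subst h; simp
  · have hc : (j * Real.pi / H : ℝ) ≠ 0 :=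
      div_ne_zero (mul_ne_zero (by exact_mod_cast h) Real.pi_ne_zero) hH.ne'
    rw [intervalIntegral.integral_comp_mul_left (fun s => Real.cos s) hc, integral_cos]
    rw [div_mul_cancel₀ _ hH.ne', Real.sin_int_mul_pi]
    simp

theorem integral_sin_mul_sin {H : ℝ} (hH : 0 < H) (k l : ℕ) :
    ∫ s in Ioo 0 H, Real.sin (freq H k * s) * Real.sin (freq H l * s) =
      if l = k then H / 2 else 0 := by
  rw [← integral_Ioc_eq_integral_Ioo, ← intervalIntegral.integral_of_le hH.le]
  have e : ∀ s : ℝ, Real.sin (freq H k * s) * Real.sin (freq H l * s) =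
      (1 / 2) * Real.cos (((k : ℤ) - l : ℤ) * Real.pi / H * s) -
        (1 / 2) * Real.cos (((k : ℤ) + l + 2 : ℤ) * Real.pi / H * s) := by
    intro s
    have e1 : (((k : ℤ) - l : ℤ) * Real.pi / H * s : ℝ) = freq H k * s - freq H l * s := by
      unfold freq; push_cast; ring
    have e2 : (((k : ℤ) + l + 2 : ℤ) * Real.pi / H * s : ℝ) = freq H k * s + freq H l * s := by
      unfold freq; push_cast; ring
    rw [e1, e2, Real.cos_sub, Real.cos_add]; ring
  simp_rw [e]
  rw [intervalIntegral.integral_sub (Continuous.intervalIntegrable (by fun_prop) _ _)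
    (Continuous.intervalIntegrable (by fun_prop) _ _), intervalIntegral.integral_const_mul,
    intervalIntegral.integral_const_mul, integral_cos_pi_div hH, integral_cos_pi_div hH,
    if_neg (show ¬ ((k : ℤ) + l + 2 = 0) by omega)]
  by_cases h : l = k
  · subst h; simp; ring
  · rw [if_neg h, if_neg (show ¬ ((k : ℤ) - l = 0) by omega)]; simp

end Orthogonality

/-! ### Eigenvalues and summable bounds for their inverses. -/

section Eigenvalues

variable {L H : ℝ}

theorem freq_pos (hH : 0 < H) (k : ℕ) : 0 < freq H k := by
  have := Real.pi_pos
  unfold freq; positivity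

theorem eig_pos (hH : 0 < H) (m : ℤ) (k : ℕ) : 0 < eig L H m k := by
  have := freq_pos hH k
  unfold eig; positivity

theorem eig_neg (m : ℤ) (k : ℕ) : eig L H (-m) k = eig L H m k := by
  unfold eig wave; push_cast; ring

/-- Separated bounds for the inverse eigenvalues. -/
theorem exists_eig_inv_le (hL : 0 < L) (hH : 0 < H) {s : ℝ} (hs : 0 < s) (hs1 : s ≤ 1) :
    ∃ B : ℤ → ℝ, Summable B ∧ (∀ m, 0 ≤ B m) ∧
      ∀ m k, (eig L H m k)⁻¹ ≤ B m * freq H k ^ (-(1 - s)) := by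
  have hpi := Real.pi_pos
  -- Weighted arithmetic–geometric means give x^(1+s) κ^(1−s) ≤ x² + κ² with x the size of the wave
  -- number; the exponent 1+s > 1 makes the sum over m converge. The index m = 0 is handled
  -- separately, using κ ≥ π/H.
  refine ⟨fun m => (2 * Real.pi / L) ^ (-(1 + s)) * |(m : ℝ)| ^ (-(1 + s)) +
    if m = 0 then (Real.pi / H) ^ (-(1 + s)) else 0, ?_, fun m => ?_, fun m k => ?_⟩
  · exact ((Real.summable_abs_int_rpow (by linarith)).mul_left _).add
      (hasSum_ite_eq 0 _).summable
  · dsimp only; split_ifs <;> positivity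
  · have hf := freq_pos hH k
    by_cases hm : m = 0
    · subst hm
      simp only [Int.cast_zero, abs_zero, if_true]
      rw [Real.zero_rpow (by linarith), mul_zero, zero_add]
      have e : eig L H 0 k = freq H k ^ (1 + s) * freq H k ^ (1 - s) := by
        rw [← Real.rpow_add hf, show 1 + s + (1 - s) = (2 : ℕ) by push_cast; ring,
          Real.rpow_natCast]
        simp [eig, wave]
      rw [e, mul_inv, Real.rpow_neg hf.le]
      gcongr
      rw [← Real.rpow_neg hf.le]
      refine Real.rpow_le_rpow_of_nonpos (by positivity) ?_ (by linarith)
      unfold freq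
      gcongr
      nlinarith [(Nat.cast_nonneg k : (0 : ℝ) ≤ k)]
    · simp only [if_neg hm, add_zero]
      have hm' : 0 < |(m : ℝ)| := abs_pos.2 (by exact_mod_cast hm)
      set x := 2 * Real.pi / L * |(m : ℝ)| with hx
      have hx0 : 0 < x := by positivity
      have e0 : eig L H m k = x ^ 2 + freq H k ^ 2 := by
        rw [eig, wave, hx, mul_pow, sq_abs]; ring
      have e1 : x ^ (1 + s) * freq H k ^ (1 - s) ≤ eig L H m k := by
        have h := Real.geom_mean_le_arith_mean2_weighted (w₁ := (1 + s) / 2) (w₂ := (1 - s) / 2)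
          (p₁ := x ^ 2) (p₂ := freq H k ^ 2) (by linarith) (by linarith) (by positivity)
          (by positivity) (by ring)
        rw [← Real.rpow_natCast, ← Real.rpow_natCast, ← Real.rpow_mul hx0.le,
          ← Real.rpow_mul hf.le] at h
        rw [show ((2 : ℕ) : ℝ) * ((1 + s) / 2) = 1 + s by push_cast; ring,
          show ((2 : ℕ) : ℝ) * ((1 - s) / 2) = 1 - s by push_cast; ring] at h
        rw [Real.rpow_natCast, Real.rpow_natCast] at h
        have h1 : (1 + s) / 2 * x ^ 2 ≤ x ^ 2 := by nlinarith [sq_nonneg x]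
        have h2 : (1 - s) / 2 * freq H k ^ 2 ≤ freq H k ^ 2 := by nlinarith [sq_nonneg (freq H k)]
        rw [e0]; linarith
      have e2 : (2 * Real.pi / L) ^ (-(1 + s)) * |(m : ℝ)| ^ (-(1 + s)) = x ^ (-(1 + s)) := by
        rw [hx, Real.mul_rpow (by positivity) (abs_nonneg _)]
      rw [e2, Real.rpow_neg hx0.le, Real.rpow_neg hf.le, ← mul_inv]
      exact inv_anti₀ (by positivity) e1

theorem summable_eig_inv (hL : 0 < L) (hH : 0 < H) (k : ℕ) :
    Summable fun m => (eig L H m k)⁻¹ := by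
  obtain ⟨B, hB, -, h⟩ := exists_eig_inv_le hL hH one_pos le_rfl
  exact Summable.of_nonneg_of_le (fun m => (inv_pos.2 (eig_pos hH m k)).le) (fun m => h m k)
    (hB.mul_right _)

end Eigenvalues

/-! ### One-dimensional Green functions and their `L^q` decay. -/

section Green

variable {L H : ℝ}

/-- The Green function of `κ² - ∂²` on the circle, with `κ = freq H k`. -/
def green (L H : ℝ) (k : ℕ) (z : AddCircle L) : ℝ :=
  ∑' m : ℤ, (eig L H m k)⁻¹ * circ true m z

theorem abs_eig_inv_mul_circ_le (hH : 0 < H) (b : Bool) (m : ℤ) (k : ℕ) (z : AddCircle L) :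
    |(eig L H m k)⁻¹ * circ b m z| ≤ (eig L H m k)⁻¹ := by
  have := (inv_pos.2 (eig_pos (L := L) hH m k)).le
  rw [abs_mul, abs_of_nonneg this]
  exact mul_le_of_le_one_right this (abs_circ_le _ _ _)

variable [hL : Fact (0 < L)]

theorem continuous_green (hH : 0 < H) (k : ℕ) : Continuous (green L H k) :=
  continuous_tsum (fun m => continuous_const.mul (continuous_circ true m))
    (summable_eig_inv hL.out hH k) fun m z => abs_eig_inv_mul_circ_le hH true m k z

theorem abs_green_le (hH : 0 < H) (k : ℕ) (z : AddCircle L) :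
    |green L H k z| ≤ ∑' m : ℤ, (eig L H m k)⁻¹ :=
  tsum_of_norm_bounded (f := fun m => (eig L H m k)⁻¹ * circ true m z)
    (summable_eig_inv hL.out hH k).hasSum fun m => abs_eig_inv_mul_circ_le hH true m k z

theorem hasSum_integral_mul_green (hH : 0 < H) (k : ℕ) {f : AddCircle L → ℝ} (hf : Continuous f) :
    HasSum (fun m : ℤ => (eig L H m k)⁻¹ * ∫ z : AddCircle L, f z * circ true m z)
      (∫ z : AddCircle L, f z * green L H k z) := by
  have hi : ∀ m : ℤ, Integrable (fun z : AddCircle L =>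
      f z * ((eig L H m k)⁻¹ * circ true m z)) := fun m =>
    integrable_circle (hf.mul (continuous_const.mul (continuous_circ true m)))
  have h := hasSum_integral_of_summable_integral_norm hi ?_
  · have e1 : ∫ z : AddCircle L, f z * green L H k z =
        ∫ z : AddCircle L, ∑' m : ℤ, f z * ((eig L H m k)⁻¹ * circ true m z) := by
      congr 1; funext z
      rw [tsum_mul_left]; rfl
    rw [e1]
    have e2 : (fun m : ℤ => (eig L H m k)⁻¹ * ∫ z : AddCircle L, f z * circ true m z) =
        fun m : ℤ => ∫ z : AddCircle L, f z * ((eig L H m k)⁻¹ * circ true m z) := by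
      funext m
      rw [← integral_const_mul]
      congr 1; funext z; ring
    rw [e2]
    exact h
  · refine Summable.of_nonneg_of_le (fun m => integral_nonneg fun z => norm_nonneg _)
      (fun m => ?_) ((summable_eig_inv hL.out hH k).mul_left (∫ z : AddCircle L, |f z|))
    rw [← integral_mul_const]
    refine integral_mono (hi m).norm ((integrable_circle hf.abs).mul_const _) fun z => ?_
    simp only
    rw [norm_mul, Real.norm_eq_abs, Real.norm_eq_abs]
    exact mul_le_mul_of_nonneg_left (abs_eig_inv_mul_circ_le hH true m k z) (abs_nonneg _)

/-- The factor is L rather than L/2 because the indices m and −m both contribute to the cosine. -/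
theorem integral_circ_mul_green (hH : 0 < H) (m : ℤ) (k : ℕ) :
    ∫ z : AddCircle L, circ true m z * green L H k z = L * (eig L H m k)⁻¹ := by
  have h := hasSum_integral_mul_green hH k (continuous_circ (L := L) true m)
  have h1 : HasSum (fun n : ℤ => if n = m then L / 2 * (eig L H m k)⁻¹ else 0) _ :=
    hasSum_ite_eq m _
  have h2 : HasSum (fun n : ℤ => if n = -m then L / 2 * (eig L H m k)⁻¹ else 0) _ :=
    hasSum_ite_eq (-m) _
  have e : (fun n : ℤ => (eig L H n k)⁻¹ * ∫ z : AddCircle L, circ true m z * circ true n z) =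
      fun n : ℤ => (if n = m then L / 2 * (eig L H m k)⁻¹ else 0) +
        if n = -m then L / 2 * (eig L H m k)⁻¹ else 0 := by
    funext n
    simp_rw [mul_comm (circ true m _)]
    rw [integral_circ_true_mul_true]
    by_cases a1 : n = m
    · subst a1
      split_ifs <;> ring
    · by_cases a2 : n = -m
      · subst a2
        rw [eig_neg]
        simp only [a1, if_true, if_false]; ring
      · simp [a1, a2]
  rw [e] at h
  rw [h.unique (h1.add h2)]
  ring

/-- Parseval gives L times the sum of squared inverse eigenvalues, and one factor of each square is
at most κ⁻². -/
theorem integral_green_sq_le (hH : 0 < H) (k : ℕ) :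
    ∫ z : AddCircle L, green L H k z ^ 2 ≤
      L * (freq H k ^ 2)⁻¹ * ∑' m : ℤ, (eig L H m k)⁻¹ := by
  have h := hasSum_integral_mul_green hH k (continuous_green (L := L) hH k)
  simp_rw [← sq] at h
  have hs := (summable_eig_inv hL.out hH k).mul_left (L * (freq H k ^ 2)⁻¹)
  rw [← tsum_mul_left, ← h.tsum_eq]
  refine h.summable.tsum_le_tsum (fun m => ?_) hs
  simp_rw [mul_comm (green L H k _)]
  rw [integral_circ_mul_green hH]
  have h1 := eig_pos (L := L) hH m k
  have h2 : (eig L H m k)⁻¹ ≤ (freq H k ^ 2)⁻¹ := by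
    have := freq_pos hH k
    refine inv_anti₀ (by positivity) ?_
    unfold eig; nlinarith [sq_nonneg (wave L m)]
  have h3 := (inv_pos.2 h1).le
  have h4 := hL.out.le
  calc (eig L H m k)⁻¹ * (L * (eig L H m k)⁻¹) = L * (eig L H m k)⁻¹ * (eig L H m k)⁻¹ := by ring
    _ ≤ _ := by gcongr

/-- Decay of the `L^q` norms of the Green functions in the transverse wave number. -/
theorem exists_integral_green_rpow_le (hH : 0 < H) {q : ℝ} (hq : 2 ≤ q) :
    ∃ M : ℝ, 0 ≤ M ∧ ∀ k, ∫ z : AddCircle L, |green L H k z| ^ q ≤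
      M * freq H k ^ (-(q + 1 / 2)) := by
  -- With A the sum of inverse eigenvalues, the `L^q` integral is at most A^(q−2) times the square
  -- integral, hence at most L κ⁻² A^(q−1). Since A is bounded by a multiple of κ^(−(1−s)), this s
  -- gives total decay 2 + (q−1)(1−s) = q + 1/2. An exponent above q is what summability of the
  -- `L^q` norms in k requires.
  have hs0 : 0 < 1 / (2 * (q - 1)) := by
    have : 0 < q - 1 := by linarith
    positivity
  have hs1 : 1 / (2 * (q - 1)) ≤ 1 := by
    rw [div_le_one (by linarith)]; linarith
  obtain ⟨B, hB, hB0, hBe⟩ := exists_eig_inv_le hL.out hH hs0 hs1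
  set s := 1 / (2 * (q - 1)) with hs
  set T := ∑' m, B m with hT
  have hT0 : 0 ≤ T := tsum_nonneg hB0
  have hL0 := hL.out.le
  refine ⟨L * T ^ (q - 1), by positivity, fun k => ?_⟩
  have hf := freq_pos hH k
  set A := ∑' m : ℤ, (eig L H m k)⁻¹ with hA
  have hA0 : 0 ≤ A := tsum_nonneg fun m => (inv_pos.2 (eig_pos hH m k)).le
  have hAT : A ≤ T * freq H k ^ (-(1 - s)) := by
    rw [hA, hT, ← tsum_mul_right]
    exact (summable_eig_inv hL.out hH k).tsum_le_tsum (fun m => hBe m k) (hB.mul_right _)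
  have hc := continuous_green (L := L) hH k
  have h1 : ∫ z : AddCircle L, |green L H k z| ^ q ≤
      ∫ z : AddCircle L, A ^ (q - 2) * green L H k z ^ 2 := by
    refine integral_mono (integrable_circle (hc.abs.rpow_const fun _ => Or.inr (by linarith)))
      (integrable_circle (continuous_const.mul (hc.pow 2))) fun z => ?_
    have e : |green L H k z| ^ q = |green L H k z| ^ (q - 2) * |green L H k z| ^ 2 := by
      rw [← Real.rpow_natCast, ← Real.rpow_add_of_nonneg (abs_nonneg _) (by linarith) (by simp)]
      congr 1; push_cast; ring
    simp only
    rw [e, sq_abs]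
    have := abs_green_le (L := L) hH k z
    exact mul_le_mul_of_nonneg_right
      (Real.rpow_le_rpow (abs_nonneg _) this (by linarith)) (sq_nonneg _)
  rw [integral_const_mul] at h1
  have h2 := integral_green_sq_le (L := L) hH k
  have h3 : A ^ (q - 2) * (L * (freq H k ^ 2)⁻¹ * A) = L * (freq H k ^ 2)⁻¹ * A ^ (q - 1) := by
    have : A ^ (q - 1) = A ^ (q - 2) * A := by
      rw [show q - 1 = (q - 2) + 1 by ring,
        Real.rpow_add_of_nonneg hA0 (by linarith) (by norm_num), Real.rpow_one]
    rw [this]; ring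
  have h4 : A ^ (q - 1) ≤ T ^ (q - 1) * freq H k ^ (-(q - 3 / 2)) := by
    refine (Real.rpow_le_rpow hA0 hAT (by linarith)).trans (le_of_eq ?_)
    rw [Real.mul_rpow hT0 (by positivity), ← Real.rpow_mul hf.le]
    congr 2
    rw [hs]
    have : q - 1 ≠ 0 := by linarith
    field_simp
    ring
  calc ∫ z : AddCircle L, |green L H k z| ^ q
      ≤ A ^ (q - 2) * (L * (freq H k ^ 2)⁻¹ * A) :=
        h1.trans (mul_le_mul_of_nonneg_left h2 (Real.rpow_nonneg hA0 _))
    _ = L * (freq H k ^ 2)⁻¹ * A ^ (q - 1) := h3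
    _ ≤ L * (freq H k ^ 2)⁻¹ * (T ^ (q - 1) * freq H k ^ (-(q - 3 / 2))) := by gcongr
    _ = L * T ^ (q - 1) * ((freq H k ^ 2)⁻¹ * freq H k ^ (-(q - 3 / 2))) := by ring
    _ = _ := by
        congr 1
        rw [← Real.rpow_natCast, ← Real.rpow_neg hf.le, ← Real.rpow_add hf]
        congr 1; push_cast; ring

end Green

/-! ### The inverse Laplacian at a fixed transverse wave number. -/

section GreenOperator

variable {L H : ℝ} [hL : Fact (0 < L)]

/-- The (unnormalized) coefficient of `v` with respect to an eigenfunction. -/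
def coef (H : ℝ) (b : Bool) (m : ℤ) (k : ℕ) (v : AddCircle L × ℝ → ℝ) : ℝ :=
  ∫ x, v x * mode H b m k x ∂(channelMeasure L H)

theorem abs_coef_le {v : AddCircle L × ℝ → ℝ} (hv : Integrable v (channelMeasure L H))
    (b : Bool) (m : ℤ) (k : ℕ) : |coef H b m k v| ≤ ∫ x, |v x| ∂(channelMeasure L H) := by
  have := abs_integral_mul_le hv (Eventually.of_forall (abs_mode_le H b m k))
  rwa [one_mul] at this

theorem integrable_mul_mode {v : AddCircle L × ℝ → ℝ} (hv : Integrable v (channelMeasure L H))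
    (b : Bool) (m : ℤ) (k : ℕ) :
    Integrable (fun x => v x * mode H b m k x) (channelMeasure L H) :=
  integrable_mul_of_ae_bdd hv (continuous_mode H b m k).aestronglyMeasurable
    (Eventually.of_forall (abs_mode_le H b m k))

/-- The contribution of the longitudinal wave number `m` to the `k`-th part of the
inverse Laplacian. -/
def greenTerm (H : ℝ) (m : ℤ) (k : ℕ) (v : AddCircle L × ℝ → ℝ) (x : AddCircle L × ℝ) : ℝ :=
  (eig L H m k)⁻¹ * (mode H true m k x * coef H true m k v + mode H false m k x * coef H false m k v)

/-- The part of the inverse Laplacian with transverse wave number `freq H k`. -/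
def greenOp (H : ℝ) (k : ℕ) (v : AddCircle L × ℝ → ℝ) (x : AddCircle L × ℝ) : ℝ :=
  2 / (L * H) * ∑' m : ℤ, greenTerm H m k v x

theorem abs_greenTerm_le (hH : 0 < H) {v : AddCircle L × ℝ → ℝ}
    (hv : Integrable v (channelMeasure L H)) (m : ℤ) (k : ℕ) (x : AddCircle L × ℝ) :
    |greenTerm H m k v x| ≤ (eig L H m k)⁻¹ * (2 * ∫ x, |v x| ∂(channelMeasure L H)) := by
  have h0 := (inv_pos.2 (eig_pos (L := L) hH m k)).le
  rw [greenTerm, abs_mul, abs_of_nonneg h0]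
  refine mul_le_mul_of_nonneg_left ((abs_add_le _ _).trans ?_) h0
  have key : ∀ b, |mode H b m k x * coef H b m k v| ≤ ∫ x, |v x| ∂(channelMeasure L H) := by
    intro b
    rw [abs_mul]
    exact (mul_le_of_le_one_left (abs_nonneg _) (abs_mode_le H b m k x)).trans
      (abs_coef_le hv b m k)
  linarith [key true, key false]

theorem summable_greenTerm_bound (hH : 0 < H) (k : ℕ) (c : ℝ) :
    Summable fun m : ℤ => (eig L H m k)⁻¹ * c :=
  (summable_eig_inv hL.out hH k).mul_right _

theorem continuous_greenTerm (m : ℤ) (k : ℕ) (v : AddCircle L × ℝ → ℝ) :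
    Continuous (greenTerm H m k v) :=
  continuous_const.mul (((continuous_mode H true m k).mul continuous_const).add
    ((continuous_mode H false m k).mul continuous_const))

theorem continuous_greenOp (hH : 0 < H) (k : ℕ) {v : AddCircle L × ℝ → ℝ}
    (hv : Integrable v (channelMeasure L H)) : Continuous (greenOp H k v) :=
  continuous_const.mul (continuous_tsum (fun m => continuous_greenTerm m k v)
    (summable_greenTerm_bound hH k _) fun m x => abs_greenTerm_le hH hv m k x)

/-- The bilinear form of `greenOp` as a series. -/
theorem hasSum_integral_mul_greenOp (hH : 0 < H) (k : ℕ) {v ψ : AddCircle L × ℝ → ℝ}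
    (hv : Integrable v (channelMeasure L H)) (hψ : Integrable ψ (channelMeasure L H)) :
    HasSum (fun m : ℤ => 2 / (L * H) * ((eig L H m k)⁻¹ *
        (coef H true m k ψ * coef H true m k v + coef H false m k ψ * coef H false m k v)))
      (∫ x, ψ x * greenOp H k v x ∂(channelMeasure L H)) := by
  set μ := channelMeasure L H
  have hi : ∀ m : ℤ, Integrable (fun x => ψ x * greenTerm H m k v x) μ := fun m =>
    integrable_mul_of_ae_bdd hψ (continuous_greenTerm m k v).aestronglyMeasurable
      (Eventually.of_forall (abs_greenTerm_le hH hv m k))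
  have h := hasSum_integral_of_summable_integral_norm hi ?_
  · have e1 : ∫ x, ψ x * greenOp H k v x ∂μ =
        2 / (L * H) * ∫ x, ∑' m : ℤ, ψ x * greenTerm H m k v x ∂μ := by
      rw [← integral_const_mul]
      congr 1; funext x
      rw [tsum_mul_left, greenOp]; ring
    have e2 : (fun m : ℤ => (eig L H m k)⁻¹ *
        (coef H true m k ψ * coef H true m k v + coef H false m k ψ * coef H false m k v)) =
        fun m : ℤ => ∫ x, ψ x * greenTerm H m k v x ∂μ := by
      funext m
      have e3 : ∀ x, ψ x * greenTerm H m k v x = (eig L H m k)⁻¹ *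
          ((ψ x * mode H true m k x) * coef H true m k v +
            (ψ x * mode H false m k x) * coef H false m k v) := by
        intro x; unfold greenTerm; ring
      simp_rw [e3]
      rw [integral_const_mul, integral_add ((integrable_mul_mode hψ true m k).mul_const _)
        ((integrable_mul_mode hψ false m k).mul_const _), integral_mul_const, integral_mul_const]
      rfl
    rw [e1]
    refine HasSum.mul_left _ ?_
    rw [e2]
    exact h
  · refine Summable.of_nonneg_of_le (fun m => integral_nonneg fun z => norm_nonneg _)
      (fun m => ?_) ((summable_greenTerm_bound (L := L) hH k
        (2 * ∫ x, |v x| ∂μ)).mul_left (∫ x, |ψ x| ∂μ))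
    rw [← integral_mul_const]
    refine integral_mono (hi m).norm (hψ.abs.mul_const _) fun x => ?_
    simp only
    rw [norm_mul, Real.norm_eq_abs, Real.norm_eq_abs]
    exact mul_le_mul_of_nonneg_left (abs_greenTerm_le hH hv m k x) (abs_nonneg _)

theorem integral_mul_greenOp_comm (hH : 0 < H) (k : ℕ) {v ψ : AddCircle L × ℝ → ℝ}
    (hv : Integrable v (channelMeasure L H)) (hψ : Integrable ψ (channelMeasure L H)) :
    ∫ x, ψ x * greenOp H k v x ∂(channelMeasure L H) =
      ∫ x, v x * greenOp H k ψ x ∂(channelMeasure L H) := by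
  have h1 := hasSum_integral_mul_greenOp hH k hv hψ
  have h2 := hasSum_integral_mul_greenOp hH k hψ hv
  rw [← h1.tsum_eq, ← h2.tsum_eq]
  congr 1; funext m; ring

theorem coef_mode (hH : 0 < H) (b c : Bool) (m n : ℤ) (k l : ℕ) :
    coef H c n l (mode H b m k : AddCircle L × ℝ → ℝ) =
      (∫ z : AddCircle L, circ b m z * circ c n z) * if l = k then H / 2 else 0 := by
  rw [← integral_sin_mul_sin hH, coef, channelMeasure, ← integral_prod_mul]
  congr 1; funext x
  simp only [mode]; ring

theorem greenOp_mode_of_ne (hH : 0 < H) (b : Bool) (m : ℤ) {k l : ℕ} (h : l ≠ k)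
    (x : AddCircle L × ℝ) : greenOp H l (mode H b m k) x = 0 := by
  have : ∀ n : ℤ, greenTerm H n l (mode H b m k) x = 0 := by
    intro n
    simp [greenTerm, coef_mode hH, h]
  simp [greenOp, this]

/-- The normalization 2/(LH) is uniform in m because the sum runs over all integers. For m ≠ 0 the
indices m and −m each supply half of the result; for m = 0 both halves fall on the same index. -/
theorem greenOp_mode (hH : 0 < H) (b : Bool) (m : ℤ) (k : ℕ) (x : AddCircle L × ℝ) :
    greenOp H k (mode H b m k) x = (eig L H m k)⁻¹ * mode H b m k x := by
  set c := L * H / 4 * ((eig L H m k)⁻¹ * mode H b m k x) with hc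
  have h1 : HasSum (fun n : ℤ => if n = m then c else 0) c := hasSum_ite_eq m _
  have h2 : HasSum (fun n : ℤ => if n = -m then c else 0) c := hasSum_ite_eq (-m) _
  have e : (fun n : ℤ => greenTerm H n k (mode H b m k) x) =
      fun n : ℤ => (if n = m then c else 0) + if n = -m then c else 0 := by
    funext n
    have e1 : greenTerm H n k (mode H b m k) x = (eig L H n k)⁻¹ *
        (circ true n x.1 * (∫ y : AddCircle L, circ b m y * circ true n y) +
          circ false n x.1 * (∫ y : AddCircle L, circ b m y * circ false n y)) *
        (Real.sin (freq H k * x.2) * (H / 2)) := by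
      simp only [greenTerm, coef_mode hH, if_true, mode]; ring
    rw [e1, circ_reproducing, hc, mode]
    by_cases a1 : n = m
    · subst a1
      split_ifs <;> ring
    · by_cases a2 : n = -m
      · subst a2
        rw [eig_neg]
        simp only [a1, if_true, if_false]; ring
      · simp [a1, a2]
  have hL0 := hL.out
  rw [greenOp, e, (h1.add h2).tsum_eq, hc]
  field_simp
  ring

/-- The kernel form, from the addition formula for the cosine; it makes Hölder's inequality with the
decay of the Green functions available. -/
theorem greenOp_eq_integral (hH : 0 < H) (k : ℕ) {v : AddCircle L × ℝ → ℝ}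
    (hv : Integrable v (channelMeasure L H)) (x : AddCircle L × ℝ) :
    greenOp H k v x = 2 / (L * H) * ∫ y, v y * (Real.sin (freq H k * x.2) *
      Real.sin (freq H k * y.2) * green L H k (x.1 - y.1)) ∂(channelMeasure L H) := by
  set μ := channelMeasure L H
  set F : ℤ → AddCircle L × ℝ → ℝ := fun m y => v y * (Real.sin (freq H k * x.2) *
    Real.sin (freq H k * y.2) * ((eig L H m k)⁻¹ * circ true m (x.1 - y.1))) with hF
  have hbd : ∀ (m : ℤ) (y : AddCircle L × ℝ), |Real.sin (freq H k * x.2) * Real.sin (freq H k * y.2) *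
      ((eig L H m k)⁻¹ * circ true m (x.1 - y.1))| ≤ (eig L H m k)⁻¹ := by
    intro m y
    rw [abs_mul, abs_mul]
    have h1 := abs_eig_inv_mul_circ_le (L := L) hH true m k (x.1 - y.1)
    have h2 : |Real.sin (freq H k * x.2)| * |Real.sin (freq H k * y.2)| ≤ 1 :=
      mul_le_one₀ (Real.abs_sin_le_one _) (abs_nonneg _) (Real.abs_sin_le_one _)
    exact (mul_le_of_le_one_left (abs_nonneg _) h2).trans h1
  have hFi : ∀ m, Integrable (F m) μ := by
    intro m
    refine integrable_mul_of_ae_bdd hv ?_ (Eventually.of_forall (hbd m))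
    have := continuous_circ (L := L) true m
    exact Continuous.aestronglyMeasurable (by fun_prop)
  have h := hasSum_integral_of_summable_integral_norm hFi ?_
  · have e1 : ∀ m, ∫ y, F m y ∂μ = greenTerm H m k v x := by
      intro m
      have e2 : ∀ y, F m y = (eig L H m k)⁻¹ * (mode H true m k x * (v y * mode H true m k y) +
          mode H false m k x * (v y * mode H false m k y)) := by
        intro y
        simp only [hF, mode, circ_true_sub]; ring
      simp_rw [e2]
      rw [integral_const_mul, integral_add ((integrable_mul_mode hv true m k).const_mul _)
        ((integrable_mul_mode hv false m k).const_mul _), integral_const_mul, integral_const_mul]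
      rfl
    rw [greenOp]
    congr 1
    simp_rw [← e1]
    rw [h.tsum_eq]
    congr 1; funext y
    rw [tsum_mul_left, tsum_mul_left]; rfl
  · refine Summable.of_nonneg_of_le (fun m => integral_nonneg fun z => norm_nonneg _)
      (fun m => ?_) ((summable_eig_inv (L := L) hL.out hH k).mul_left (∫ x, |v x| ∂μ))
    rw [← integral_mul_const]
    refine integral_mono (hFi m).norm (hv.abs.mul_const _) fun y => ?_
    simp only [hF]
    rw [norm_mul, Real.norm_eq_abs, Real.norm_eq_abs]
    exact mul_le_mul_of_nonneg_left (hbd m y) (abs_nonneg _)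

theorem summable_freq_rpow (hH : 0 < H) {σ : ℝ} (hσ : 1 < σ) :
    Summable fun k : ℕ => freq H k ^ (-σ) := by
  have h := ((summable_nat_add_iff 1).2 (Real.summable_nat_rpow.2
    (show -σ < -1 by linarith))).mul_right ((Real.pi / H) ^ (-σ))
  have hpi := Real.pi_pos
  refine h.congr fun k => ?_
  rw [← Real.mul_rpow (by positivity) (by positivity), freq]
  push_cast
  rw [mul_div_assoc]

theorem integral_green_sub_rpow (hH : 0 < H) (k : ℕ) (q : ℝ) (z : AddCircle L) :
    ∫ y, |green L H k (z - y.1)| ^ q ∂(channelMeasure L H) =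
      H * ∫ y : AddCircle L, |green L H k y| ^ q := by
  rw [channelMeasure, integral_fun_fst (fun y : AddCircle L => |green L H k (z - y)| ^ q),
    integral_sub_left_eq_self (fun y : AddCircle L => |green L H k y| ^ q)]
  simp [measureReal_def, hH.le]

/-- The parts of the inverse Laplacian are bounded from `L^p` to `L^∞`, with summable norms. -/
theorem exists_abs_greenOp_le (hH : 0 < H) {p : ℝ≥0∞} (hp : 1 < p) (hp' : p < ⊤) :
    ∃ C : ℕ → ℝ, Summable C ∧ (∀ k, 0 ≤ C k) ∧
      ∀ (k : ℕ) (v : AddCircle L × ℝ → ℝ), MemLp v p (channelMeasure L H) →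
        ∀ x, |greenOp H k v x| ≤ C k * (eLpNorm v p (channelMeasure L H)).toReal := by
  set μ := channelMeasure L H
  have hP : 1 < p.toReal := by
    rw [← ENNReal.toReal_one]; exact (ENNReal.toReal_lt_toReal (by simp) hp'.ne).2 hp
  -- Lowering p to r ≤ 2 makes the conjugate exponent q at least 2, as the Green function estimate
  -- demands; finiteness of the measure allows it.
  set r := min p.toReal 2 with hr
  have hr1 : 1 < r := lt_min hP (by norm_num)
  have hr2 : r ≤ 2 := min_le_right _ _
  have hconj := Real.HolderConjugate.conjExponent hr1
  set q := r.conjExponent with hq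
  have hq2 : 2 ≤ q := by
    rw [hq, Real.conjExponent, le_div_iff₀ (by linarith)]; linarith
  have hrp : ENNReal.ofReal r ≤ p := by
    rw [← ENNReal.ofReal_toReal hp'.ne]; exact ENNReal.ofReal_le_ofReal (min_le_left _ _)
  have hr0 : ENNReal.ofReal r ≠ 0 := by simp; linarith
  obtain ⟨M, hM0, hM⟩ := exists_integral_green_rpow_le (L := L) hH hq2
  -- The q-th root of the decay κ^(−(q+1/2)); σ > 1 makes the operator bounds summable.
  set σ := (q + 1 / 2) / q with hσ
  have hq0 : 0 < q := by linarith
  have hσ1 : 1 < σ := by rw [hσ, lt_div_iff₀ hq0]; linarith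
  set D := (μ univ ^ (1 / (ENNReal.ofReal r).toReal - 1 / p.toReal)).toReal with hD
  have hL0 := hL.out
  refine ⟨fun k => 2 / (L * H) * ((H * M) ^ (1 / q) * freq H k ^ (-σ) * D),
    ((((summable_freq_rpow hH hσ1).mul_left _).mul_right D).mul_left _),
    fun k => ?_, fun k v hv x => ?_⟩
  · have := freq_pos hH k
    have : 0 ≤ D := ENNReal.toReal_nonneg
    positivity
  have hvi : Integrable v μ := hv.integrable hp.le
  have hvr : MemLp v (ENNReal.ofReal r) μ := hv.mono_exponent hrp
  have hnorm : (∫ y, |v y| ^ r ∂μ) ^ (1 / r) ≤ D * (eLpNorm v p μ).toReal := by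
    have h1 := hvr.eLpNorm_eq_integral_rpow_norm hr0 ENNReal.ofReal_ne_top
    rw [ENNReal.toReal_ofReal (by linarith : (0 : ℝ) ≤ r)] at h1
    have h2 : (∫ y, |v y| ^ r ∂μ) ^ (1 / r) = (eLpNorm v (ENNReal.ofReal r) μ).toReal := by
      rw [h1, ENNReal.toReal_ofReal (by positivity), one_div]; rfl
    have h3 := eLpNorm_le_eLpNorm_mul_rpow_measure_univ hrp hv.1
    rw [h2, hD, mul_comm, ← ENNReal.toReal_mul]
    refine ENNReal.toReal_mono (ENNReal.mul_ne_top hv.2.ne (ENNReal.rpow_ne_top_of_nonneg ?_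
      (measure_ne_top _ _))) h3
    rw [ENNReal.toReal_ofReal (by linarith : (0 : ℝ) ≤ r), sub_nonneg]
    exact one_div_le_one_div_of_le (by linarith) (min_le_left _ _)
  have hgc : Continuous fun y : AddCircle L × ℝ => |green L H k (x.1 - y.1)| := by
    have := continuous_green (L := L) hH k
    fun_prop
  have hgm : MemLp (fun y : AddCircle L × ℝ => |green L H k (x.1 - y.1)|) (ENNReal.ofReal q) μ :=
    MemLp.of_bound hgc.aestronglyMeasurable _ (Eventually.of_forall fun y => by
      rw [Real.norm_eq_abs, abs_abs]; exact abs_green_le hH k _)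
  have hholder := integral_mul_le_Lp_mul_Lq_of_nonneg hconj (μ := μ)
    (f := fun y => |v y|) (g := fun y => |green L H k (x.1 - y.1)|)
    (Eventually.of_forall fun y => abs_nonneg _) (Eventually.of_forall fun y => abs_nonneg _)
    hvr.abs hgm
  have hgq : (∫ y, |green L H k (x.1 - y.1)| ^ q ∂μ) ^ (1 / q) ≤
      (H * M) ^ (1 / q) * freq H k ^ (-σ) := by
    have hf := freq_pos hH k
    rw [integral_green_sub_rpow hH]
    have h1 : H * ∫ y : AddCircle L, |green L H k y| ^ q ≤
        H * M * freq H k ^ (-(q + 1 / 2)) := by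
      rw [mul_assoc]; exact mul_le_mul_of_nonneg_left (hM k) hH.le
    refine (Real.rpow_le_rpow (mul_nonneg hH.le (integral_nonneg fun y => by positivity)) h1
      (by positivity)).trans (le_of_eq ?_)
    rw [Real.mul_rpow (by positivity) (by positivity), ← Real.rpow_mul hf.le]
    congr 2
    rw [hσ]; ring
  rw [greenOp_eq_integral hH k hvi, abs_mul, abs_of_pos (a := 2 / (L * H)) (by positivity),
    mul_assoc]
  refine mul_le_mul_of_nonneg_left ?_ (by positivity)
  calc |∫ y, v y * (Real.sin (freq H k * x.2) * Real.sin (freq H k * y.2) *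
        green L H k (x.1 - y.1)) ∂μ|
      ≤ ∫ y, |v y| * |green L H k (x.1 - y.1)| ∂μ := by
        rw [← Real.norm_eq_abs]
        refine norm_integral_le_of_norm_le (integrable_mul_of_ae_bdd hvi.abs
          hgc.aestronglyMeasurable (Eventually.of_forall fun y => by
            rw [abs_abs]; exact abs_green_le hH k _)) (Eventually.of_forall fun y => ?_)
        rw [Real.norm_eq_abs, abs_mul, abs_mul, abs_mul]
        refine mul_le_mul_of_nonneg_left (mul_le_of_le_one_left (abs_nonneg _) ?_) (abs_nonneg _)
        exact mul_le_one₀ (Real.abs_sin_le_one _) (abs_nonneg _) (Real.abs_sin_le_one _)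
    _ ≤ (∫ y, |v y| ^ r ∂μ) ^ (1 / r) * (∫ y, |green L H k (x.1 - y.1)| ^ q ∂μ) ^ (1 / q) := hholder
    _ ≤ (D * (eLpNorm v p μ).toReal) * ((H * M) ^ (1 / q) * freq H k ^ (-σ)) := by
        refine mul_le_mul hnorm hgq (by positivity) ?_
        exact mul_nonneg ENNReal.toReal_nonneg ENNReal.toReal_nonneg
    _ = _ := by ring

end GreenOperator

/-! ### Existence and uniqueness for the weak Dirichlet problem. -/

section DirichletProblem

variable {L H : ℝ} [hL : Fact (0 < L)] {p : ℝ≥0∞}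

/-- The solution of the Dirichlet problem as a series over transverse wave numbers. -/
def dirichletSol (H : ℝ) (v : AddCircle L × ℝ → ℝ) (x : AddCircle L × ℝ) : ℝ :=
  ∑' k : ℕ, greenOp H k v x

theorem memLp_of_continuous {g : AddCircle L × ℝ → ℝ} (hg : Continuous g) :
    MemLp g p (channelMeasure L H) := by
  obtain ⟨C, hC⟩ := exists_bound_of_continuous (H := H) hg
  exact MemLp.of_bound hg.aestronglyMeasurable C hC

theorem continuous_dirichletSol (hH : 0 < H) (hp : 1 < p) (hp' : p < ⊤)
    {v : AddCircle L × ℝ → ℝ} (hv : MemLp v p (channelMeasure L H)) :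
    Continuous (dirichletSol H v) := by
  obtain ⟨C, hC, -, hb⟩ := exists_abs_greenOp_le (L := L) hH hp hp'
  exact continuous_tsum (fun k => continuous_greenOp hH k (hv.integrable hp.le))
    (hC.mul_right _) fun k x => hb k v hv x

theorem hasSum_integral_mul_dirichletSol (hH : 0 < H) (hp : 1 < p) (hp' : p < ⊤)
    {v ψ : AddCircle L × ℝ → ℝ} (hv : MemLp v p (channelMeasure L H))
    (hψ : Integrable ψ (channelMeasure L H)) :
    HasSum (fun k : ℕ => ∫ x, ψ x * greenOp H k v x ∂(channelMeasure L H))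
      (∫ x, ψ x * dirichletSol H v x ∂(channelMeasure L H)) := by
  obtain ⟨C, hC, -, hb⟩ := exists_abs_greenOp_le (L := L) hH hp hp'
  have hi : ∀ k : ℕ, Integrable (fun x => ψ x * greenOp H k v x) (channelMeasure L H) := fun k =>
    integrable_mul_of_ae_bdd hψ (continuous_greenOp hH k (hv.integrable hp.le)).aestronglyMeasurable
      (Eventually.of_forall (hb k v hv))
  have h := hasSum_integral_of_summable_integral_norm hi ?_
  · have e : ∫ x, ψ x * dirichletSol H v x ∂(channelMeasure L H) =
        ∫ x, ∑' k : ℕ, ψ x * greenOp H k v x ∂(channelMeasure L H) := by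
      congr 1; funext x
      rw [tsum_mul_left]; rfl
    rw [e]
    exact h
  · refine Summable.of_nonneg_of_le (fun k => integral_nonneg fun z => norm_nonneg _)
      (fun k => ?_) ((hC.mul_right (eLpNorm v p (channelMeasure L H)).toReal).mul_left
        (∫ x, |ψ x| ∂(channelMeasure L H)))
    rw [← integral_mul_const]
    refine integral_mono (hi k).norm (hψ.abs.mul_const _) fun x => ?_
    simp only
    rw [norm_mul, Real.norm_eq_abs, Real.norm_eq_abs]
    exact mul_le_mul_of_nonneg_left (hb k v hv x) (abs_nonneg _)

theorem integral_mul_dirichletSol_comm (hH : 0 < H) (hp : 1 < p) (hp' : p < ⊤)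
    {v ψ : AddCircle L × ℝ → ℝ} (hv : MemLp v p (channelMeasure L H))
    (hψ : MemLp ψ p (channelMeasure L H)) :
    ∫ x, ψ x * dirichletSol H v x ∂(channelMeasure L H) =
      ∫ x, v x * dirichletSol H ψ x ∂(channelMeasure L H) := by
  have h1 := hasSum_integral_mul_dirichletSol hH hp hp' hv (hψ.integrable hp.le)
  have h2 := hasSum_integral_mul_dirichletSol hH hp hp' hψ (hv.integrable hp.le)
  rw [← h1.tsum_eq, ← h2.tsum_eq]
  congr 1; funext k
  exact integral_mul_greenOp_comm hH k (hv.integrable hp.le) (hψ.integrable hp.le)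

theorem dirichletSol_mode (hH : 0 < H) (b : Bool) (m : ℤ) (k : ℕ) (x : AddCircle L × ℝ) :
    dirichletSol H (mode H b m k) x = (eig L H m k)⁻¹ * mode H b m k x := by
  rw [dirichletSol, tsum_eq_single k fun l hl => greenOp_mode_of_ne hH b m hl x]
  exact greenOp_mode hH b m k x

/-- Symmetry of the solution operator moves it onto the mode, which is an eigenfunction. -/
theorem coef_dirichletSol (hH : 0 < H) (hp : 1 < p) (hp' : p < ⊤) {v : AddCircle L × ℝ → ℝ}
    (hv : MemLp v p (channelMeasure L H)) (b : Bool) (m : ℤ) (k : ℕ) :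
    coef H b m k (dirichletSol H v) = (eig L H m k)⁻¹ * coef H b m k v := by
  have h := integral_mul_dirichletSol_comm hH hp hp' hv
    (memLp_of_continuous (L := L) (continuous_mode H b m k))
  simp_rw [dirichletSol_mode hH] at h
  unfold coef
  rw [← integral_const_mul]
  simp_rw [mul_comm (dirichletSol H v _), h]
  congr 1; funext x; ring

/-- Integrable functions with the same coefficients agree almost everywhere. -/
theorem ae_eq_of_coef_eq (hH : 0 < H) {u v : AddCircle L × ℝ → ℝ}
    (hu : Integrable u (channelMeasure L H)) (hv : Integrable v (channelMeasure L H))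
    (h : ∀ b m k, coef H b m k u = coef H b m k v) : u =ᵐ[channelMeasure L H] v := by
  have := ae_eq_zero_of_modes hH (hu.sub hv) fun b m k => by
    have e := h b m k
    simp only [Pi.sub_apply, sub_mul]
    rw [integral_sub (integrable_mul_mode hu b m k) (integrable_mul_mode hv b m k)]
    exact sub_eq_zero.2 e
  filter_upwards [this] with x hx
  exact sub_eq_zero.1 hx

/-- Both sides have the same coefficients, by Green's identity with each mode, so completeness
identifies them. Exponent 2 is a convenient choice for continuous data. -/
theorem dirichletSol_laplacian (hH : 0 < H) {φ : AddCircle L × ℝ → ℝ}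
    (hφ : IsDirichletTest H φ) :
    dirichletSol H (fun x => -laplacian φ x) =ᵐ[channelMeasure L H] φ := by
  have hc : Continuous fun x => -laplacian φ x := hφ.continuous_laplacian.neg
  have hm : MemLp (fun x => -laplacian φ x) 2 (channelMeasure L H) := memLp_of_continuous hc
  refine ae_eq_of_coef_eq hH (integrable_of_continuous
    (continuous_dirichletSol hH (by norm_num) (by simp) hm))
    (integrable_of_continuous hφ.continuous) fun b m k => ?_
  rw [coef_dirichletSol hH (by norm_num) (by simp) hm]
  have h := integral_mode_mul_laplacian hH hφ b m k
  unfold coef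
  simp_rw [mul_comm _ (mode H b m k _)]
  rw [h, inv_mul_cancel_left₀ (eig_pos hH m k).ne']

/-- The weak equation is the symmetry of the solution operator combined with
`dirichletSol_laplacian`, so no regularity of the solution beyond continuity is used. -/
theorem isDirichletSolution_dirichletSol (hH : 0 < H) (hp : 1 < p) (hp' : p < ⊤)
    {v : AddCircle L × ℝ → ℝ} (hv : MemLp v p (channelMeasure L H)) :
    IsDirichletSolution H v (dirichletSol H v) where
  integrable := integrable_of_continuous (continuous_dirichletSol hH hp hp' hv)
  weak_eq φ hφ := by
    have h := integral_mul_dirichletSol_comm hH hp hp' hv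
      (memLp_of_continuous (L := L) (H := H) hφ.continuous_laplacian.neg)
    calc ∫ x, dirichletSol H v x * -laplacian φ x ∂(channelMeasure L H)
        = ∫ x, -laplacian φ x * dirichletSol H v x ∂(channelMeasure L H) := by
          simp_rw [mul_comm]
      _ = ∫ x, v x * dirichletSol H (fun x => -laplacian φ x) x ∂(channelMeasure L H) := h
      _ = _ := by
          refine integral_congr_ae ?_
          filter_upwards [dirichletSol_laplacian hH hφ] with x hx
          rw [hx]

/-- Modes are admissible test functions, so the weak equation fixes all coefficients; completeness
in `L¹` then gives uniqueness among integrable solutions. -/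
theorem IsDirichletSolution.ae_eq (hH : 0 < H) (hp : 1 < p) (hp' : p < ⊤)
    {v u : AddCircle L × ℝ → ℝ} (hv : MemLp v p (channelMeasure L H))
    (hu : IsDirichletSolution H v u) : u =ᵐ[channelMeasure L H] dirichletSol H v := by
  refine ae_eq_of_coef_eq hH hu.integrable
    (integrable_of_continuous (continuous_dirichletSol hH hp hp' hv)) fun b m k => ?_
  rw [coef_dirichletSol hH hp hp' hv]
  have h := hu.weak_eq _ (isDirichletTest_mode hH b m k)
  simp_rw [laplacian_mode, neg_neg, mul_left_comm (u _)] at h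
  rw [integral_const_mul] at h
  have h0 := (eig_pos (L := L) hH m k).ne'
  unfold coef
  rw [← h, inv_mul_cancel_left₀ h0]

theorem inverseLaplacian_ae_eq (hH : 0 < H) (hp : 1 < p) (hp' : p < ⊤)
    {v : AddCircle L × ℝ → ℝ} (hv : MemLp v p (channelMeasure L H)) :
    inverseLaplacian H v =ᵐ[channelMeasure L H] dirichletSol H v := by
  have hex : ∃ u, IsDirichletSolution H v u :=
    ⟨_, isDirichletSolution_dirichletSol hH hp hp' hv⟩
  rw [inverseLaplacian, dif_pos hex]
  exact hex.choose_spec.ae_eq hH hp hp' hv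

end DirichletProblem

/-! ### Spectral form, definiteness and weak continuity of the energy. -/

section Energy

variable {L H : ℝ} [hL : Fact (0 < L)] {p : ℝ≥0∞}

/-- The contribution of one eigenspace to the energy. -/
def energyTerm (H : ℝ) (m : ℤ) (k : ℕ) (v : AddCircle L × ℝ → ℝ) : ℝ :=
  2 / (L * H) * ((eig L H m k)⁻¹ * (coef H true m k v ^ 2 + coef H false m k v ^ 2))

/-- The contribution of one transverse wave number to the energy. -/
def energyPart (H : ℝ) (k : ℕ) (v : AddCircle L × ℝ → ℝ) : ℝ := ∑' m : ℤ, energyTerm H m k v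

theorem energyTerm_nonneg (hH : 0 < H) (m : ℤ) (k : ℕ) (v : AddCircle L × ℝ → ℝ) :
    0 ≤ energyTerm H m k v := by
  have h1 := eig_pos (L := L) hH m k
  have h2 := hL.out
  unfold energyTerm; positivity

theorem hasSum_energyTerm (hH : 0 < H) (k : ℕ) {v : AddCircle L × ℝ → ℝ}
    (hv : Integrable v (channelMeasure L H)) :
    HasSum (fun m : ℤ => energyTerm H m k v)
      (∫ x, v x * greenOp H k v x ∂(channelMeasure L H)) := by
  have h := hasSum_integral_mul_greenOp hH k hv hv
  simp_rw [← sq] at h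
  exact h

theorem hasSum_energyPart (hH : 0 < H) (hp : 1 < p) (hp' : p < ⊤) {v : AddCircle L × ℝ → ℝ}
    (hv : MemLp v p (channelMeasure L H)) :
    HasSum (fun k : ℕ => energyPart H k v)
      (∫ x, v x * dirichletSol H v x ∂(channelMeasure L H)) := by
  have h := hasSum_integral_mul_dirichletSol hH hp hp' hv (hv.integrable hp.le)
  have e : (fun k : ℕ => energyPart H k v) =
      fun k => ∫ x, v x * greenOp H k v x ∂(channelMeasure L H) :=
    funext fun k => (hasSum_energyTerm hH k (hv.integrable hp.le)).tsum_eq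
  rw [e]
  exact h

theorem hasSum_energy (hH : 0 < H) (hp : 1 < p) (hp' : p < ⊤) (v : LpChannel L H p) :
    HasSum (fun k : ℕ => energyPart H k v) (2 * energy v) := by
  have e : 2 * energy v = ∫ x, v x * dirichletSol H v x ∂(channelMeasure L H) := by
    rw [energy, ← mul_assoc, mul_one_div_cancel two_ne_zero, one_mul]
    refine integral_congr_ae ?_
    filter_upwards [inverseLaplacian_ae_eq hH hp hp' (Lp.memLp v)] with x hx
    rw [hx]
  rw [e]
  exact hasSum_energyPart hH hp hp' (Lp.memLp v)

theorem coef_congr_ae {u v : AddCircle L × ℝ → ℝ} (h : u =ᵐ[channelMeasure L H] v) (b : Bool)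
    (m : ℤ) (k : ℕ) : coef H b m k u = coef H b m k v := by
  refine integral_congr_ae ?_
  filter_upwards [h] with x hx
  rw [hx]

theorem coef_add [Fact (1 ≤ p)] (u v : LpChannel L H p) (b : Bool) (m : ℤ) (k : ℕ) :
    coef H b m k (u + v : LpChannel L H p) = coef H b m k u + coef H b m k v := by
  have hi : ∀ f : LpChannel L H p, Integrable f (channelMeasure L H) := fun f =>
    (Lp.memLp f).integrable Fact.out
  rw [coef_congr_ae (Lp.coeFn_add u v)]
  unfold coef
  simp only [Pi.add_apply, add_mul]
  exact integral_add (integrable_mul_mode (hi u) b m k) (integrable_mul_mode (hi v) b m k)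

theorem coef_sub [Fact (1 ≤ p)] (u v : LpChannel L H p) (b : Bool) (m : ℤ) (k : ℕ) :
    coef H b m k (u - v : LpChannel L H p) = coef H b m k u - coef H b m k v := by
  have := coef_add (u - v) v b m k
  rw [sub_add_cancel] at this
  linarith

/-- Each spectral term is a sum of squares of linear functionals. The identity is the form of strict
convexity used later: if neither v + h nor v − h exceeds v in energy, then E(h) ≤ 0. -/
theorem energy_parallelogram (hH : 0 < H) [Fact (1 ≤ p)] (hp : 1 < p) (hp' : p < ⊤)
    (v h : LpChannel L H p) : energy (v + h) + energy (v - h) = 2 * energy v + 2 * energy h := by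
  have hi : ∀ f : LpChannel L H p, Integrable f (channelMeasure L H) := fun f =>
    (Lp.memLp f).integrable Fact.out
  have hsum : ∀ (f : LpChannel L H p) k, HasSum (fun m : ℤ => energyTerm H m k f)
      (energyPart H k f) := fun f k => (hasSum_energyTerm hH k (hi f)).summable.hasSum
  have e : ∀ k, energyPart H k (v + h : LpChannel L H p) + energyPart H k (v - h : LpChannel L H p)
      = 2 * energyPart H k v + 2 * energyPart H k h := by
    intro k
    refine ((hsum (v + h) k).add (hsum (v - h) k)).unique ?_
    have h1 := ((hsum v k).mul_left 2).add ((hsum h k).mul_left 2)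
    have e2 : (fun m : ℤ => energyTerm H m k (v + h : LpChannel L H p) +
        energyTerm H m k (v - h : LpChannel L H p)) =
        fun m : ℤ => 2 * energyTerm H m k v + 2 * energyTerm H m k h := by
      funext m
      simp only [energyTerm, coef_add, coef_sub]; ring
    rw [e2]
    exact h1
  have h1 := (hasSum_energy hH hp hp' (v + h)).add (hasSum_energy hH hp hp' (v - h))
  have h2 := ((hasSum_energy hH hp hp' v).mul_left 2).add ((hasSum_energy hH hp hp' h).mul_left 2)
  simp_rw [e] at h1
  have := h1.unique h2
  linarith

/-- The energy is positive definite. -/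
theorem eq_zero_of_energy_nonpos (hH : 0 < H) [Fact (1 ≤ p)] (hp : 1 < p) (hp' : p < ⊤)
    {h : LpChannel L H p} (he : energy h ≤ 0) : h = 0 := by
  have hi : Integrable h (channelMeasure L H) := (Lp.memLp h).integrable Fact.out
  have hs := hasSum_energy hH hp hp' h
  have hpart0 : ∀ k, 0 ≤ energyPart H k h := fun k =>
    tsum_nonneg fun m => energyTerm_nonneg hH m k h
  have hpart : ∀ k, energyPart H k h = 0 := fun k => by
    have := le_hasSum hs k fun j _ => hpart0 j
    linarith [hpart0 k]
  have hterm : ∀ m k, energyTerm H m k h = 0 := fun m k => by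
    have := le_hasSum (hasSum_energyTerm hH k hi).summable.hasSum m
      fun j _ => energyTerm_nonneg hH j k h
    have h2 : ∑' m : ℤ, energyTerm H m k h = 0 := hpart k
    linarith [energyTerm_nonneg hH m k h]
  have hcoef : ∀ b m k, coef H b m k h = 0 := fun b m k => by
    have h1 := hterm m k
    have h2 := eig_pos (L := L) hH m k
    have h3 := hL.out
    have h4 : coef H true m k h ^ 2 + coef H false m k h ^ 2 = 0 := by
      rw [energyTerm] at h1
      have h5 : (2 / (L * H)) ≠ 0 := by positivity
      exact (mul_eq_zero.1 ((mul_eq_zero.1 h1).resolve_left h5)).resolve_left (inv_pos.2 h2).ne'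
    cases b
    · nlinarith [sq_nonneg (coef H true m k h), sq_nonneg (coef H false m k h)]
    · nlinarith [sq_nonneg (coef H true m k h), sq_nonneg (coef H false m k h)]
  exact (Lp.eq_zero_iff_ae_eq_zero).2 (ae_eq_zero_of_modes hH hi hcoef)

/-- The energy is weakly continuous on bounded sets. -/
theorem tendsto_energy_of_weakTendsto (hH : 0 < H) [Fact (1 ≤ p)] (hp : 1 < p) (hp' : p < ⊤)
    {ι : Type*} {l : Filter ι} {v : ι → LpChannel L H p} {V : LpChannel L H p} {R : ℝ}
    (hR : ∀ᶠ i in l, ‖v i‖ ≤ R) (hv : WeakTendsto (channelMeasure L H) (fun i => v i) l V) :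
    Tendsto (fun i => energy (v i)) l (𝓝 (energy V)) := by
  have hi : ∀ f : LpChannel L H p, Integrable f (channelMeasure L H) := fun f =>
    (Lp.memLp f).integrable Fact.out
  obtain ⟨D, hD0, hD⟩ := exists_integral_abs_le (μ := channelMeasure L H) (p := p)
  obtain ⟨C, hC, hC0, hb⟩ := exists_abs_greenOp_le (L := L) hH hp hp'
  have hL0 := hL.out
  have hDR : ∀ᶠ i in l, ∫ x, |v i x| ∂(channelMeasure L H) ≤ D * R := hR.mono fun i hi =>
    (hD (v i)).trans (mul_le_mul_of_nonneg_left hi hD0)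
  have hcoef : ∀ b m k, Tendsto (fun i => coef H b m k (v i)) l (𝓝 (coef H b m k V)) :=
    fun b m k => hv _ (continuous_mode H b m k).aestronglyMeasurable
      ⟨1, Eventually.of_forall (abs_mode_le H b m k)⟩
  -- Weak convergence gives convergence of each coefficient. Dominated convergence is applied twice:
  -- over m with the inverse eigenvalues as majorant, then over k with the operator bounds.
  have hpart : ∀ k, Tendsto (fun i => energyPart H k (v i)) l (𝓝 (energyPart H k V)) := by
    intro k
    refine tendsto_tsum_of_dominated_convergence
      (bound := fun m => 2 / (L * H) * ((eig L H m k)⁻¹ * ((D * R) ^ 2 + (D * R) ^ 2)))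
      ((summable_greenTerm_bound hH k _).mul_left _) (fun m => ?_)
      (hDR.mono fun i hDRi m => ?_)
    · exact ((((hcoef true m k).pow 2).add ((hcoef false m k).pow 2)).const_mul _).const_mul _
    · rw [Real.norm_of_nonneg (energyTerm_nonneg hH m k _), energyTerm]
      have h1 := (eig_pos (L := L) hH m k).le
      have key : ∀ b, coef H b m k (v i) ^ 2 ≤ (D * R) ^ 2 := fun b => by
        rw [← sq_abs]
        have := (abs_coef_le (hi (v i)) b m k).trans hDRi
        gcongr
      have := key true
      have := key false
      gcongr
  have h2 : Tendsto (fun i => ∑' k, energyPart H k (v i)) l (𝓝 (∑' k, energyPart H k V)) := by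
    refine tendsto_tsum_of_dominated_convergence (bound := fun k => C k * R * (D * R))
      ((hC.mul_right R).mul_right _) hpart ((hR.and hDR).mono fun i hRi k => ?_)
    rw [energyPart, (hasSum_energyTerm hH k (hi (v i))).tsum_eq, Real.norm_eq_abs]
    have h1 : ∀ x, |greenOp H k (v i) x| ≤ C k * R := fun x =>
      (hb k (v i) (Lp.memLp _) x).trans (mul_le_mul_of_nonneg_left hRi.1 (hC0 k))
    have h3 : 0 ≤ C k * R := (abs_nonneg _).trans (h1 (0, 0))
    exact (abs_integral_mul_le (hi (v i)) (Eventually.of_forall h1)).trans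
      (mul_le_mul_of_nonneg_left hRi.2 h3)
  simp_rw [(hasSum_energy hH hp hp' _).tsum_eq] at h2
  have h3 := h2.const_mul (1 / 2)
  simpa using h3

end Energy

/-! ### The relaxed problem and compactness of maximizing families. -/

section Relaxation

variable {L H : ℝ} [hL : Fact (0 < L)] {p : ℝ≥0∞}

theorem measure_snd_mem_finite {S : Set ℝ} (hS : S.Finite) :
    channelMeasure L H {x | x.2 ∈ S} = 0 := by
  unfold channelMeasure
  refine Measure.quasiMeasurePreserving_snd.preimage_null ?_
  exact Measure.restrict_le_self.absolutelyContinuous (hS.measure_zero volume)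

/-- On every set of positive measure there is a nontrivial bounded function with vanishing mean
and vanishing impulse. -/
theorem exists_perturbation {A : Set (AddCircle L × ℝ)} (hA : MeasurableSet A)
    (hA0 : channelMeasure L H A ≠ 0) :
    ∃ g : AddCircle L × ℝ → ℝ, Measurable g ∧ (∀ x, |g x| ≤ 1) ∧ (∀ x, x ∉ A → g x = 0) ∧
      ∫ x, g x ∂(channelMeasure L H) = 0 ∧ ∫ x, x.2 * g x ∂(channelMeasure L H) = 0 ∧
      ¬ g =ᵐ[channelMeasure L H] 0 := by
  set μ := channelMeasure L H
  set A' : Set (AddCircle L × ℝ) := A ∩ {x | x.2 ∈ Ioo 0 H} with hA'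
  have hIm : MeasurableSet {x : AddCircle L × ℝ | x.2 ∈ Ioo 0 H} :=
    measurable_snd measurableSet_Ioo
  have hA'm : MeasurableSet A' := hA.inter hIm
  have hA'0 : μ A' ≠ 0 := by
    have : A' =ᵐ[μ] A := by
      filter_upwards [ae_channel_mem (L := L) (H := H)] with x hx
      exact propext ⟨fun h => h.1, fun h => ⟨h, hx⟩⟩
    rwa [measure_congr this]
  have hmon : ∀ j : ℕ, ∀ x, |A'.indicator (fun x => x.2 ^ j) x| ≤ |H| ^ j := by
    intro j x
    by_cases hx : x ∈ A'
    · rw [indicator_of_mem hx, abs_pow]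
      have h1 := hx.2.1
      have h2 := hx.2.2
      gcongr
    · rw [indicator_of_notMem hx, abs_zero]; positivity
  have hmm : ∀ j : ℕ, Measurable (A'.indicator fun x : AddCircle L × ℝ => x.2 ^ j) := fun j =>
    (measurable_snd.pow_const j).indicator hA'm
  have hmi : ∀ j : ℕ, Integrable (A'.indicator fun x : AddCircle L × ℝ => x.2 ^ j) μ := fun j =>
    Integrable.of_bound (hmm j).aestronglyMeasurable _ (Eventually.of_forall (hmon j))
  set a : ℕ → ℝ := fun j => ∫ x, A'.indicator (fun x : AddCircle L × ℝ => x.2 ^ j) x ∂μ with ha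
  -- Three coefficients of a quadratic polynomial in x₂ against two linear conditions, mean and
  -- impulse: the moment matrix has a nontrivial kernel.
  let T : (Fin 3 → ℝ) →ₗ[ℝ] (Fin 2 → ℝ) := Matrix.toLin'
    (Matrix.of fun (i : Fin 2) (j : Fin 3) => a (i + j : ℕ))
  have hker : LinearMap.ker T ≠ ⊥ := LinearMap.ker_ne_bot_of_finrank_lt (by simp)
  obtain ⟨c, hc, hc0⟩ := Submodule.exists_mem_ne_zero_of_ne_bot hker
  have hT : ∀ i, T c i = 0 := fun i => congrFun (LinearMap.mem_ker.1 hc) i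
  have hT0 := hT 0
  have hT1 := hT 1
  simp only [T, Matrix.toLin'_apply, Matrix.mulVec, dotProduct, Fin.sum_univ_three,
    Matrix.of_apply] at hT0 hT1
  norm_num at hT0 hT1
  set B := |c 0| + |c 1| * |H| + |c 2| * |H| ^ 2 + 1 with hB
  have hB0 : 0 < B := by positivity
  set g₀ : AddCircle L × ℝ → ℝ := fun x => c 0 * A'.indicator (fun x => x.2 ^ 0) x +
    c 1 * A'.indicator (fun x => x.2 ^ 1) x + c 2 * A'.indicator (fun x => x.2 ^ 2) x with hg₀
  have hij : ∀ (j : ℕ) (r : ℝ),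
      Integrable (fun x => r * A'.indicator (fun x : AddCircle L × ℝ => x.2 ^ j) x) μ :=
    fun j r => (hmi j).const_mul r
  have hij₂ : ∀ (j k : ℕ) (r s : ℝ), Integrable (fun x =>
      r * A'.indicator (fun x : AddCircle L × ℝ => x.2 ^ j) x +
        s * A'.indicator (fun x : AddCircle L × ℝ => x.2 ^ k) x) μ :=
    fun j k r s => (hij j r).add (hij k s)
  have hi0 : ∫ x, g₀ x ∂μ = 0 := by
    simp only [hg₀]
    rw [integral_add (hij₂ 0 1 _ _) (hij 2 _), integral_add (hij 0 _) (hij 1 _),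
      integral_const_mul, integral_const_mul, integral_const_mul]
    change c 0 * a 0 + c 1 * a 1 + c 2 * a 2 = 0
    linarith
  have hi1 : ∫ x, x.2 * g₀ x ∂μ = 0 := by
    have e : ∀ x : AddCircle L × ℝ, x.2 * g₀ x = c 0 * A'.indicator (fun x => x.2 ^ 1) x +
        c 1 * A'.indicator (fun x => x.2 ^ 2) x + c 2 * A'.indicator (fun x => x.2 ^ 3) x := by
      intro x
      simp only [hg₀]
      by_cases hx : x ∈ A'
      · simp only [indicator_of_mem hx]; ring
      · simp only [indicator_of_notMem hx]; ring
    simp_rw [e]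
    rw [integral_add (hij₂ 1 2 _ _) (hij 3 _), integral_add (hij 1 _) (hij 2 _),
      integral_const_mul, integral_const_mul, integral_const_mul]
    change c 0 * a 1 + c 1 * a 2 + c 2 * a 3 = 0
    linarith
  refine ⟨fun x => B⁻¹ * g₀ x, ?_, fun x => ?_, fun x hx => ?_, ?_, ?_, fun hz => hA'0 ?_⟩
  · exact measurable_const.mul ((((hmm 0).const_mul _).add ((hmm 1).const_mul _)).add
      ((hmm 2).const_mul _))
  · rw [abs_mul, abs_of_pos (inv_pos.2 hB0), inv_mul_le_iff₀ hB0, mul_one]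
    refine (abs_add_three _ _ _).trans ?_
    rw [abs_mul, abs_mul, abs_mul]
    have h0 := mul_le_mul_of_nonneg_left (hmon 0 x) (abs_nonneg (c 0))
    have h1 := mul_le_mul_of_nonneg_left (hmon 1 x) (abs_nonneg (c 1))
    have h2 := mul_le_mul_of_nonneg_left (hmon 2 x) (abs_nonneg (c 2))
    rw [pow_zero, mul_one] at h0
    rw [pow_one] at h1
    linarith
  · have : x ∉ A' := fun h => hx h.1
    simp [hg₀, indicator_of_notMem this]
  · rw [integral_const_mul, hi0, mul_zero]
  · simp_rw [mul_left_comm _ B⁻¹]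
    rw [integral_const_mul, hi1, mul_zero]
  -- A nonzero polynomial in x₂ vanishes only on finitely many horizontal circles, a null set, so
  -- the function is nontrivial on A.
  · let P : Polynomial ℝ := Polynomial.C (c 0) + Polynomial.C (c 1) * Polynomial.X +
      Polynomial.C (c 2) * Polynomial.X ^ 2
    have hP : P ≠ 0 := by
      intro hP
      refine hc0 (funext fun j => ?_)
      have h0 := congrArg (fun q => Polynomial.coeff q 0) hP
      have h1 := congrArg (fun q => Polynomial.coeff q 1) hP
      have h2 := congrArg (fun q => Polynomial.coeff q 2) hP
      simp [P, Polynomial.coeff_X, Polynomial.coeff_C] at h0 h1 h2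
      fin_cases j <;> simp [h0, h1, h2]
    have hfin : {t : ℝ | P.IsRoot t}.Finite := Polynomial.finite_setOfPred_isRoot hP
    have hnull := measure_snd_mem_finite (L := L) (H := H) hfin
    have hz' : ∀ᵐ x ∂μ, x.2 ∉ {t : ℝ | P.IsRoot t} := by
      rw [ae_iff]; simpa using hnull
    have : ∀ᵐ x ∂μ, x ∉ A' := by
      filter_upwards [hz, hz'] with x h1 h2 hx
      refine h2 ?_
      have h3 := (mul_eq_zero.1 h1).resolve_left (inv_pos.2 hB0).ne'
      simp only [hg₀, indicator_of_mem hx] at h3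
      change P.eval x.2 = 0
      simp only [P, Polynomial.eval_add, Polynomial.eval_mul, Polynomial.eval_C,
        Polynomial.eval_X, Polynomial.eval_pow]
      linarith
    rw [ae_iff] at this
    simpa using this

theorem Majorized.congr_left {X : Type*} [MeasurableSpace X] {μ : Measure X} {v v' w : X → ℝ}
    (h : Majorized μ v w) (hv : v =ᵐ[μ] v') : Majorized μ v' w where
  integrable_left := h.integrable_left.congr hv
  integrable_right := h.integrable_right
  integral_eq := by rw [← integral_congr_ae hv, h.integral_eq]
  stopLoss_le a := by
    refine le_trans (le_of_eq (integral_congr_ae ?_)) (h.stopLoss_le a)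
    filter_upwards [hv] with x hx
    rw [hx]

theorem WeakTendsto.congr_right {X ι : Type*} [MeasurableSpace X] {μ : Measure X} {l : Filter ι}
    {f : ι → X → ℝ} {v v' : X → ℝ} (h : WeakTendsto μ f l v) (hv : v =ᵐ[μ] v') :
    WeakTendsto μ f l v' := by
  intro g hg hb
  have e : ∫ x, v x * g x ∂μ = ∫ x, v' x * g x ∂μ := integral_congr_ae (by
    filter_upwards [hv] with x hx
    rw [hx])
  rw [← e]
  exact h g hg hb

theorem ae_abs_snd_le : ∀ᵐ x ∂(channelMeasure L H), |x.2| ≤ H := by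
  filter_upwards [ae_channel_mem] with x hx
  rw [abs_of_pos hx.1]
  exact hx.2.le

theorem aestronglyMeasurable_snd' :
    AEStronglyMeasurable (fun x : AddCircle L × ℝ => x.2) (channelMeasure L H) :=
  measurable_snd.aestronglyMeasurable

theorem impulse_eq (v : LpChannel L H p) :
    impulse v = ∫ x, v x * x.2 ∂(channelMeasure L H) := by
  simp only [impulse, mul_comm]

theorem WeakTendsto.impulse {ι : Type*} {l : Filter ι} {v : ι → LpChannel L H p}
    {V : LpChannel L H p} (h : WeakTendsto (channelMeasure L H) (fun i => v i) l V) :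
    Tendsto (fun i => impulse (v i)) l (𝓝 (impulse V)) := by
  simp_rw [impulse_eq]
  exact h _ aestronglyMeasurable_snd' ⟨H, ae_abs_snd_le⟩

theorem impulse_add_toLp [Fact (1 ≤ p)] (v : LpChannel L H p) {g : AddCircle L × ℝ → ℝ}
    (hg : MemLp g p (channelMeasure L H)) (h0 : ∫ x, x.2 * g x ∂(channelMeasure L H) = 0) :
    impulse (v + hg.toLp g) = impulse v := by
  rw [impulse_eq, impulse_eq]
  have e : ∫ x, (v + hg.toLp g : LpChannel L H p) x * x.2 ∂(channelMeasure L H) =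
      ∫ x, (v x * x.2 + g x * x.2) ∂(channelMeasure L H) := by
    refine integral_congr_ae ?_
    filter_upwards [Lp.coeFn_add v (hg.toLp g), hg.coeFn_toLp] with x h1 h2
    rw [h1, Pi.add_apply, h2, add_mul]
  rw [e, integral_add (integrable_mul_of_ae_bdd ((Lp.memLp v).integrable Fact.out)
    aestronglyMeasurable_snd' ae_abs_snd_le) (integrable_mul_of_ae_bdd (hg.integrable Fact.out)
    aestronglyMeasurable_snd' ae_abs_snd_le)]
  simp_rw [mul_comm (g _)]
  rw [h0, add_zero]

/-- The convex relaxation of `ℛ_w ∩ ℐ_w`. -/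
def relaxedClass (w : LpChannel L H p) : Set (LpChannel L H p) :=
  {v | Majorized (channelMeasure L H) v w ∧ impulse v = impulse w}

theorem identDistrib_of_mem_rearrangementClass {v w : LpChannel L H p}
    (h : v ∈ rearrangementClass w) :
    IdentDistrib v w (channelMeasure L H) (channelMeasure L H) :=
  identDistrib_of_measure_lt_eq (Lp.aestronglyMeasurable v).aemeasurable
    (Lp.aestronglyMeasurable w).aemeasurable h

theorem norm_le_of_majorized (hp : 1 < p) (hp' : p < ⊤) {v w : LpChannel L H p}
    (h : Majorized (channelMeasure L H) v w) : ‖v‖ ≤ ‖w‖ := by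
  rw [Lp.norm_def, Lp.norm_def]
  exact ENNReal.toReal_mono (Lp.memLp w).2.ne (h.eLpNorm_le hp hp')

theorem maximizers_eq_of_mem {v w : LpChannel L H p}
    (hv : v ∈ rearrangementClass w ∩ impulseClass w) : maximizers v = maximizers w := by
  have h1 : rearrangementClass v = rearrangementClass w := by
    ext u
    exact forall_congr' fun a => by rw [hv.1 a]
  have h2 : impulseClass v = impulseClass w := by
    ext u
    change impulse u = impulse v ↔ impulse u = impulse w
    rw [show impulse v = impulse w from hv.2]
  unfold maximizers
  rw [h1, h2]

theorem energy_eq_of_mem_maximizers {u v w : LpChannel L H p} (hu : u ∈ maximizers w)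
    (hv : v ∈ maximizers w) : energy u = energy v :=
  le_antisymm (hv.2 u hu.1) (hu.2 v hv.1)

variable [Fact (1 ≤ p)]

theorem majorized_of_mem_rearrangementClass {v w : LpChannel L H p}
    (h : v ∈ rearrangementClass w) : Majorized (channelMeasure L H) v w :=
  majorized_of_identDistrib (identDistrib_of_mem_rearrangementClass h)
    ((Lp.memLp w).integrable Fact.out)

theorem mem_relaxedClass_of_mem {v w : LpChannel L H p}
    (h : v ∈ rearrangementClass w ∩ impulseClass w) : v ∈ relaxedClass w :=
  ⟨majorized_of_mem_rearrangementClass h.1, h.2⟩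

/-- A maximizer of the energy over the relaxed class is a rearrangement. -/
theorem mem_rearrangementClass_of_isMax (hH : 0 < H) (hp : 1 < p) (hp' : p < ⊤)
    {v w : LpChannel L H p} (hv : v ∈ relaxedClass w)
    (hmax : ∀ u ∈ relaxedClass w, energy u ≤ energy v) : v ∈ rearrangementClass w := by
  set μ := channelMeasure L H
  have hmaj : Majorized μ v w := hv.1
  by_contra hnot
  have hne : ∃ a, stopLoss μ v a ≠ stopLoss μ w a := by
    by_contra! hcon
    exact hnot fun a =>
      measure_lt_eq_of_stopLoss_eq hmaj.integrable_left hmaj.integrable_right hcon a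
  obtain ⟨a, r, η, hr, hη, hslack, hpos⟩ := hmaj.exists_slack hne
  have hAm : MeasurableSet {x | |v x - a| < r} :=
    measurableSet_lt ((Lp.stronglyMeasurable v).measurable.sub_const a).abs measurable_const
  obtain ⟨g, hgm, hg1, hgA, hg0, hgI, hgne⟩ := exists_perturbation hAm hpos
  -- The first bound keeps the perturbation pointwise below r, the second keeps its `L¹` norm below
  -- η, as `Majorized.add_of_slack` requires.
  set c := min r (η / (μ.real univ + 1)) with hc
  have hm0 : 0 ≤ μ.real univ := measureReal_nonneg
  have hc0 : 0 < c := lt_min hr (by positivity)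
  have key : ∀ s : ℝ, |s| = c → ∀ hm : MemLp (fun x => s * g x) p μ,
      v + hm.toLp _ ∈ relaxedClass w := by
    intro s hs hm
    have hb : ∀ x, |s * g x| ≤ c := fun x => by
      rw [abs_mul, hs]; exact mul_le_of_le_one_right hc0.le (hg1 x)
    have hmi : Integrable (fun x => s * g x) μ := hm.integrable Fact.out
    refine ⟨?_, ?_⟩
    · have h1 := hmaj.add_of_slack hslack hmi (fun x => (hb x).trans (min_le_left _ _))
        (fun x hx => by rw [hgA x hx, mul_zero]) (by rw [integral_const_mul, hg0, mul_zero]) (by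
          calc ∫ x, |s * g x| ∂μ ≤ ∫ _, c ∂μ :=
                integral_mono hmi.abs (integrable_const c) hb
            _ = μ.real univ * c := by simp
            _ ≤ (μ.real univ + 1) * (η / (μ.real univ + 1)) :=
                mul_le_mul (by linarith) (min_le_right _ _) hc0.le (by linarith)
            _ = η := by field_simp)
      refine h1.congr_left ?_
      filter_upwards [Lp.coeFn_add v (hm.toLp _), hm.coeFn_toLp] with x h1 h2
      rw [h1, Pi.add_apply, h2]
    · rw [impulse_add_toLp v hm, hv.2]
      simp_rw [mul_left_comm _ s]
      rw [integral_const_mul, hgI, mul_zero]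
  have hmem : ∀ s : ℝ, MemLp (fun x => s * g x) p μ := fun s =>
    (MemLp.of_bound hgm.aestronglyMeasurable 1 (Eventually.of_forall hg1)).const_mul s
  have hplus := hmax _ (key c (abs_of_pos hc0) (hmem c))
  have hminus := hmax _ (key (-c) (by rw [abs_neg, abs_of_pos hc0]) (hmem (-c)))
  have e : v + (hmem (-c)).toLp _ = v - (hmem c).toLp _ := by
    rw [sub_eq_add_neg, ← MemLp.toLp_neg]
    congr 2
    funext x
    simp
  rw [e] at hminus
  -- Both perturbations are admissible and neither increases the energy, so the perturbation has
  -- nonpositive energy and must vanish.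
  have hpar := energy_parallelogram hH hp hp' v ((hmem c).toLp _)
  have hzero := eq_zero_of_energy_nonpos hH hp hp' (h := (hmem c).toLp _) (by linarith)
  refine hgne ?_
  filter_upwards [(hmem c).coeFn_toLp, (Lp.eq_zero_iff_ae_eq_zero).1 hzero] with x h1 h2
  rw [h1] at h2
  exact (mul_eq_zero.1 h2).resolve_left hc0.ne'

/-- Weak compactness in `L^p` for families majorized by a convergent family. -/
theorem exists_weakLimit_Lp (hp : 1 < p) (hp' : p < ⊤) {ι : Type*} (𝓤 : Ultrafilter ι)
    {v w : ι → LpChannel L H p} {W : LpChannel L H p}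
    (hvw : ∀ i, Majorized (channelMeasure L H) (v i) (w i)) (hw : Tendsto w 𝓤 (𝓝 W)) :
    ∃ V : LpChannel L H p, Majorized (channelMeasure L H) V W ∧
      WeakTendsto (channelMeasure L H) (fun i => v i) 𝓤 V := by
  obtain ⟨V, hV, hweak⟩ := exists_majorized_weakLimit 𝓤 hvw ((Lp.memLp W).integrable Fact.out)
    (tendsto_L1_of_tendsto_Lp hw)
  have hm : MemLp V p (channelMeasure L H) := hV.memLp hp hp' (Lp.memLp W)
  exact ⟨hm.toLp V, hV.congr_left hm.coeFn_toLp.symm, hweak.congr_right hm.coeFn_toLp.symm⟩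

/-- The direct method. The superlevel sets of the energy at attained values are nested; an
ultrafilter refining them plays the role of a maximizing sequence, and its weak limit dominates
every competitor. -/
theorem exists_isMax_relaxedClass (hH : 0 < H) (hp : 1 < p) (hp' : p < ⊤) (w : LpChannel L H p) :
    ∃ v ∈ relaxedClass w, ∀ u ∈ relaxedClass w, energy u ≤ energy v := by
  have hw : w ∈ relaxedClass w := mem_relaxedClass_of_mem ⟨fun _ => rfl, rfl⟩
  have : Nonempty (relaxedClass w) := ⟨⟨w, hw⟩⟩
  let F : relaxedClass w → Filter (relaxedClass w) := fun u =>
    𝓟 {v | energy u.1 ≤ energy v.1}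
  have hF : (⨅ u, F u).NeBot := by
    refine iInf_neBot_of_directed (fun u u' => ?_) fun u => principal_neBot_iff.2
      ⟨u, show energy u.1 ≤ energy u.1 from le_rfl⟩
    rcases le_total (energy u.1) (energy u'.1) with h | h
    · exact ⟨u', principal_mono.2 fun v hv => h.trans hv, le_rfl⟩
    · exact ⟨u, le_rfl, principal_mono.2 fun v hv => h.trans hv⟩
  let 𝓤 : Ultrafilter (relaxedClass w) := Ultrafilter.of (⨅ u, F u)
  have h𝓤 : ∀ u : relaxedClass w, ∀ᶠ v in (𝓤 : Filter (relaxedClass w)),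
      energy u.1 ≤ energy v.1 := fun u =>
    (Ultrafilter.of_le (⨅ u, F u)).trans (iInf_le F u) (mem_principal_self _)
  obtain ⟨V, hV, hweak⟩ := exists_weakLimit_Lp hp hp' 𝓤 (v := fun u => u.1) (w := fun _ => w)
    (fun u => u.2.1) tendsto_const_nhds
  have hI : impulse V = impulse w := by
    refine tendsto_nhds_unique hweak.impulse (tendsto_const_nhds.congr fun u => ?_)
    exact u.2.2.symm
  have hE := tendsto_energy_of_weakTendsto hH hp hp' (R := ‖w‖)
    (Eventually.of_forall fun u : relaxedClass w => norm_le_of_majorized hp hp' u.2.1) hweak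
  exact ⟨V, ⟨hV, hI⟩, fun u hu => ge_of_tendsto hE (h𝓤 ⟨u, hu⟩)⟩

theorem maximizers_nonempty (hH : 0 < H) (hp : 1 < p) (hp' : p < ⊤) (w : LpChannel L H p) :
    (maximizers w).Nonempty := by
  obtain ⟨v, hv, hmax⟩ := exists_isMax_relaxedClass hH hp hp' w
  exact ⟨v, ⟨mem_rearrangementClass_of_isMax hH hp hp' hv hmax, hv.2⟩,
    fun u hu => hmax u (mem_relaxedClass_of_mem hu)⟩

/-- Relaxation does not raise the maximum, since a relaxed maximizer already belongs to the original
constraint set. -/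
theorem energy_le_of_mem_maximizers (hH : 0 < H) (hp : 1 < p) (hp' : p < ⊤)
    {u v w : LpChannel L H p} (hv : v ∈ maximizers w) (hu : u ∈ relaxedClass w) :
    energy u ≤ energy v := by
  obtain ⟨v₀, hv₀, hmax⟩ := exists_isMax_relaxedClass hH hp hp' w
  exact (hmax u hu).trans
    (hv.2 v₀ ⟨mem_rearrangementClass_of_isMax hH hp hp' hv₀ hmax, hv₀.2⟩)

/-- The compactness of maximizing families. -/
theorem exists_tendsto_maximizer (hH : 0 < H) (hp : 1 < p) (hp' : p < ⊤) {ι : Type*}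
    (𝓤 : Ultrafilter ι) {v w : ι → LpChannel L H p} {W : LpChannel L H p}
    (hW : W ∈ maximizers W) (hvw : ∀ i, v i ∈ rearrangementClass (w i))
    (hw : Tendsto w 𝓤 (𝓝 W)) (hI : Tendsto (fun i => impulse (v i)) 𝓤 (𝓝 (impulse W)))
    (hE : Tendsto (fun i => energy (v i)) 𝓤 (𝓝 (energy W))) :
    ∃ V ∈ maximizers W, Tendsto v 𝓤 (𝓝 V) := by
  obtain ⟨V, hV, hweak⟩ := exists_weakLimit_Lp hp hp' 𝓤
    (fun i => majorized_of_mem_rearrangementClass (hvw i)) hw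
  have hVI : impulse V = impulse W := tendsto_nhds_unique hweak.impulse hI
  have hR : ∀ᶠ i in (𝓤 : Filter ι), ‖v i‖ ≤ ‖W‖ + 1 := by
    filter_upwards [hw.norm.eventually_le_const (show ‖W‖ < ‖W‖ + 1 by linarith)] with i hi
    exact (norm_le_of_majorized hp hp' (majorized_of_mem_rearrangementClass (hvw i))).trans hi
  have hVE : energy V = energy W :=
    tendsto_nhds_unique (tendsto_energy_of_weakTendsto hH hp hp' hR hweak) hE
  -- The weak limit has the energy of the maximizer W, which is also the relaxed maximum. It is
  -- therefore a rearrangement of W, and this upgrades weak convergence to strong.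
  have hmax : ∀ u ∈ relaxedClass W, energy u ≤ energy V := fun u hu =>
    (energy_le_of_mem_maximizers hH hp hp' hW hu).trans hVE.ge
  have hVR := mem_rearrangementClass_of_isMax hH hp hp' ⟨hV, hVI⟩ hmax
  refine ⟨V, ⟨⟨hVR, hVI⟩, fun u hu => hmax u (mem_relaxedClass_of_mem hu)⟩, ?_⟩
  exact tendsto_of_weakTendsto_of_identDistrib hp'.ne
    (fun i => identDistrib_of_mem_rearrangementClass (hvw i))
    (identDistrib_of_mem_rearrangementClass hVR) hw hweak

theorem isCompact_maximizers (hH : 0 < H) (hp : 1 < p) (hp' : p < ⊤) (w : LpChannel L H p) :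
    IsCompact (maximizers w) := by
  classical
  obtain ⟨W, hW⟩ := maximizers_nonempty hH hp hp' w
  have hWw := maximizers_eq_of_mem hW.1
  rw [isCompact_iff_ultrafilter_le_nhds]
  intro f hf
  have hfM : ∀ᶠ u in (f : Filter (LpChannel L H p)), u ∈ maximizers w := le_principal_iff.1 hf
  -- The compactness theorem asks for a family lying in the class at every index, so the identity is
  -- replaced by a fixed maximizer off ℳ; the ultrafilter does not see the change.
  let v : LpChannel L H p → LpChannel L H p := fun u => if u ∈ maximizers w then u else W
  have hv : ∀ u, v u ∈ maximizers w := fun u => by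
    simp only [v]; split_ifs with h
    · exact h
    · exact hW
  obtain ⟨V, hV, hlim⟩ := exists_tendsto_maximizer hH hp hp' f (v := v) (w := fun _ => W) (W := W)
    (hWw ▸ hW) (fun u a => by rw [(hv u).1.1 a, hW.1.1 a]) tendsto_const_nhds
    (tendsto_const_nhds.congr fun u => ((hv u).1.2.trans hW.1.2.symm).symm)
    (tendsto_const_nhds.congr fun u => energy_eq_of_mem_maximizers hW (hv u))
  refine ⟨V, hWw ▸ hV, ?_⟩
  have : Tendsto id (f : Filter (LpChannel L H p)) (𝓝 V) := hlim.congr' (by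
    filter_upwards [hfM] with u hu
    simp [v, hu])
  exact this

theorem tendsto_energy {ι : Type*} {l : Filter ι} (hH : 0 < H) (hp : 1 < p) (hp' : p < ⊤)
    {v : ι → LpChannel L H p} {V : LpChannel L H p} (h : Tendsto v l (𝓝 V)) :
    Tendsto (fun i => energy (v i)) l (𝓝 (energy V)) ∧
      Tendsto (fun i => impulse (v i)) l (𝓝 (impulse V)) := by
  have hi : ∀ f : LpChannel L H p, Integrable f (channelMeasure L H) := fun f =>
    (Lp.memLp f).integrable Fact.out
  have hweak : WeakTendsto (channelMeasure L H) (fun i => v i) l V := by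
    rintro g hg ⟨C, hC⟩
    rw [tendsto_iff_norm_sub_tendsto_zero]
    have h1 := (tendsto_L1_of_tendsto_Lp h).const_mul C
    rw [mul_zero] at h1
    refine squeeze_zero (fun i => norm_nonneg _) (fun i => ?_) h1
    rw [← integral_sub (integrable_mul_of_ae_bdd (hi _) hg hC)
      (integrable_mul_of_ae_bdd (hi _) hg hC)]
    simp_rw [← sub_mul]
    exact abs_integral_mul_le ((hi (v i)).sub (hi V)) hC
  exact ⟨tendsto_energy_of_weakTendsto hH hp hp' (R := ‖V‖ + 1)
    (h.norm.eventually_le_const (by linarith)) hweak, hweak.impulse⟩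

end Relaxation

/-! ### Stability of the set of maximizers and of its isolated subsets. -/

section Stability

variable {L H : ℝ} [hL : Fact (0 < L)] {p : ℝ≥0∞} [Fact (1 ≤ p)]

theorem exists_isMinDist {A : Set (LpChannel L H p)} (hA : IsCompact A) (hne : A.Nonempty)
    (u : LpChannel L H p) : ∃ m, IsMinDist A u m :=
  (hA.image (by fun_prop : Continuous fun v => ‖u - v‖)).exists_isLeast (hne.image _)

theorem exists_isMinDist_lt_iff {A : Set (LpChannel L H p)} (hA : IsCompact A)
    {u : LpChannel L H p} {δ : ℝ} :
    (∃ m < δ, IsMinDist A u m) ↔ ∃ v ∈ A, ‖u - v‖ < δ := by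
  constructor
  · rintro ⟨m, hm, ⟨v, hv, rfl⟩, -⟩
    exact ⟨v, hv, hm⟩
  · rintro ⟨v, hv, hlt⟩
    obtain ⟨m, hm⟩ := exists_isMinDist hA ⟨v, hv⟩ u
    exact ⟨m, (hm.2 ⟨v, hv, rfl⟩).trans_lt hlt, hm⟩

/-- Otherwise initial data approaching ℳ would leave its ε-neighbourhood at certain times.
Compactness of ℳ gives a limit U of the data; the later states are rearrangements of the data with
the same energy and impulse, so along the ultrafilter they converge to an element of ℳ. Continuity
in time plays no role. -/
theorem stability_maximizers (hH : 0 < H) (hp : 1 < p) (hp' : p < ⊤) (w : LpChannel L H p)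
    {ε : ℝ} (hε : 0 < ε) : ∃ δ > 0, ∀ ζ : ℝ → LpChannel L H p, IsAdmissible ζ →
      (∃ v ∈ maximizers w, ‖ζ 0 - v‖ < δ) → ∀ t, ∃ v ∈ maximizers w, ‖ζ t - v‖ < ε := by
  by_contra! hcon
  have hδ : ∀ n : ℕ, (0 : ℝ) < 1 / ((n : ℝ) + 1) := fun n => by positivity
  choose ζ hζ hnear t ht using fun n : ℕ => hcon _ (hδ n)
  choose u hu hud using hnear
  let 𝓤 : Ultrafilter ℕ := hyperfilter ℕ
  have h𝓤 : (𝓤 : Filter ℕ) ≤ atTop := by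
    rw [← Nat.cofinite_eq_atTop]; exact hyperfilter_le_cofinite
  obtain ⟨U, hU, hulim⟩ := (isCompact_maximizers hH hp hp' w).ultrafilter_le_nhds (𝓤.map u) (by
    rw [Ultrafilter.coe_map, le_principal_iff, mem_map]
    exact univ_mem' hu)
  have hulim : Tendsto u 𝓤 (𝓝 U) := hulim
  have hlim : Tendsto (fun n => ζ n 0) 𝓤 (𝓝 U) := by
    have h1 : Tendsto (fun n => ζ n 0 - u n) 𝓤 (𝓝 0) := by
      rw [tendsto_zero_iff_norm_tendsto_zero]
      exact squeeze_zero (fun n => norm_nonneg _) (fun n => (hud n).le)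
        (tendsto_one_div_add_atTop_nhds_zero_nat.mono_left h𝓤)
    have h2 := h1.add hulim
    simpa using h2
  obtain ⟨hEl, hIl⟩ := tendsto_energy hH hp hp' hlim
  have hUw := maximizers_eq_of_mem hU.1
  obtain ⟨V, hV, hVlim⟩ := exists_tendsto_maximizer hH hp hp' 𝓤 (v := fun n => ζ n (t n))
    (w := fun n => ζ n 0) (W := U) (hUw ▸ hU) (fun n => (hζ n).rearrangement (t n)) hlim
    (hIl.congr fun n => ((hζ n).impulse_eq (t n)).symm)
    (hEl.congr fun n => ((hζ n).energy_eq (t n)).symm)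
  rw [hUw] at hV
  have h3 := (tendsto_iff_norm_sub_tendsto_zero.1 hVlim).eventually_lt_const hε
  obtain ⟨n, hn⟩ := h3.exists
  exact absurd (ht n V hV) (not_le.2 hn)

/-- The isolated set is M with open balls of radius c around the remaining points removed, hence
closed in a compact set. -/
theorem isCompact_of_isolated {M S : Set (LpChannel L H p)} (hM : IsCompact M) (hSM : S ⊆ M)
    {c : ℝ} (hc : 0 < c) (hiso : ∀ v₁ ∈ S, ∀ v₂ ∈ M \ S, c ≤ ‖v₁ - v₂‖) : IsCompact S := by
  have e : S = M \ ⋃ v₂ ∈ M \ S, Metric.ball v₂ c := by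
    ext v
    simp only [Set.mem_sdiff, mem_iUnion, Metric.mem_ball, exists_prop, not_exists, not_and, not_lt,
      and_imp, dist_eq_norm]
    refine ⟨fun hv => ⟨hSM hv, fun v₂ h1 h2 => hiso v hv v₂ ⟨h1, h2⟩⟩, fun ⟨hvM, h⟩ => ?_⟩
    by_contra hvS
    have := h v hvM hvS
    rw [sub_self, norm_zero] at this
    linarith
  rw [e]
  exact hM.diff (isOpen_biUnion fun _ _ => Metric.isOpen_ball)

/-- When 2ε ≤ c the ε-neighbourhoods of S and of its complement in M are disjoint. They are open and
cover the orbit, so connectedness of ℝ keeps it in the one where it started. -/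
theorem stability_isolated {M S : Set (LpChannel L H p)} {c : ℝ}
    (hiso : ∀ v₁ ∈ S, ∀ v₂ ∈ M \ S, c ≤ ‖v₁ - v₂‖) {ε : ℝ} (hεc : 2 * ε ≤ c)
    {ζ : ℝ → LpChannel L H p} (hζ : Continuous ζ) (h0 : ∃ v ∈ S, ‖ζ 0 - v‖ < ε)
    (hall : ∀ t, ∃ v ∈ M, ‖ζ t - v‖ < ε) (t : ℝ) : ∃ v ∈ S, ‖ζ t - v‖ < ε := by
  have hopen : ∀ A : Set (LpChannel L H p), IsOpen {t | ∃ v ∈ A, ‖ζ t - v‖ < ε} := by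
    intro A
    have : {t | ∃ v ∈ A, ‖ζ t - v‖ < ε} = ⋃ v ∈ A, {t | ‖ζ t - v‖ < ε} := by
      ext t; simp
    rw [this]
    exact isOpen_biUnion fun v _ => isOpen_lt (by fun_prop) continuous_const
  have hcompl : {t | ∃ v ∈ S, ‖ζ t - v‖ < ε} = {t | ∃ v ∈ M \ S, ‖ζ t - v‖ < ε}ᶜ := by
    ext s
    constructor
    · rintro ⟨v₁, h1, h1'⟩ ⟨v₂, h2, h2'⟩
      have h3 := hiso v₁ h1 v₂ h2
      have h4 : ‖v₁ - v₂‖ ≤ ‖ζ s - v₁‖ + ‖ζ s - v₂‖ := by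
        rw [norm_sub_rev (ζ s) v₁]
        exact norm_sub_le_norm_sub_add_norm_sub _ _ _
      linarith
    · intro hs
      obtain ⟨v, hv, hlt⟩ := hall s
      by_cases hvS : v ∈ S
      · exact ⟨v, hvS, hlt⟩
      · exact absurd ⟨v, ⟨hv, hvS⟩, hlt⟩ hs
  have hclopen : IsClopen {t | ∃ v ∈ S, ‖ζ t - v‖ < ε} :=
    ⟨by rw [hcompl]; exact (hopen _).isClosed_compl, hopen S⟩
  have huniv := (isClopen_iff.1 hclopen).resolve_left (Set.nonempty_iff_ne_empty.1 ⟨0, h0⟩)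
  exact eq_univ_iff_forall.1 huniv t

end Stability

end PeriodicChannel

end

open PeriodicChannel in
theorem mainTheorem3 (L H : ℝ) [Fact (0 < L)] (hH : 0 < H)
    (p : ℝ≥0∞) [Fact (1 ≤ p)] (hp : 1 < p) (hp' : p < ⊤) (w : LpChannel L H p) :
    -- the minimal distance to `ℳ` is attained, so that the minima in the criterion make sense
    (∀ u : LpChannel L H p, ∃ m, IsMinDist (maximizers w) u m) ∧
    -- stability of `ℳ` under admissible maps
    (∀ ε > 0, ∃ δ > 0, ∀ ζ : ℝ → LpChannel L H p, IsAdmissible ζ →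
      (∃ m < δ, IsMinDist (maximizers w) (ζ 0) m) →
        ∀ t, ∃ m < ε, IsMinDist (maximizers w) (ζ t) m) ∧
    -- stability of isolated nonempty subsets of `ℳ` under continuous admissible maps
    (∀ S ⊆ maximizers w, S.Nonempty →
      (∃ c > 0, ∀ v₁ ∈ S, ∀ v₂ ∈ maximizers w \ S, c ≤ ‖v₁ - v₂‖) →
      (∀ u : LpChannel L H p, ∃ m, IsMinDist S u m) ∧
      (∀ ε > 0, ∃ δ > 0, ∀ ζ : ℝ → LpChannel L H p, IsAdmissible ζ → Continuous ζ →
        (∃ m < δ, IsMinDist S (ζ 0) m) →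
          ∀ t, ∃ m < ε, IsMinDist S (ζ t) m)) := by
  have hM := isCompact_maximizers hH hp hp' w
  have hne := maximizers_nonempty hH hp hp' w
  refine ⟨exists_isMinDist hM hne, fun ε hε => ?_, fun S hSM hSne ⟨c, hc, hiso⟩ => ?_⟩
  · simp only [exists_isMinDist_lt_iff hM]
    exact stability_maximizers hH hp hp' w hε
  · have hS := isCompact_of_isolated hM hSM hc hiso
    refine ⟨exists_isMinDist hS hSne, fun ε hε => ?_⟩
    simp only [exists_isMinDist_lt_iff hS]
    -- The cap c/2 is what makes the neighbourhoods of S and of its complement in ℳ disjoint.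
    obtain ⟨δ, hδ, hstab⟩ := stability_maximizers hH hp hp' w
      (lt_min hε (show 0 < c / 2 by linarith))
    refine ⟨min δ (min ε (c / 2)), lt_min hδ (lt_min hε (by linarith)), ?_⟩
    rintro ζ hζ hcont ⟨v, hv, hlt⟩ t
    have hall := hstab ζ hζ ⟨v, hSM hv, hlt.trans_le (min_le_left _ _)⟩
    obtain ⟨u, hu, hut⟩ := stability_isolated hiso
      (by linarith [min_le_right ε (c / 2)]) hcont ⟨v, hv, hlt.trans_le (min_le_right _ _)⟩ hall t
    exact ⟨u, hu, hut.trans_le (min_le_left _ _)⟩
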